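/- Consider the problem Steiner Forest: given a finite (unweighted, undirected, simple) graph $G$, a set $S\subseteq V(G)\times V(G)$ of terminal pairs and an integer $\ell\ge 0$, decide whether $(G,S)$ has a Steiner forest $F$ with $|E(F)|\le \ell$. Here a Steiner forest of $(G,S)$ is a subgraph $F$ of $G$ such that for every $(s,t)\in S$ the vertices $s$ and $t$ belong to the same connected component of $F$. Theorem. Steiner Forest is fixed-parameter tractable when parameterized by the vertex cover number $k$ of the input graph (neither $k$ nor a vertex cover is given as part of the input). More precisely, Steiner Forest can be decided in time $2^{O(k\log k)}\, n^{O(1)}$, where $n=|V(G)|$; and, given $(G,S)$, one can also compute in time $2^{O(k\log k)}\, n^{O(1)}$ a Steiner forest of $(G,S)$ with the minimum number of edges, or report that $(G,S)$ has no Steiner forest. (Running times count the steps of a random access machine with addition and subtraction; $n^{O(1)}$ means at most $c\,(n+1)^c$ for a constant $c$.) -/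

import Mathlib

/-! ### A random access machine with step count

Programs are structured (`while`) programs over finitely many registers and finitely many unbounded
arrays of natural numbers, with indirect addressing into the arrays.  The only arithmetic is
addition and truncated subtraction, so that `t` steps lengthen the binary representations of the
numbers by at most `t` bits beyond those of the input and of the constants of the program, and the
unit-cost measure below is polynomially related to Turing machine time. -/

namespace RAM

/-- A machine state: the registers and the arrays.  Every program mentions only finitely many
registers and arrays, since neither can be addressed indirectly (array cells can). -/
structure State where
  reg : ℕ → ℕ
  arr : ℕ → ℕ → ℕ

/-- Arithmetic expressions. -/
inductive Expr where
  /-- a constant -/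
  | lit (a : ℕ) : Expr
  /-- the content of a register -/
  | reg (x : ℕ) : Expr
  /-- addition -/
  | add (e f : Expr) : Expr
  /-- truncated subtraction -/
  | sub (e f : Expr) : Expr
  /-- the content of the cell of array `a` whose index is the value of `e` -/
  | read (a : ℕ) (e : Expr) : Expr

/-- The value of an expression. -/
def Expr.eval (s : State) : Expr → ℕ
  | .lit a => a
  | .reg x => s.reg x
  | .add e f => e.eval s + f.eval s
  | .sub e f => e.eval s - f.eval s
  | .read a e => s.arr a (e.eval s)

/-- The number of steps needed to evaluate an expression: one for each symbol. -/
def Expr.cost : Expr → ℕ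
  | .lit _ => 1
  | .reg _ => 1
  | .add e f => e.cost + f.cost + 1
  | .sub e f => e.cost + f.cost + 1
  | .read _ e => e.cost + 1

/-- Programs. -/
inductive Prog where
  /-- do nothing -/
  | skip : Prog
  /-- store the value of `e` in register `x` -/
  | assign (x : ℕ) (e : Expr) : Prog
  /-- store the value of `e` in the cell of array `a` whose index is the value of `i` -/
  | write (a : ℕ) (i e : Expr) : Prog
  /-- run `p`, then `q` -/
  | seq (p q : Prog) : Prog
  /-- run `p` if the value of `e` is nonzero, and `q` otherwise -/
  | ite (e : Expr) (p q : Prog) : Prog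
  /-- run `p` as long as the value of `e` is nonzero -/
  | loop (e : Expr) (p : Prog) : Prog

/-- The state after storing `v` in register `x`. -/
def State.setReg (s : State) (x v : ℕ) : State :=
  { s with reg := Function.update s.reg x v }

/-- The state after storing `v` in cell `i` of array `a`. -/
def State.setArr (s : State) (a i v : ℕ) : State :=
  { s with arr := Function.update s.arr a (Function.update (s.arr a) i v) }

/-- `Exec p s s' t`: started in state `s`, the program `p` halts in state `s'` after exactly `t`
steps. -/
inductive Exec : Prog → State → State → ℕ → Prop
  | skip (s : State) : Exec .skip s s 1
  | assign (s : State) (x : ℕ) (e : Expr) :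
      Exec (.assign x e) s (s.setReg x (e.eval s)) (e.cost + 1)
  | write (s : State) (a : ℕ) (i e : Expr) :
      Exec (.write a i e) s (s.setArr a (i.eval s) (e.eval s)) (i.cost + e.cost + 1)
  | seq {p q : Prog} {s s₁ s₂ : State} {t₁ t₂ : ℕ} :
      Exec p s s₁ t₁ → Exec q s₁ s₂ t₂ → Exec (.seq p q) s s₂ (t₁ + t₂)
  | iteTrue {e : Expr} {p q : Prog} {s s₁ : State} {t : ℕ} :
      e.eval s ≠ 0 → Exec p s s₁ t → Exec (.ite e p q) s s₁ (e.cost + 1 + t)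
  | iteFalse {e : Expr} {p q : Prog} {s s₁ : State} {t : ℕ} :
      e.eval s = 0 → Exec q s s₁ t → Exec (.ite e p q) s s₁ (e.cost + 1 + t)
  | loopTrue {e : Expr} {p : Prog} {s s₁ s₂ : State} {t₁ t₂ : ℕ} :
      e.eval s ≠ 0 → Exec p s s₁ t₁ → Exec (.loop e p) s₁ s₂ t₂ →
      Exec (.loop e p) s s₂ (e.cost + 1 + t₁ + t₂)
  | loopFalse {e : Expr} {p : Prog} {s : State} :
      e.eval s = 0 → Exec (.loop e p) s s (e.cost + 1)

/-- The initial state on input `x`: register `0` holds the length of `x`, array `0` holds `x`, and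
everything else is `0`. -/
def State.init (x : List ℕ) : State where
  reg := fun r => if r = 0 then x.length else 0
  arr := fun a i => if a = 0 then x.getD i 0 else 0

/-- The output of a halted machine: the first `m` cells of array `1`, where `m` is the content of
register `0`. -/
def State.output (s : State) : List ℕ :=
  (List.range (s.reg 0)).map (s.arr 1)

/-- On input `x` the program `P` halts after at most `T` steps, with output `y`. -/
def Prog.OutputsWithin (P : Prog) (x y : List ℕ) (T : ℝ) : Prop :=
  ∃ (s : State) (t : ℕ), Exec P (State.init x) s t ∧ s.output = y ∧ (t : ℝ) ≤ T

open Classical in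
/-- On input `x` the program `P` halts after at most `T` steps and answers the yes-no question `Q`,
with output `1` for yes and output `0` for no. -/
def Prog.DecidesWithin (P : Prog) (x : List ℕ) (Q : Prop) (T : ℝ) : Prop :=
  P.OutputsWithin x [if Q then 1 else 0] T

/-- The size of an input: the number of its binary digits, plus one for every entry. -/
def inputSize (x : List ℕ) : ℕ :=
  (x.map fun a => a.size + 1).sum

/-- The decision problem `Q` on instances of type `α`, encoded by `enc`, is fixed-parameter tractable
by the parameter `κ`: one program answers every instance `a` within `f (κ a) * |a| ^ c` steps, where
`f` is computable and `c` is a constant.  The parameter is not part of the input. -/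
def FixedParameterTractable {α : Type} (enc : α → List ℕ) (Q : α → Prop) (κ : α → ℕ) : Prop :=
  ∃ (f : ℕ → ℕ) (c : ℕ) (P : Prog), Computable f ∧
    ∀ a : α, P.DecidesWithin (enc a) (Q a) ((f (κ a) : ℝ) * (inputSize (enc a) : ℝ) ^ c)

end RAM

/-! ### Steiner forests -/

/-- `F` is a Steiner forest of `G` for the set `S` of terminal pairs: a subgraph of `G` in which the
two members of every pair belong to the same connected component.  (Acyclicity is not part of the
definition; a Steiner forest with the minimum number of edges has no cycles.) -/
def IsSteinerForest {V : Type} {G : SimpleGraph V} (S : Set (V × V)) (F : G.Subgraph) : Prop :=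
  ∀ p ∈ S, ∃ (h₁ : p.1 ∈ F.verts) (h₂ : p.2 ∈ F.verts), F.coe.Reachable ⟨p.1, h₁⟩ ⟨p.2, h₂⟩

/-- `F` is a Steiner forest with the minimum number of edges. -/
def IsMinSteinerForest {V : Type} {G : SimpleGraph V} (S : Set (V × V)) (F : G.Subgraph) : Prop :=
  IsSteinerForest S F ∧
    ∀ F' : G.Subgraph, IsSteinerForest S F' → F.edgeSet.ncard ≤ F'.edgeSet.ncard

/-- A finite graph on the vertices `0, …, n - 1` with a set of terminal pairs. -/
structure SteinerInstance where
  n : ℕ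
  G : SimpleGraph (Fin n)
  S : Set (Fin n × Fin n)

namespace SteinerInstance

/-- `(G, S)` has a Steiner forest with at most `l` edges. -/
def HasSteinerForestOfSize (I : SteinerInstance) (l : ℕ) : Prop :=
  ∃ F : I.G.Subgraph, IsSteinerForest I.S F ∧ F.edgeSet.ncard ≤ l

/-- `(G, S)` has a Steiner forest. -/
def Feasible (I : SteinerInstance) : Prop :=
  ∃ F : I.G.Subgraph, IsSteinerForest I.S F

/-- The vertex cover number of the graph (which is finite). -/
noncomputable def vc (I : SteinerInstance) : ℕ :=
  I.G.vertexCoverNum.toNat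

end SteinerInstance

open Classical in
/-- The `0`-`1` matrix of a binary relation on `0, …, n - 1`, row by row. -/
noncomputable def matrixBits {n : ℕ} (r : Fin n → Fin n → Prop) : List ℕ :=
  (List.finRange n).flatMap fun i => (List.finRange n).map fun j => if r i j then 1 else 0

/-- The encoding of `(G, S)`: the number of vertices, the adjacency matrix of `G`, and the matrix
of `S`. -/
noncomputable def SteinerInstance.encode (I : SteinerInstance) : List ℕ :=
  I.n :: (matrixBits I.G.Adj ++ matrixBits fun u v => (u, v) ∈ I.S)

/-- The encoding of `(G, S, l)`: the integer `l`, followed by the encoding of `(G, S)`. -/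
noncomputable def SteinerInstance.encodeWith (I : SteinerInstance) (l : ℕ) : List ℕ :=
  l :: I.encode

/-! Let `C` be the set of ends of a maximal matching, a vertex cover with at most `2 * k` members.
The demands matter only through the classes of the equivalence relation they generate: each class
must lie in one tree. Root every tree of a solution, in `C` if it has an edge. A vertex outside `C`
has all its neighbours in `C`, so it is isolated, a leaf, or a hub, that is, the parent of a vertex
in `C`. There are at most `#C` hubs.

A sketch records the shape of the rooted forest on `C` and the hubs by seven functions from `C` to
`C`. It does not name the vertices that serve as hubs, as that would cost a factor `n` for each. It
only tells, for every hub, which demand class contains it; a vertex without demands is a class of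
its own. This suffices: all members of a class lie in the same tree whichever of them is a hub, and
two hubs realized by the same vertex do no harm if they belong to the same tree, since merging them
saves edges. The class, too, has only `#C` relevant values: by the exchange argument in
`exists_candidate_of_small_rank`, every hub can take one of the first `#C` classes suitable for it.

Every valid sketch yields a solution with at most `cost` edges
(`Sketch.Valid.exists_connectsPairs`), and every solution yields a valid sketch whose cost is at
most its number of edges (`Sketch.exists_valid`). Hence the optimum is the least cost of a valid
sketch (`isOptCode_of_sketches`). Validity is a formula with quantifiers and counting over vertices,
so it is checked in polynomial time, and there are `(#C ^ #C) ^ 7 = 2 ^ O(k log k)` sketches to try.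

An optimal forest is then found by deleting edges as long as the optimum stays the same
(`RAM.Cmd.run_minimize`).

The algorithm is written in a language whose sums and loops are bounded by registers. Its programs
have a simple denotation `run`, and `RAM.Cmd.comp_spec` compiles them to the machine with running
time polynomial in the bounds. -/

namespace RAM

/-! ### A compiler for expressions with bounded sums and for programs with bounded loops -/

/-- Arithmetic expressions with conditionals and bounded sums. -/
inductive Exp where
  | lit (a : ℕ) : Exp
  | var (x : ℕ) : Exp
  | add (e f : Exp) : Exp
  | sub (e f : Exp) : Exp
  | get (a : ℕ) (e : Exp) : Exp
  | cond (c e f : Exp) : Exp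
  /-- the sum of `e` over all values of register `x` below the content of register `r` -/
  | sum (x r : ℕ) (e : Exp) : Exp

namespace Exp

/-- The value of an expression. -/
def val (A : ℕ → ℕ → ℕ) : Exp → (ℕ → ℕ) → ℕ
  | lit a, _ => a
  | var x, ρ => ρ x
  | add e f, ρ => e.val A ρ + f.val A ρ
  | sub e f, ρ => e.val A ρ - f.val A ρ
  | get a e, ρ => A a (e.val A ρ)
  | cond c e f, ρ => if c.val A ρ ≠ 0 then e.val A ρ else f.val A ρ
  | sum x r e, ρ => ∑ i ∈ Finset.range (ρ r), e.val A (Function.update ρ x i)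

/-- A program that stores the value of the expression in register `d`, changing no register
below `d`. -/
def comp : Exp → ℕ → Prog
  | lit a, d => .assign d (.lit a)
  | var x, d => .assign d (.reg x)
  | add e f, d => .seq (e.comp d) (.seq (f.comp (d + 1)) (.assign d (.add (.reg d) (.reg (d + 1)))))
  | sub e f, d => .seq (e.comp d) (.seq (f.comp (d + 1)) (.assign d (.sub (.reg d) (.reg (d + 1)))))
  | get a e, d => .seq (e.comp d) (.assign d (.read a (.reg d)))
  | cond c e f, d => .seq (c.comp d) (.ite (.reg d) (e.comp d) (f.comp d))
  | sum x r e, d =>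
      .seq (.assign d (.lit 0)) <| .seq (.assign (d + 1) (.reg x)) <|
      .seq (.assign (d + 2) (.reg r)) <| .seq (.assign x (.lit 0)) <|
      .seq (.loop (.sub (.reg (d + 2)) (.reg x)) <|
        .seq (e.comp (d + 3)) <| .seq (.assign d (.add (.reg d) (.reg (d + 3))))
          (.assign x (.add (.reg x) (.lit 1)))) <|
      .assign x (.reg (d + 1))

/-- All registers are below `b`, and the bounds of all sums are registers in `R`. -/
def fits (b : ℕ) (R : List ℕ) : Exp → Bool
  | lit _ => true
  | var x => x < b
  | add e f => e.fits b R && f.fits b R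
  | sub e f => e.fits b R && f.fits b R
  | get _ e => e.fits b R
  | cond c e f => c.fits b R && e.fits b R && f.fits b R
  | sum x r e => x < b && (r < b && R.contains r) && e.fits b R

/-- A bound on the time of `comp`, if all sums have at most `X` terms. -/
def time (X : ℕ) : Exp → ℕ
  | lit _ => 2
  | var _ => 2
  | add e f => e.time X + f.time X + 4
  | sub e f => e.time X + f.time X + 4
  | get _ e => e.time X + 3
  | cond c e f => c.time X + 2 + e.time X + f.time X
  | sum _ _ e => X * (e.time X + 12) + 14

end Exp

/-! ### Correctness and running time of the compiled code -/

theorem Exec.of_eq {p : Prog} {s s' s'' : State} {t t' : ℕ} (h : Exec p s s' t) (hs : s' = s'')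
    (ht : t = t') : Exec p s s'' t' := by subst hs ht; exact h

@[simp] theorem State.setReg_reg (s : State) (x v : ℕ) :
    (s.setReg x v).reg = Function.update s.reg x v := rfl
@[simp] theorem State.setReg_arr (s : State) (x v : ℕ) : (s.setReg x v).arr = s.arr := rfl
@[simp] theorem State.setArr_reg (s : State) (a i v : ℕ) : (s.setArr a i v).reg = s.reg := rfl
theorem State.setArr_arr (s : State) (a i v : ℕ) :
    (s.setArr a i v).arr = Function.update s.arr a (Function.update (s.arr a) i v) := rfl

/-- Variables live below `b`, temporary values from `d ≥ b` on, and a second operand is evaluated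
from `d + 1` on, so the first result survives. A summation variable is a genuine register: its old
content waits in `d + 1` and is restored at the end. -/
theorem Exp.comp_spec {b : ℕ} {R : List ℕ} (e : Exp) (he : e.fits b R = true) :
    ∀ (d : ℕ), b ≤ d → ∀ (s : State) (ρ : ℕ → ℕ) (X : ℕ), (∀ y < b, s.reg y = ρ y) →
      (∀ r ∈ R, ρ r ≤ X) →
      ∃ s' t, Exec (e.comp d) s s' t ∧ s'.arr = s.arr ∧ (∀ y < d, s'.reg y = s.reg y) ∧
        s'.reg d = e.val s.arr ρ ∧ t ≤ e.time X := by
  induction e with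
  | lit a =>
    intro d hd s ρ X hρ hX
    exact ⟨_, _, Exec.assign _ _ _, rfl, fun y hy => by simp [hy.ne], by simp [Expr.eval, val],
      by simp [Expr.cost, time]⟩
  | var x =>
    intro d hd s ρ X hρ hX
    simp only [fits, decide_eq_true_eq] at he
    exact ⟨_, _, Exec.assign _ _ _, rfl, fun y hy => by simp [hy.ne],
      by simp [Expr.eval, val, hρ x he], by simp [Expr.cost, time]⟩
  | add e f ihe ihf =>
    intro d hd s ρ X hρ hX
    simp only [fits, Bool.and_eq_true] at he
    obtain ⟨s₁, t₁, h₁, ha₁, hr₁, hv₁, ht₁⟩ := ihe he.1 d hd s ρ X hρ hX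
    obtain ⟨s₂, t₂, h₂, ha₂, hr₂, hv₂, ht₂⟩ := ihf he.2 (d + 1) (by omega) s₁ ρ X
      (fun y hy => (hr₁ y (by omega)).trans (hρ y hy)) hX
    refine ⟨_, _, h₁.seq (h₂.seq (.assign _ _ _)), by simp [ha₁, ha₂], fun y hy => ?_, ?_, ?_⟩
    · simp [hy.ne, hr₂ y (by omega), hr₁ y hy]
    · simp [Expr.eval, val, hv₂, hr₂ d (by omega), hv₁, ha₁]
    · simp only [Expr.cost, time]; omega
  | sub e f ihe ihf =>
    intro d hd s ρ X hρ hX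
    simp only [fits, Bool.and_eq_true] at he
    obtain ⟨s₁, t₁, h₁, ha₁, hr₁, hv₁, ht₁⟩ := ihe he.1 d hd s ρ X hρ hX
    obtain ⟨s₂, t₂, h₂, ha₂, hr₂, hv₂, ht₂⟩ := ihf he.2 (d + 1) (by omega) s₁ ρ X
      (fun y hy => (hr₁ y (by omega)).trans (hρ y hy)) hX
    refine ⟨_, _, h₁.seq (h₂.seq (.assign _ _ _)), by simp [ha₁, ha₂], fun y hy => ?_, ?_, ?_⟩
    · simp [hy.ne, hr₂ y (by omega), hr₁ y hy]
    · simp [Expr.eval, val, hv₂, hr₂ d (by omega), hv₁, ha₁]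
    · simp only [Expr.cost, time]; omega
  | get a e ihe =>
    intro d hd s ρ X hρ hX
    simp only [fits] at he
    obtain ⟨s₁, t₁, h₁, ha₁, hr₁, hv₁, ht₁⟩ := ihe he d hd s ρ X hρ hX
    refine ⟨_, _, h₁.seq (.assign _ _ _), by simp [ha₁], fun y hy => ?_, ?_, ?_⟩
    · simp [hy.ne, hr₁ y hy]
    · simp [Expr.eval, val, hv₁, ha₁]
    · simp only [Expr.cost, time]; omega
  | cond c e f ihc ihe ihf =>
    intro d hd s ρ X hρ hX
    simp only [fits, Bool.and_eq_true] at he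
    obtain ⟨s₁, t₁, h₁, ha₁, hr₁, hv₁, ht₁⟩ := ihc he.1.1 d hd s ρ X hρ hX
    have hρ₁ : ∀ y < b, s₁.reg y = ρ y := fun y hy => (hr₁ y (by omega)).trans (hρ y hy)
    by_cases hc : c.val s.arr ρ = 0
    · obtain ⟨s₂, t₂, h₂, ha₂, hr₂, hv₂, ht₂⟩ := ihf he.2 d hd s₁ ρ X hρ₁ hX
      refine ⟨_, _, h₁.seq (.iteFalse (by simp [Expr.eval, hv₁, hc]) h₂), by simp [ha₁, ha₂],
        fun y hy => ?_, ?_, ?_⟩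
      · rw [hr₂ y hy, hr₁ y hy]
      · simp [val, hv₂, hc, ha₁]
      · simp only [Expr.cost, time]; omega
    · obtain ⟨s₂, t₂, h₂, ha₂, hr₂, hv₂, ht₂⟩ := ihe he.1.2 d hd s₁ ρ X hρ₁ hX
      refine ⟨_, _, h₁.seq (.iteTrue (by simp [Expr.eval, hv₁, hc]) h₂), by simp [ha₁, ha₂],
        fun y hy => ?_, ?_, ?_⟩
      · rw [hr₂ y hy, hr₁ y hy]
      · simp [val, hv₂, hc, ha₁]
      · simp only [Expr.cost, time]; omega
  | sum x r e ih =>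
    intro d hd s ρ X hρ hX
    simp only [fits, Bool.and_eq_true, decide_eq_true_eq, List.contains_iff_mem] at he
    obtain ⟨⟨hx, hr, hR⟩, he⟩ := he
    have hle : ρ r ≤ X := hX r hR
    have key : ∀ k i, i + k = ρ r → ∀ s' : State, s'.arr = s.arr →
        (∀ y < b, s'.reg y = Function.update ρ x i y) → (∀ y < d, y ≠ x → s'.reg y = s.reg y) →
        s'.reg d = ∑ j ∈ Finset.range i, e.val s.arr (Function.update ρ x j) →
        s'.reg (d + 1) = ρ x → s'.reg (d + 2) = ρ r →
        ∃ s'' t, Exec (.loop (.sub (.reg (d + 2)) (.reg x)) <|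
          .seq (e.comp (d + 3)) <| .seq (.assign d (.add (.reg d) (.reg (d + 3))))
          (.assign x (.add (.reg x) (.lit 1)))) s' s'' t ∧ s''.arr = s.arr ∧
          (∀ y < d, y ≠ x → s''.reg y = s.reg y) ∧
          s''.reg d = ∑ j ∈ Finset.range (ρ r), e.val s.arr (Function.update ρ x j) ∧
          s''.reg (d + 1) = ρ x ∧ t ≤ k * (e.time X + 12) + 4 := by
      intro k
      induction k with
      | zero =>
        intro i hi s' ha hb hy hd0 hd1 hd2
        refine ⟨s', _, .loopFalse ?_, ha, hy, ?_, hd1, ?_⟩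
        · simp [Expr.eval, hd2, hb x hx]; omega
        · rw [hd0]; congr 2
        · simp [Expr.cost]
      | succ k ihk =>
        intro i hi s' ha hb hy hd0 hd1 hd2
        obtain ⟨s₁, t₁, h₁, ha₁, hr₁, hv₁, ht₁⟩ := ih he (d + 3) (by omega) s'
          -- The summation variable may itself bound an inner sum: its value `i` is below `ρ r ≤ X`.
          (Function.update ρ x i) X hb (fun r' hr' => by
            by_cases h : r' = x
            · subst h; simp; omega
            · simpa [h] using hX r' hr')
        obtain ⟨s₂, t₂, h₂, ha₂, hr₂, hv₂, hd₂, ht₂⟩ := ihk (i + 1) (by omega)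
          ((s₁.setReg d (s₁.reg d + s₁.reg (d + 3))).setReg x
            ((s₁.setReg d (s₁.reg d + s₁.reg (d + 3))).reg x + 1))
          (by simp [ha₁, ha])
          (fun y hy' => by
            by_cases h : y = x
            · subst h
              have : y ≠ d := by omega
              simp [this, hr₁ y (by omega), hb y hy']
            · have : y ≠ d := by omega
              simp [h, this, hr₁ y (by omega), hb y hy'])
          (fun y hy' hne => by
            have : y ≠ d := by omega
            simp [hne, this, hr₁ y (by omega), hy y hy' hne])
          (by
            have : d ≠ x := by omega
            simp [this, hr₁ d (by omega), hd0, hv₁, Finset.sum_range_succ, ha])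
          (by
            have : d + 1 ≠ x := by omega
            simp [this, hr₁ (d + 1) (by omega), hd1])
          (by
            have : d + 2 ≠ x := by omega
            simp [this, hr₁ (d + 2) (by omega), hd2])
        refine ⟨s₂, _, .loopTrue ?_ (h₁.seq (.seq (.assign _ _ _) (.assign _ _ _))) h₂, ha₂, hr₂,
          hv₂, hd₂, ?_⟩
        · simp [Expr.eval, hd2, hb x hx]; omega
        · simp only [Expr.cost]
          have : (k + 1) * (e.time X + 12) = k * (e.time X + 12) + (e.time X + 12) := by ring
          omega
    have e1 : d + 1 ≠ x := by omega
    have e2 : d + 2 ≠ x := by omega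
    have e0 : d ≠ x := by omega
    have e3 : x ≠ d := by omega
    have e4 : r ≠ d := by omega
    have e5 : r ≠ d + 1 := by omega
    have e6 : x ≠ d + 1 := by omega
    obtain ⟨s₂, t₂, h₂, ha₂, hr₂, hv₂, hd₂, ht₂⟩ := key (ρ r) 0 (by omega)
      ((((s.setReg d 0).setReg (d + 1) (s.reg x)).setReg (d + 2) (s.reg r)).setReg x 0) rfl
      (fun y hy => by
        by_cases h : y = x
        · subst h; simp
        · have h1 : y ≠ d := by omega
          have h2 : y ≠ d + 1 := by omega
          have h3 : y ≠ d + 2 := by omega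
          simp [h, h1, h2, h3, hρ y hy])
      (fun y hy h => by
        have h1 : y ≠ d := by omega
        have h2 : y ≠ d + 1 := by omega
        have h3 : y ≠ d + 2 := by omega
        simp [h, h1, h2, h3])
      (by simp [e0]) (by simp [e1, hρ x hx]) (by simp [e2, hρ r hr])
    refine ⟨_, _, .seq (.assign _ _ _) (.seq (.assign _ _ _) (.seq (.assign _ _ _)
      (.seq (.assign _ _ _) (.seq (t₁ := t₂) (s₁ := s₂) ?_ (.assign _ _ _))))), ?_, ?_, ?_, ?_⟩
    · refine h₂.of_eq rfl rfl |> fun h => ?_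
      simpa [Expr.eval, e3, e4, e5] using h
    · simp [ha₂]
    · intro y hy
      by_cases h : y = x
      · subst h; simp [Expr.eval, hd₂, hρ y hx]
      · simp [h, hr₂ y hy h]
    · simp [e0, hv₂, val]
    · simp only [Expr.cost, time]
      have : ρ r * (e.time X + 12) ≤ X * (e.time X + 12) := Nat.mul_le_mul_right _ hle
      omega

/-- Programs with bounded loops. -/
inductive Cmd where
  | set (x : ℕ) (e : Exp) : Cmd
  | put (a : ℕ) (i e : Exp) : Cmd
  | seq (c c' : Cmd) : Cmd
  | cond (e : Exp) (c c' : Cmd) : Cmd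
  /-- run `c` for all values of register `x` below the content of register `r` -/
  | iter (x r : ℕ) (c : Cmd) : Cmd

namespace Cmd

/-- The state after running a program. -/
def run : Cmd → State → State
  | set x e, s => s.setReg x (e.val s.arr s.reg)
  | put a i e, s => s.setArr a (i.val s.arr s.reg) (e.val s.arr s.reg)
  | seq c c', s => c'.run (c.run s)
  | cond e c c', s => if e.val s.arr s.reg ≠ 0 then c.run s else c'.run s
  | .iter x r c, s => Nat.rec s (fun i st => c.run (st.setReg x i)) (s.reg r)

/-- Compilation; the registers from `d` on are used for temporary values. -/
def comp : Cmd → ℕ → Prog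
  | set x e, d => .seq (e.comp d) (.assign x (.reg d))
  | put a i e, d => .seq (i.comp d) (.seq (e.comp (d + 1)) (.write a (.reg d) (.reg (d + 1))))
  | seq c c', d => .seq (c.comp d) (c'.comp d)
  | cond e c c', d => .seq (e.comp d) (.ite (.reg d) (c.comp d) (c'.comp d))
  | .iter x r c, d =>
      .seq (.assign d (.lit 0)) <| .seq (.assign (d + 1) (.reg r)) <|
      .loop (.sub (.reg (d + 1)) (.reg d)) <|
        .seq (.assign x (.reg d)) <| .seq (c.comp (d + 2)) <|
          .assign d (.add (.reg d) (.lit 1))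

/-- All registers are below `b`, the bounds of all sums and loops are registers in `R`, and no
register in `R` is changed. -/
def fits (b : ℕ) (R : List ℕ) : Cmd → Bool
  | set x e => (x < b && !R.contains x) && e.fits b R
  | put _ i e => i.fits b R && e.fits b R
  | seq c c' => c.fits b R && c'.fits b R
  | cond e c c' => e.fits b R && c.fits b R && c'.fits b R
  | .iter x r c => (x < b && !R.contains x) && (r < b && R.contains r) && c.fits b R

/-- A bound on the time of `comp`, if all sums and loops have length at most `X`. -/
def time (X : ℕ) : Cmd → ℕ
  | set _ e => e.time X + 2
  | put _ i e => i.time X + e.time X + 3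
  | seq c c' => c.time X + c'.time X
  | cond e c c' => e.time X + c.time X + c'.time X + 2
  | .iter _ _ c => X * (c.time X + 10) + 8

/-- Whether register `x` may be changed. -/
def writes (x : ℕ) : Cmd → Bool
  | set y _ => x = y
  | put _ _ _ => false
  | seq c c' => c.writes x || c'.writes x
  | cond _ c c' => c.writes x || c'.writes x
  | .iter y _ c => x = y || c.writes x

/-- Whether array `a` may be changed. -/
def puts (a : ℕ) : Cmd → Bool
  | set _ _ => false
  | put b _ _ => a = b
  | seq c c' => c.puts a || c'.puts a
  | cond _ c c' => c.puts a || c'.puts a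
  | .iter _ _ c => c.puts a

theorem iter_inv {x r : ℕ} {c : Cmd} {s : State} (I : ℕ → State → Prop) (h0 : I 0 s)
    (hs : ∀ i < s.reg r, ∀ st, I i st → I (i + 1) (c.run (st.setReg x i))) :
    I (s.reg r) ((Cmd.iter x r c).run s) := by
  have : ∀ k ≤ s.reg r, I k (Nat.rec s (fun i st => c.run (st.setReg x i)) k) := by
    intro k
    induction k with
    | zero => intro _; exact h0
    | succ k ih => intro hk; exact hs k (by omega) _ (ih (by omega))
  exact this _ le_rfl

/-- With `run_arr`, the frame rule. For a concrete program the hypothesis is checked by evaluation,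
so data that are not touched need no invariant. -/
theorem run_reg {x : ℕ} (c : Cmd) (hc : c.writes x = false) (s : State) :
    (c.run s).reg x = s.reg x := by
  induction c generalizing s with
  | set y e =>
    simp only [writes, decide_eq_false_iff_not] at hc
    simp [run, hc]
  | put => rfl
  | seq c c' ih ih' =>
    simp only [writes, Bool.or_eq_false_iff] at hc
    rw [run, ih' hc.2, ih hc.1]
  | cond e c c' ih ih' =>
    simp only [writes, Bool.or_eq_false_iff] at hc
    rw [run]; split
    · exact ih hc.1 s
    · exact ih' hc.2 s
  | iter y r c ih =>
    simp only [writes, Bool.or_eq_false_iff, decide_eq_false_iff_not] at hc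
    exact iter_inv (fun _ st => st.reg x = s.reg x) rfl fun i _ st h => by
      rw [ih hc.2]; simpa [hc.1] using h

theorem run_arr {a : ℕ} (c : Cmd) (hc : c.puts a = false) (s : State) :
    (c.run s).arr a = s.arr a := by
  induction c generalizing s with
  | set y e => rfl
  | put b i e =>
    simp only [puts, decide_eq_false_iff_not] at hc
    simp [run, State.setArr_arr, hc]
  | seq c c' ih ih' =>
    simp only [puts, Bool.or_eq_false_iff] at hc
    rw [run, ih' hc.2, ih hc.1]
  | cond e c c' ih ih' =>
    simp only [puts, Bool.or_eq_false_iff] at hc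
    rw [run]; split
    · exact ih hc.1 s
    · exact ih' hc.2 s
  | iter y r c ih =>
    exact iter_inv (fun _ st => st.arr a = s.arr a) rfl fun i _ st h => by
      rw [ih hc]; simpa using h

theorem writes_of_fits {b : ℕ} {R : List ℕ} {x : ℕ} (hx : x ∈ R) (c : Cmd)
    (hc : c.fits b R = true) : c.writes x = false := by
  induction c with
  | set y e =>
    simp only [fits, Bool.and_eq_true, Bool.not_eq_true', decide_eq_true_eq] at hc
    simp only [writes, decide_eq_false_iff_not]
    rintro rfl
    simp [hx] at hc
  | put => rfl
  | seq c c' ih ih' =>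
    simp only [fits, Bool.and_eq_true] at hc
    simp [writes, ih hc.1, ih' hc.2]
  | cond e c c' ih ih' =>
    simp only [fits, Bool.and_eq_true] at hc
    simp [writes, ih hc.1.2, ih' hc.2]
  | iter y r c ih =>
    simp only [fits, Bool.and_eq_true, Bool.not_eq_true', decide_eq_true_eq] at hc
    simp only [writes, Bool.or_eq_false_iff, decide_eq_false_iff_not, ih hc.2, and_true]
    rintro rfl
    simp [hx] at hc

/-- The real state `s` simulates the ideal state `σ` on the arrays and on the registers below `b`. A
loop keeps its counter and its bound in `d` and `d + 1`, out of reach of the body, which may even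
overwrite the loop variable. As registers in `R` never change, `X` bounds all loops throughout the
run. -/
theorem comp_spec {b : ℕ} {R : List ℕ} (c : Cmd) (hc : c.fits b R = true) :
    ∀ (d : ℕ), b ≤ d → ∀ (s σ : State) (X : ℕ), s.arr = σ.arr → (∀ y < b, s.reg y = σ.reg y) →
      (∀ r ∈ R, σ.reg r ≤ X) →
      ∃ s' t, Exec (c.comp d) s s' t ∧ s'.arr = (c.run σ).arr ∧
        (∀ y < b, s'.reg y = (c.run σ).reg y) ∧ (∀ y, b ≤ y → y < d → s'.reg y = s.reg y) ∧
        t ≤ c.time X := by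
  induction c with
  | set x e =>
    intro d hd s σ X ha hσ hX
    simp only [fits, Bool.and_eq_true, decide_eq_true_eq] at hc
    obtain ⟨s₁, t₁, h₁, ha₁, hr₁, hv₁, ht₁⟩ := e.comp_spec hc.2 d hd s σ.reg X hσ hX
    refine ⟨_, _, h₁.seq (.assign _ _ _), by simp [ha₁, ha, run], fun y hy => ?_,
      fun y hy hy' => ?_, ?_⟩
    · by_cases h : y = x
      · subst h; simp [run, Expr.eval, hv₁, ha]
      · simp [h, run, hr₁ y (by omega), hσ y hy]
    · have : y ≠ x := by omega
      simp [this, hr₁ y hy']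
    · simp only [Expr.cost, time]; omega
  | put a i e =>
    intro d hd s σ X ha hσ hX
    simp only [fits, Bool.and_eq_true] at hc
    obtain ⟨s₁, t₁, h₁, ha₁, hr₁, hv₁, ht₁⟩ := i.comp_spec hc.1 d hd s σ.reg X hσ hX
    obtain ⟨s₂, t₂, h₂, ha₂, hr₂, hv₂, ht₂⟩ := e.comp_spec hc.2 (d + 1) (by omega) s₁ σ.reg X
      (fun y hy => (hr₁ y (by omega)).trans (hσ y hy)) hX
    refine ⟨_, _, h₁.seq (h₂.seq (.write _ _ _ _)), ?_, fun y hy => ?_,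
      fun y hy hy' => ?_, ?_⟩
    · simp [run, State.setArr_arr, Expr.eval, hr₂ d (by omega), hv₁, hv₂, ha₂, ha₁, ha]
    · simp [run, hr₂ y (by omega), hr₁ y (by omega), hσ y hy]
    · simp [hr₂ y (by omega), hr₁ y hy']
    · simp only [Expr.cost, time]; omega
  | seq c c' ih ih' =>
    intro d hd s σ X ha hσ hX
    simp only [fits, Bool.and_eq_true] at hc
    obtain ⟨s₁, t₁, h₁, ha₁, hr₁, hv₁, ht₁⟩ := ih hc.1 d hd s σ X ha hσ hX
    obtain ⟨s₂, t₂, h₂, ha₂, hr₂, hv₂, ht₂⟩ := ih' hc.2 d hd s₁ (c.run σ) X ha₁ hr₁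
      (fun r hr => by rw [run_reg c (writes_of_fits hr c hc.1)]; exact hX r hr)
    refine ⟨_, _, h₁.seq h₂, ha₂, hr₂, fun y hy hy' => ?_, ?_⟩
    · rw [hv₂ y hy hy', hv₁ y hy hy']
    · simp only [time]; omega
  | cond e c c' ih ih' =>
    intro d hd s σ X ha hσ hX
    simp only [fits, Bool.and_eq_true] at hc
    obtain ⟨s₁, t₁, h₁, ha₁, hr₁, hv₁, ht₁⟩ := e.comp_spec hc.1.1 d hd s σ.reg X hσ hX
    have hσ₁ : ∀ y < b, s₁.reg y = σ.reg y := fun y hy => (hr₁ y (by omega)).trans (hσ y hy)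
    rw [ha] at hv₁
    by_cases h : e.val σ.arr σ.reg = 0
    · obtain ⟨s₂, t₂, h₂, ha₂, hr₂, hv₂, ht₂⟩ := ih' hc.2 d hd s₁ σ X (ha₁.trans ha) hσ₁ hX
      refine ⟨_, _, h₁.seq (.iteFalse (by simp [Expr.eval, hv₁, h]) h₂), by simp [run, h, ha₂],
        by simpa [run, h] using hr₂, fun y hy hy' => ?_, ?_⟩
      · rw [hv₂ y hy hy', hr₁ y hy']
      · simp only [time, Expr.cost]; omega
    · obtain ⟨s₂, t₂, h₂, ha₂, hr₂, hv₂, ht₂⟩ := ih hc.1.2 d hd s₁ σ X (ha₁.trans ha) hσ₁ hX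
      refine ⟨_, _, h₁.seq (.iteTrue (by simp [Expr.eval, hv₁, h]) h₂), by simp [run, h, ha₂],
        by simpa [run, h] using hr₂, fun y hy hy' => ?_, ?_⟩
      · rw [hv₂ y hy hy', hr₁ y hy']
      · simp only [time, Expr.cost]; omega
  | iter x r c ih =>
    intro d hd s σ X ha hσ hX
    have hc' := hc
    simp only [fits, Bool.and_eq_true, Bool.not_eq_true', decide_eq_true_eq,
      List.contains_iff_mem] at hc
    obtain ⟨⟨⟨hx, hxR⟩, hr, hR⟩, hc⟩ := hc
    have hxR' : x ∉ R := by simpa using hxR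
    have hle : σ.reg r ≤ X := hX r hR
    have key : ∀ k i, i + k = σ.reg r → ∀ s' σ' : State, s'.arr = σ'.arr →
        (∀ y < b, s'.reg y = σ'.reg y) → (∀ y, b ≤ y → y < d → s'.reg y = s.reg y) →
        (∀ r ∈ R, σ'.reg r = σ.reg r) →
        s'.reg d = i → s'.reg (d + 1) = σ.reg r →
        σ' = Nat.rec σ (fun i st => c.run (st.setReg x i)) i →
        ∃ s'' t, Exec (.loop (.sub (.reg (d + 1)) (.reg d)) <|
          .seq (.assign x (.reg d)) <| .seq (c.comp (d + 2)) <|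
          .assign d (.add (.reg d) (.lit 1))) s' s'' t ∧
          s''.arr = ((Cmd.iter x r c).run σ).arr ∧
          (∀ y < b, s''.reg y = ((Cmd.iter x r c).run σ).reg y) ∧
          (∀ y, b ≤ y → y < d → s''.reg y = s.reg y) ∧ t ≤ k * (c.time X + 10) + 4 := by
      intro k
      induction k with
      | zero =>
        intro i hi s' σ' ha hb hy hR' hd0 hd1 hσ'
        have hrun : (Cmd.iter x r c).run σ = σ' := by
          rw [hσ', run]; congr 1; omega
        refine ⟨s', _, .loopFalse ?_, by rw [hrun, ha], by rwa [hrun], hy, ?_⟩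
        · simp [Expr.eval, hd0, hd1]; omega
        · simp [Expr.cost]
      | succ k ihk =>
        intro i hi s' σ' ha hb hy hR' hd0 hd1 hσ'
        have hxd : x ≠ d := by omega
        obtain ⟨s₁, t₁, h₁, ha₁, hr₁, hv₁, ht₁⟩ := ih hc (d + 2) (by omega)
          (s'.setReg x (s'.reg d)) (σ'.setReg x i) X (by simp [ha])
          (fun y hy' => by
            by_cases h : y = x
            · subst h; simp [hd0]
            · simp [h, hb y hy'])
          (fun r' hr' => by
            have h : r' ≠ x := fun h => hxR' (h ▸ hr')
            simpa [h, hR' r' hr'] using hX r' hr')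
        have hv₁' : ∀ y, b ≤ y → y < d + 2 → s₁.reg y = s'.reg y := fun y h1 h2 => by
          have h : y ≠ x := by omega
          rw [hv₁ y h1 h2]; simp [h]
        obtain ⟨s₂, t₂, h₂, ha₂, hr₂, hv₂, ht₂⟩ := ihk (i + 1) (by omega)
          (s₁.setReg d (s₁.reg d + 1)) (c.run (σ'.setReg x i))
          (by simp [ha₁])
          (fun y hy' => by
            have : y ≠ d := by omega
            simp [this, hr₁ y hy'])
          (fun y h1 h2 => by
            have : y ≠ d := by omega
            simp [this, hv₁' y h1 (by omega), hy y h1 h2])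
          (fun r' hr' => by
            have h : r' ≠ x := fun h => hxR' (h ▸ hr')
            rw [run_reg c (writes_of_fits hr' c hc)]
            simp [h, hR' r' hr'])
          (by simp [hv₁' d (by omega) (by omega), hd0])
          (by simp [hv₁' (d + 1) (by omega) (by omega), hd1])
          (by rw [hσ'])
        refine ⟨s₂, _, .loopTrue ?_ (.seq (.assign _ _ _) (.seq h₁ (.assign _ _ _))) h₂, ha₂, hr₂,
          hv₂, ?_⟩
        · simp [Expr.eval, hd0, hd1]; omega
        · simp only [Expr.cost]
          have : (k + 1) * (c.time X + 10) = k * (c.time X + 10) + (c.time X + 10) := by ring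
          omega
    have e4 : r ≠ d := by omega
    obtain ⟨s₂, t₂, h₂, ha₂, hr₂, hv₂, ht₂⟩ := key (σ.reg r) 0 (by omega)
      ((s.setReg d 0).setReg (d + 1) (s.reg r)) σ (by simp [ha])
      (fun y hy => by
        have h1 : y ≠ d := by omega
        have h2 : y ≠ d + 1 := by omega
        simp [h1, h2, hσ y hy])
      (fun y h1 h2 => by
        have h1 : y ≠ d := by omega
        have h2 : y ≠ d + 1 := by omega
        simp [h1, h2])
      (fun _ _ => rfl) (by simp) (by simp [hσ r hr]) rfl
    refine ⟨s₂, _, .seq (.assign _ _ _) (.seq (t₂ := t₂) (.assign _ _ _) ?_), ha₂, hr₂, hv₂, ?_⟩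
    · simpa [Expr.eval, e4] using h₂
    · simp only [Expr.cost, time]
      have : σ.reg r * (c.time X + 10) ≤ X * (c.time X + 10) := Nat.mul_le_mul_right _ hle
      omega

end Cmd

/-- A function bounded by a polynomial. -/
def PolyBounded (f : ℕ → ℕ) : Prop :=
  ∃ k, ∀ X, f X ≤ k * (X + 1) ^ k

namespace PolyBounded

theorem const (a : ℕ) : PolyBounded fun _ => a :=
  ⟨a, fun X => Nat.le_mul_of_pos_right _ (by positivity)⟩

theorem id : PolyBounded fun X => X := ⟨1, fun X => by simp⟩

theorem add {f g : ℕ → ℕ} (hf : PolyBounded f) (hg : PolyBounded g) :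
    PolyBounded fun X => f X + g X := by
  obtain ⟨k, hk⟩ := hf
  obtain ⟨l, hl⟩ := hg
  refine ⟨k + l, fun X => ?_⟩
  calc f X + g X ≤ k * (X + 1) ^ k + l * (X + 1) ^ l := add_le_add (hk X) (hl X)
    _ ≤ k * (X + 1) ^ (k + l) + l * (X + 1) ^ (k + l) := by
      gcongr <;> omega
    _ = _ := by ring

theorem mul {f g : ℕ → ℕ} (hf : PolyBounded f) (hg : PolyBounded g) :
    PolyBounded fun X => f X * g X := by
  obtain ⟨k, hk⟩ := hf
  obtain ⟨l, hl⟩ := hg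
  refine ⟨k * l + k + l, fun X => ?_⟩
  calc f X * g X ≤ (k * (X + 1) ^ k) * (l * (X + 1) ^ l) := Nat.mul_le_mul (hk X) (hl X)
    _ = k * l * (X + 1) ^ (k + l) := by ring
    _ ≤ (k * l + k + l) * (X + 1) ^ (k * l + k + l) := by
      gcongr <;> omega

end PolyBounded

/-- The nesting depth of sums is fixed by the expression, and each level costs one more factor `X`.
-/
theorem Exp.polyBounded_time (e : Exp) : PolyBounded fun X => e.time X := by
  induction e with
  | lit | var => exact .const 2
  | add e f ihe ihf | sub e f ihe ihf => exact (ihe.add ihf).add (.const 4)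
  | get a e ih => exact ih.add (.const 3)
  | cond c e f ihc ihe ihf => exact ((ihc.add (.const 2)).add ihe).add ihf
  | sum x r e ih => exact (PolyBounded.id.mul (ih.add (.const 12))).add (.const 14)

theorem Cmd.polyBounded_time (c : Cmd) : PolyBounded fun X => c.time X := by
  induction c with
  | set x e => exact e.polyBounded_time.add (.const 2)
  | put a i e => exact (i.polyBounded_time.add e.polyBounded_time).add (.const 3)
  | seq c c' ih ih' => exact ih.add ih'
  | cond e c c' ih ih' => exact ((e.polyBounded_time.add ih).add ih').add (.const 2)
  | iter x r c ih => exact (PolyBounded.id.mul (ih.add (.const 10))).add (.const 8)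

end RAM

/-! ### Forests given by parent functions -/

/-- The members of every pair in `S` are connected in `H`. -/
def ConnectsPairs {V : Type} (S : Set (V × V)) (H : SimpleGraph V) : Prop :=
  ∀ p ∈ S, H.Reachable p.1 p.2

theorem IsSteinerForest.connectsPairs {V : Type} {G : SimpleGraph V} {S : Set (V × V)}
    {F : G.Subgraph} (h : IsSteinerForest S F) : ConnectsPairs S F.spanningCoe := by
  intro p hp
  obtain ⟨h₁, h₂, h⟩ := h p hp
  exact h.map (⟨Subtype.val, fun {a b} hab => hab⟩ : F.coe →g F.spanningCoe)

theorem ConnectsPairs.isSteinerForest {V : Type} {G H : SimpleGraph V} {S : Set (V × V)}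
    (hH : H ≤ G) (h : ConnectsPairs S H) : IsSteinerForest S (SimpleGraph.toSubgraph H hH) := by
  intro p hp
  exact ⟨trivial, trivial, (h p hp).map
    (⟨fun v => ⟨v, trivial⟩, fun {a b} hab => hab⟩ : H →g (SimpleGraph.toSubgraph H hH).coe)⟩

/-- Take the edges from non-roots to their parents. Since depths decrease, following parents ends at
a root, and labels are constant on the way; so the label of a vertex is a root connected to it. -/
theorem exists_le_of_parents {n : ℕ} {G : SimpleGraph (Fin n)} {par : Fin n → Fin n}
    {lab dep : Fin n → ℕ}
    (h : ∀ x, lab x = x ∨ (G.Adj x (par x) ∧ lab (par x) = lab x ∧ dep (par x) < dep x)) :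
    ∃ H ≤ G, H.edgeSet.ncard ≤ (Finset.univ.filter fun x : Fin n => lab x ≠ x).card ∧
      ∀ x y, lab x = lab y → H.Reachable x y := by
  set E : Set (Sym2 (Fin n)) := (fun x => s(x, par x)) '' {x | lab x ≠ x} with hE
  have hadj : ∀ x, lab x ≠ x → (SimpleGraph.fromEdgeSet E).Adj x (par x) := by
    intro x hx
    obtain ⟨h1, -, -⟩ := (h x).resolve_left hx
    exact (SimpleGraph.fromEdgeSet_adj _).2 ⟨⟨x, hx, rfl⟩, h1.ne⟩
  have hroot : ∀ k x, dep x = k → ∃ r : Fin n, lab x = r ∧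
      (SimpleGraph.fromEdgeSet E).Reachable x r := by
    intro k
    induction k using Nat.strong_induction_on with
    | _ k ih =>
      intro x hk
      by_cases hx : lab x = x
      · exact ⟨x, hx, .refl _⟩
      · obtain ⟨-, h2, h3⟩ := (h x).resolve_left hx
        obtain ⟨r, hr, hr'⟩ := ih _ (hk ▸ h3) (par x) rfl
        exact ⟨r, h2 ▸ hr, (hadj x hx).reachable.trans hr'⟩
  refine ⟨SimpleGraph.fromEdgeSet E, ?_, ?_, ?_⟩
  · intro u v huv
    obtain ⟨⟨x, hx, hxe⟩, -⟩ := (SimpleGraph.fromEdgeSet_adj _).1 huv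
    obtain ⟨h1, -, -⟩ := (h x).resolve_left hx
    rw [← SimpleGraph.mem_edgeSet, ← hxe]
    exact h1
  · rw [SimpleGraph.edgeSet_fromEdgeSet]
    calc (E \ _).ncard ≤ E.ncard := Set.ncard_le_ncard Set.sdiff_subset (Set.toFinite _)
      _ ≤ Set.ncard {x | lab x ≠ x} := Set.ncard_image_le (Set.toFinite _)
      _ = _ := by rw [Set.ncard_eq_toFinset_card']; congr 1; ext; simp
  · intro x y hxy
    obtain ⟨r, hr, hr'⟩ := hroot _ x rfl
    obtain ⟨r₂, hr₂, hr₂'⟩ := hroot _ y rfl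
    have : r = r₂ := Fin.ext (by rw [← hr, ← hr₂, hxy])
    subst this
    exact hr'.trans hr₂'.symm

theorem SimpleGraph.Reachable.exists_adj_dist_lt {V : Type} {H : SimpleGraph V} {z x : V}
    (h : H.Reachable z x) (hne : z ≠ x) : ∃ y, H.Adj x y ∧ H.dist z y < H.dist z x := by
  obtain ⟨p, hp⟩ := h.symm.exists_walk_length_eq_dist
  cases p with
  | nil => exact absurd rfl hne
  | cons hadj q =>
    rename_i y
    refine ⟨y, hadj, ?_⟩
    rw [H.dist_comm, H.dist_comm (v := x), ← hp, SimpleGraph.Walk.length_cons]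
    exact Nat.lt_succ_of_le (SimpleGraph.dist_le q)

/-- Root every component, inside `C` if it meets `C`, and let the parent be a neighbour nearer to
the root. A non-root has an incident edge, so its component meets `C` and its root is in `C`. The
edge from a non-root to its parent determines the non-root, which bounds their number. -/
theorem exists_parents {V : Type} [Finite V] (H : SimpleGraph V) (C : Set V)
    (hC : ∀ u v, H.Adj u v → u ∈ C ∨ v ∈ C) :
    ∃ (par lab : V → V) (dep : V → ℕ),
      (∀ x, lab x ≠ x → H.Adj x (par x) ∧ lab (par x) = lab x ∧ dep (par x) < dep x ∧ lab x ∈ C) ∧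
      (∀ x y, lab x = lab y ↔ H.Reachable x y) ∧
      {x | lab x ≠ x}.ncard ≤ H.edgeSet.ncard := by
  classical
  have hrep : ∀ K : H.ConnectedComponent, ∃ r, H.connectedComponentMk r = K ∧
      ((∃ c ∈ C, H.connectedComponentMk c = K) → r ∈ C) := by
    intro K
    by_cases h : ∃ c ∈ C, H.connectedComponentMk c = K
    · obtain ⟨c, hc, hK⟩ := h
      exact ⟨c, hK, fun _ => hc⟩
    · obtain ⟨v, rfl⟩ := K.exists_rep
      exact ⟨v, rfl, fun h' => absurd h' h⟩
  choose rep hrep₁ hrep₂ using hrep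
  set lab : V → V := fun x => rep (H.connectedComponentMk x) with hlab
  have hlr : ∀ x, H.Reachable (lab x) x := fun x =>
    SimpleGraph.ConnectedComponent.exact (hrep₁ _)
  have hiff : ∀ x y, lab x = lab y ↔ H.Reachable x y := by
    intro x y
    refine ⟨fun h => (hlr x).symm.trans (h ▸ hlr y), fun h => ?_⟩
    simp only [hlab, SimpleGraph.ConnectedComponent.sound h]
  have hstep : ∀ x, ∃ y, lab x ≠ x → H.Adj x y ∧ H.dist (lab x) y < H.dist (lab x) x := by
    intro x
    by_cases hx : lab x = x
    · exact ⟨x, fun h => absurd hx h⟩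
    · obtain ⟨y, hy⟩ := (hlr x).exists_adj_dist_lt hx
      exact ⟨y, fun _ => hy⟩
  choose par hpar using hstep
  have hlp : ∀ x, lab x ≠ x → lab (par x) = lab x := fun x hx =>
    (hiff _ _).2 (hpar x hx).1.reachable.symm
  refine ⟨par, lab, fun x => H.dist (lab x) x, fun x hx => ⟨(hpar x hx).1, hlp x hx, ?_, ?_⟩,
    hiff, ?_⟩
  · show H.dist (lab (par x)) (par x) < _
    rw [hlp x hx]; exact (hpar x hx).2
  · refine hrep₂ _ ?_
    rcases hC _ _ (hpar x hx).1 with h | h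
    · exact ⟨x, h, rfl⟩
    · exact ⟨_, h, SimpleGraph.ConnectedComponent.sound (hpar x hx).1.reachable.symm⟩
  · refine Set.ncard_le_ncard_of_injOn (fun x => s(x, par x)) (fun x hx => (hpar x hx).1) ?_
      (Set.toFinite _)
    intro x hx y hy hxy
    rcases Sym2.eq_iff.1 hxy with h | ⟨h, h'⟩
    · exact h.1
    -- Each of two vertices would be the parent of the other, and both distances to the common root
    -- would decrease.
    · exfalso
      have h1 := (hpar x hx).2
      have h2 := (hpar y hy).2
      have h3 : lab x = lab y := by
        rw [← hlp x hx, h']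
      rw [h'] at h1
      rw [← h, ← h3] at h2
      omega

/-- If every `h` has a candidate `r h` such that conflicting elements have distinct candidates,
then candidates can be found among the first `#U` candidates. -/
theorem exists_candidate_of_small_rank {n : ℕ} (U : Finset (Fin n))
    (cand : Fin n → Fin n → Prop) [∀ h r, Decidable (cand h r)] (L : Fin n → ℕ)
    (r : Fin n → Fin n) (hr : ∀ h ∈ U, cand h (r h))
    (hL : ∀ h ∈ U, ∀ h' ∈ U, r h = r h' → L h = L h') :
    ∃ r' : Fin n → Fin n, (∀ h ∈ U, cand h (r' h)) ∧
      (∀ h ∈ U, ∀ h' ∈ U, r' h = r' h' → L h = L h') ∧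
      ∀ h ∈ U, (Finset.univ.filter fun s => s < r' h ∧ cand h s).card < U.card := by
  induction hm : ∑ h ∈ U, (r h : ℕ) using Nat.strong_induction_on generalizing r with
  | _ k ih =>
    by_cases hsmall : ∀ h ∈ U, (Finset.univ.filter fun s => s < r h ∧ cand h s).card < U.card
    · exact ⟨r, hr, hL, hsmall⟩
    · push Not at hsmall
      obtain ⟨h, hU, hle⟩ := hsmall
      -- The other members of `U` occupy fewer than `#U` values, but at least `#U` candidates of `h`
      -- lie below `r h`; so one of these is free.
      have hlt : ((U.erase h).image r).card <
          (Finset.univ.filter fun s => s < r h ∧ cand h s).card := by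
        refine lt_of_lt_of_le (lt_of_le_of_lt Finset.card_image_le ?_) hle
        exact Finset.card_lt_card (Finset.erase_ssubset hU)
      obtain ⟨s, hs, hs'⟩ := Finset.exists_mem_notMem_of_card_lt_card hlt
      simp only [Finset.mem_filter, Finset.mem_univ, true_and] at hs
      simp only [Finset.mem_image, Finset.mem_erase, not_exists, not_and, and_imp] at hs'
      -- Moving `h` to a free smaller candidate causes no conflict and lowers the sum of all values,
      -- the measure of the induction.
      refine ih _ ?_ (Function.update r h s) ?_ ?_ rfl
      · rw [← hm]
        refine Finset.sum_lt_sum (fun x hx => ?_) ⟨h, hU, by simpa using hs.1⟩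
        by_cases hxh : x = h
        · subst hxh; simpa using hs.1.le
        · simp [hxh]
      · intro x hx
        by_cases hxh : x = h
        · subst hxh; simpa using hs.2
        · simpa [hxh] using hr x hx
      · intro x hx y hy hxy
        by_cases hxh : x = h <;> by_cases hyh : y = h
        · rw [hxh, hyh]
        · subst hxh
          simp only [Function.update_self, ne_eq, hyh, not_false_eq_true,
            Function.update_of_ne] at hxy
          exact absurd hxy.symm (hs' y hyh hy)
        · subst hyh
          simp only [Function.update_self, ne_eq, hxh, not_false_eq_true,
            Function.update_of_ne] at hxy
          exact absurd hxy (hs' x hxh hx)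
        · simp only [ne_eq, hxh, hyh, not_false_eq_true, Function.update_of_ne] at hxy
          exact hL x hx y hy hxy

/-! ### Sketches of Steiner forests -/

/-- A sketch of a rooted Steiner forest relative to a vertex cover `C`.  All values at members of
`C` are meant to be members of `C`: the root `lab i` of the tree of `i`, an indication `dep i` of
the depth of `i`, whether the parent of `i` is in `C` (`kind i = i`), and this parent or the name
`h` of the parent outside of `C` (a *hub*).  The parent of the hub `h` is `hub h`, the hub is
a member of a demand class with more than one element if `typ h = h`, and the rank of `idx h` in `C`
tells which of the suitable classes contains the hub. -/
structure Sketch (n : ℕ) where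
  lab : Fin n → ℕ
  dep : Fin n → ℕ
  kind : Fin n → ℕ
  par : Fin n → ℕ
  hub : Fin n → ℕ
  typ : Fin n → ℕ
  idx : Fin n → ℕ

/-- `v` is not alone in its class. -/
def IsTerminal {n : ℕ} (cls : Fin n → ℕ) (v : Fin n) : Prop :=
  ∃ u, u ≠ v ∧ cls u = cls v

namespace Sketch

variable {n : ℕ} (G : SimpleGraph (Fin n)) (C : Finset (Fin n)) (cls : Fin n → ℕ) (g : Sketch n)

/-- The parent of `i` is the hub `h`. -/
def HubChild (i h : Fin n) : Prop :=
  i ∈ C ∧ g.lab i ≠ i ∧ g.kind i ≠ i ∧ g.par i = h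

/-- The hub `h` occurs. -/
def Used (h : Fin n) : Prop :=
  ∃ i, g.HubChild C i h

/-- All members of class `r` can be in the tree with root `b`. -/
def ClassFits (r b : ℕ) : Prop :=
  ∀ u, cls u = r → (u ∈ C ∧ g.lab u = b) ∨ (u ∉ C ∧ ∃ c ∈ C, G.Adj u c ∧ g.lab c = b)

/-- Class `r` has a member that can be the hub `h`. -/
def Candidate (h : Fin n) (r : ℕ) : Prop :=
  ∃ c ∈ C, g.hub h = c ∧ g.ClassFits G C cls r (g.lab c) ∧
    ∃ v ∉ C, cls v = r ∧ (IsTerminal cls v ↔ g.typ h = h) ∧ G.Adj v c ∧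
      ∀ i, g.HubChild C i h → G.Adj v i

open Classical in
/-- The hub `h` is in class `r`. -/
def Chosen (h r : Fin n) : Prop :=
  g.Candidate G C cls h r ∧
    (Finset.univ.filter fun s => s < r ∧ g.Candidate G C cls h s).card =
    (Finset.univ.filter fun u => u ∈ C ∧ (u : ℕ) < g.idx h).card

/-- The parents of the vertices in `C` are as they should be. -/
def ParentsValid : Prop :=
  ∀ i ∈ C, g.lab i = i ∨
    (g.kind i = i ∧ ∃ c ∈ C, g.par i = c ∧ G.Adj i c ∧ g.lab c = g.lab i ∧ g.dep c < g.dep i) ∨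
    (g.kind i ≠ i ∧ ∃ h ∈ C, g.par i = h ∧
      ∃ c ∈ C, g.hub h = c ∧ g.lab c = g.lab i ∧ g.dep c < g.dep i)

/-- Hubs in the same class are in the same tree. -/
def HubsConsistent : Prop :=
  ∀ h h' : Fin n, g.Used C h → g.Used C h' →
    ∀ r, g.Chosen G C cls h r → g.Chosen G C cls h' r →
      ∀ c c' : Fin n, g.hub h = c → g.hub h' = c' → g.lab c = g.lab c'

/-- There is a Steiner forest with this sketch. -/
structure Valid : Prop where
  parents : g.ParentsValid G C
  hubs : ∀ h, g.Used C h → ∃ r, g.Chosen G C cls h r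
  consistent : g.HubsConsistent G C cls
  classes : ∀ v, IsTerminal cls v → ∃ b : Fin n, g.ClassFits G C cls (cls v) b

open Classical in
/-- A bound on the number of edges of a Steiner forest with this sketch. -/
noncomputable def cost : ℕ :=
  (Finset.univ.filter fun i => i ∈ C ∧ g.lab i ≠ i).card +
  (Finset.univ.filter fun v => v ∉ C ∧ IsTerminal cls v).card +
  (Finset.univ.filter fun h => g.Used C h ∧ g.typ h ≠ h).card

/-! ### From sketches to forests -/

variable {G C cls g}

/-- Realize every used hub by a suitable vertex of its class. Hubs realized by the same vertex are
in the same class, hence in the same tree by `HubsConsistent`. The remaining terminals outside `C`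
become leaves at a neighbour in the tree of their class, which exists by `ClassFits`; all other
vertices outside `C` stay isolated. -/
theorem Valid.exists_connectsPairs {S : Set (Fin n × Fin n)}
    (hcls : ∀ p ∈ S, cls p.1 = cls p.2) (hlt : ∀ v, cls v < n) (hv : g.Valid G C cls) :
    ∃ H ≤ G, ConnectsPairs S H ∧ H.edgeSet.ncard ≤ g.cost C cls := by
  classical
  have h1 : ∀ h, ∃ r c v : Fin n, g.Used C h → g.Chosen G C cls h r ∧ c ∈ C ∧ g.hub h = c ∧
      g.ClassFits G C cls r (g.lab c) ∧ v ∉ C ∧ cls v = r ∧ (IsTerminal cls v ↔ g.typ h = h) ∧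
      G.Adj v c ∧ ∀ i, g.HubChild C i h → G.Adj v i := by
    intro h
    by_cases hu : g.Used C h
    · obtain ⟨r, hr⟩ := hv.hubs h hu
      obtain ⟨c, hc, hq, hf, v, hvC, hv⟩ := hr.1
      exact ⟨r, c, v, fun _ => ⟨hr, hc, hq, hf, hvC, hv⟩⟩
    · exact ⟨h, h, h, fun h' => absurd h' hu⟩
  choose r c v hrcv using h1
  -- the root of the tree of every class
  have h2 : ∀ s : Fin n, ∃ b : ℕ, (∀ h, g.Used C h → r h = s → b = g.lab (c h)) ∧
      (∀ u, IsTerminal cls u → cls u = s → g.ClassFits G C cls s b) := by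
    intro s
    by_cases hs : ∃ h, g.Used C h ∧ r h = s
    · obtain ⟨h, hu, rfl⟩ := hs
      refine ⟨g.lab (c h), fun h' hu' hr' => ?_, fun u _ _ => (hrcv h hu).2.2.2.1⟩
      exact hv.consistent h h' hu hu' (r h) (hrcv h hu).1 (hr' ▸ (hrcv h' hu').1) _ _
        (hrcv h hu).2.2.1 (hrcv h' hu').2.2.1
    · by_cases ht : ∃ u, IsTerminal cls u ∧ cls u = s
      · obtain ⟨u, hu, hus⟩ := ht
        obtain ⟨b, hb⟩ := hv.classes u hu
        exact ⟨b, fun h hu hr => absurd ⟨h, hu, hr⟩ hs, fun _ _ _ => hus ▸ hb⟩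
      · exact ⟨0, fun h hu hr => absurd ⟨h, hu, hr⟩ hs, fun u hu hus => absurd ⟨u, hu, hus⟩ ht⟩
  choose β hβ₁ hβ₂ using h2
  -- parents outside of the cover
  have h3 : ∀ u, u ∉ C → ∃ (p : Fin n) (l d : ℕ), (l = u ∨ (p ∈ C ∧ G.Adj u p ∧ l = g.lab p ∧
        2 * g.dep p < d)) ∧
      (l ≠ u → IsTerminal cls u ∨ ∃ h, g.Used C h ∧ g.typ h ≠ h ∧ v h = u) ∧
      (IsTerminal cls u → l = β ⟨cls u, hlt u⟩) ∧
      (∀ h, g.Used C h → v h = u → l = g.lab (c h) ∧ d ≤ 2 * g.dep (c h) + 1) := by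
    intro u hu
    by_cases hh : ∃ h, g.Used C h ∧ v h = u
    -- If several hubs share the vertex `u`, the shallowest of their parents becomes the parent of
    -- `u`; then `u` is less deep than the children of all these hubs.
    · obtain ⟨h, hm, hmin⟩ := Finset.exists_min_image
        (Finset.univ.filter fun h => g.Used C h ∧ v h = u) (fun h => g.dep (c h))
        (by obtain ⟨h, hh⟩ := hh; exact ⟨h, by simpa using hh⟩)
      simp only [Finset.mem_filter, Finset.mem_univ, true_and, and_imp] at hm hmin
      obtain ⟨hused, rfl⟩ := hm
      obtain ⟨hr, hcC, hq, hf, -, hvr, ht, hadj, -⟩ := hrcv h hused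
      have hs : (⟨cls (v h), hlt (v h)⟩ : Fin n) = r h := Fin.ext hvr
      refine ⟨c h, g.lab (c h), 2 * g.dep (c h) + 1, .inr ⟨hcC, hadj, rfl, by omega⟩,
        fun _ => ?_, fun _ => ?_, fun h' hu' hv' => ⟨?_, ?_⟩⟩
      · by_cases hT : IsTerminal cls (v h)
        · exact .inl hT
        · exact .inr ⟨h, hused, fun h' => hT (ht.2 h'), rfl⟩
      · rw [hs, hβ₁ _ h hused rfl]
      · have : r h' = r h := Fin.ext (by rw [← (hrcv h' hu').2.2.2.2.2.1, hv', hvr])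
        rw [← hβ₁ _ h hused rfl, hβ₁ _ h' hu' this]
      · have := hmin h' hu' hv'
        omega
    · have hh' : ∀ h, g.Used C h → v h ≠ u := fun h h1 h2 => hh ⟨h, h1, h2⟩
      by_cases hT : IsTerminal cls u
      · obtain ⟨p, hp, hadj, hlab⟩ :=
          ((hβ₂ ⟨cls u, hlt u⟩ u hT rfl u rfl).resolve_left fun h => hu h.1).2
        exact ⟨p, β ⟨cls u, hlt u⟩, 2 * g.dep p + 1, .inr ⟨hp, hadj, hlab.symm, by omega⟩,
          fun _ => .inl hT, fun _ => rfl, fun h h1 h2 => absurd h2 (hh' h h1)⟩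
      · exact ⟨u, u, 0, .inl rfl, fun h => absurd rfl h, fun h => absurd h hT,
          fun h h1 h2 => absurd h2 (hh' h h1)⟩
  choose! P L D hP hL hβL hLh using h3
  have h4 : ∀ i ∈ C, ∃ p : Fin n, g.lab i = i ∨ (G.Adj i p ∧
      ((p ∈ C ∧ g.lab p = g.lab i ∧ g.dep p < g.dep i) ∨
       (p ∉ C ∧ L p = g.lab i ∧ D p < 2 * g.dep i))) := by
    intro i hi
    rcases hv.parents i hi with h | h | h
    · exact ⟨i, .inl h⟩
    · obtain ⟨-, p, hp, -, hadj, hl, hd⟩ := h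
      exact ⟨p, .inr ⟨hadj, .inl ⟨hp, hl, hd⟩⟩⟩
    · by_cases hroot : g.lab i = i
      · exact ⟨i, .inl hroot⟩
      obtain ⟨hk, h, hhC, hpar, c', hc', hq, hl, hd⟩ := h
      have hch : g.HubChild C i h := ⟨hi, hroot, hk, hpar⟩
      have hused : g.Used C h := ⟨i, hch⟩
      obtain ⟨hr, hcC, hq', hf, hvC, hvr, ht, hadj, hall⟩ := hrcv h hused
      have hcc : c' = c h := Fin.ext (hq.symm.trans hq')
      obtain ⟨e1, e2⟩ := hLh (v h) hvC h hused rfl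
      refine ⟨v h, .inr ⟨(hall i hch).symm, .inr ⟨hvC, ?_, ?_⟩⟩⟩
      · rw [e1, ← hcc, hl]
      · rw [hcc] at hd; omega
  choose! Q hQ using h4
  obtain ⟨H, hHG, hcard, hreach⟩ := exists_le_of_parents (G := G)
    (par := fun x => if x ∈ C then Q x else P x)
    (lab := fun x => if x ∈ C then g.lab x else L x)
    -- Doubling leaves room for hubs: below a parent `c` and above a child `i` there is the odd
    -- depth `2 * g.dep c + 1 < 2 * g.dep i`.
    (dep := fun x => if x ∈ C then 2 * g.dep x else D x) (by
      intro x
      by_cases hx : x ∈ C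
      · simp only [hx, if_true]
        rcases hQ x hx with h | ⟨h, ⟨h1, h2, h3⟩ | ⟨h1, h2, h3⟩⟩
        · exact .inl h
        · simp only [h1, if_true]
          exact .inr ⟨h, h2, by omega⟩
        · simp only [h1, if_false]
          exact .inr ⟨h, h2, h3⟩
      · simp only [hx, if_false]
        rcases hP x hx with h | ⟨h1, h2, h3, h4⟩
        · exact .inl h
        · simp only [h1, if_true]
          exact .inr ⟨h2, h3.symm, h4⟩)
  refine ⟨H, hHG, fun p hp => ?_, hcard.trans ?_⟩
  · by_cases hne : p.1 = p.2
    · rw [hne]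
    have key : ∀ x, IsTerminal cls x →
        (if x ∈ C then g.lab x else L x) = β ⟨cls x, hlt x⟩ := by
      intro x hx
      split_ifs with hxC
      · exact ((hβ₂ ⟨cls x, hlt x⟩ x hx rfl x rfl).resolve_right fun h => h.1 hxC).2
      · exact hβL x hxC hx
    have e := hcls p hp
    refine hreach _ _ ((key _ ⟨p.2, fun h => hne h.symm, e.symm⟩).trans
      (Eq.trans ?_ (key _ ⟨p.1, hne, e⟩).symm))
    congr 1
    exact Fin.ext e
  · rw [cost]
    -- A non-root outside `C` is a terminal or realizes a hub that is not a terminal; merged hubs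
    -- only make the image under `v` smaller.
    calc (Finset.univ.filter fun x : Fin n => (if x ∈ C then g.lab x else L x) ≠ x).card
        ≤ ((Finset.univ.filter fun i : Fin n => i ∈ C ∧ g.lab i ≠ i) ∪
          (Finset.univ.filter fun v => v ∉ C ∧ IsTerminal cls v) ∪
          ((Finset.univ.filter fun h => g.Used C h ∧ g.typ h ≠ h).image v)).card := by
          refine Finset.card_le_card fun x hx => ?_
          simp only [Finset.mem_filter, Finset.mem_univ, true_and, Finset.mem_union,
            Finset.mem_image] at hx ⊢
          by_cases hxC : x ∈ C
          · simp only [hxC, if_true] at hx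
            exact .inl (.inl ⟨hxC, hx⟩)
          · simp only [hxC, if_false] at hx
            rcases hL x hxC hx with h | ⟨h, h1, h2, h3⟩
            · exact .inl (.inr ⟨hxC, h⟩)
            · exact .inr ⟨h, ⟨h1, h2⟩, h3⟩
      _ ≤ _ := by
          refine (Finset.card_union_le _ _).trans (add_le_add (Finset.card_union_le _ _) ?_)
          exact Finset.card_image_le

end Sketch

/-! ### From forests to sketches -/

theorem Finset.exists_mem_card_filter_lt {n : ℕ} (C : Finset (Fin n)) {r : ℕ} (hr : r < C.card) :
    ∃ c ∈ C, (Finset.univ.filter fun u => u ∈ C ∧ u < c).card = r := by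
  refine ⟨C.orderEmbOfFin rfl ⟨r, hr⟩, C.orderEmbOfFin_mem rfl _, ?_⟩
  have : (Finset.univ.filter fun u => u ∈ C ∧ u < C.orderEmbOfFin rfl ⟨r, hr⟩) =
      (Finset.Iio (⟨r, hr⟩ : Fin C.card)).map (C.orderEmbOfFin rfl).toEmbedding := by
    ext u
    simp only [Finset.mem_filter, Finset.mem_univ, true_and, Finset.mem_map, Finset.mem_Iio]
    constructor
    · rintro ⟨hu, hlt⟩
      have : u ∈ Set.range (C.orderEmbOfFin rfl) := by
        rw [Finset.range_orderEmbOfFin]; exact hu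
      obtain ⟨i, rfl⟩ := this
      exact ⟨i, by simpa using hlt, rfl⟩
    · rintro ⟨i, hi, rfl⟩
      exact ⟨C.orderEmbOfFin_mem rfl i, by simpa using hi⟩
  rw [this, Finset.card_map, Fin.card_Iio]

namespace Sketch

variable {n : ℕ} {G : SimpleGraph (Fin n)} {C : Finset (Fin n)} {cls : Fin n → ℕ}

/-- `f` maps `C` to `C`, and everything else to `0`. -/
def IsMapOn (C : Finset (Fin n)) (f : Fin n → ℕ) : Prop :=
  (∀ i ∈ C, ∃ c ∈ C, f i = (c : Fin n)) ∧ ∀ i ∉ C, f i = 0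

/-- All values at members of `C` are members of `C`. -/
structure Normal (C : Finset (Fin n)) (g : Sketch n) : Prop where
  lab : IsMapOn C g.lab
  dep : IsMapOn C g.dep
  kind : IsMapOn C g.kind
  par : IsMapOn C g.par
  hub : IsMapOn C g.hub
  typ : IsMapOn C g.typ
  idx : IsMapOn C g.idx

theorem exists_isMapOn {C : Finset (Fin n)} (f : Fin n → Fin n) (hf : ∀ i ∈ C, f i ∈ C) :
    ∃ f' : Fin n → ℕ, IsMapOn C f' ∧ ∀ i ∈ C, f' i = f i := by
  classical
  exact ⟨fun i => if i ∈ C then f i else 0, ⟨fun i hi => ⟨f i, hf i hi, by simp [hi]⟩,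
    fun i hi => by simp [hi]⟩, fun i hi => by simp [hi]⟩

/-- Read the sketch off the rooted forest given by `exists_parents`. A hub is named after one of its
children in `C`. Depths are replaced by ranks, and numbers below `#C` are stored as the members of
`C` of that rank. A yes-no value at `i` is stored as `i` or as another member of `C`, which is why
`hpair` is needed. The actual classes of the hubs are candidates without conflicts, since a class
lies in one tree; they are exchanged for candidates of small rank, which does not affect the cost.
-/
theorem exists_valid {H : SimpleGraph (Fin n)} (hHG : H ≤ G)
    (hC : ∀ u v, G.Adj u v → u ∈ C ∨ v ∈ C) (hpair : ∀ c ∈ C, ∃ c' ∈ C, c' ≠ c)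
    (hlt : ∀ v, cls v < n) (hcls : ∀ u v, cls u = cls v → H.Reachable u v) :
    ∃ g : Sketch n, g.Normal C ∧ g.Valid G C cls ∧ g.cost C cls ≤ H.edgeSet.ncard := by
  classical
  obtain ⟨par, lab, dep, hpar, hreach, hcard⟩ := exists_parents H (C : Set (Fin n))
    (fun u v h => hC u v (hHG h))
  simp only [Finset.mem_coe] at hpar
  have hclab : ∀ u v, cls u = cls v → lab u = lab v := fun u v h => (hreach u v).2 (hcls u v h)
  have hlabC : ∀ i ∈ C, lab i ∈ C := by
    intro i hi
    by_cases h : lab i = i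
    · rwa [h]
    · exact (hpar i h).2.2.2
  choose! oth hothC hoth using hpair
  have hout : ∀ v, v ∉ C → lab v ≠ v → par v ∈ C := fun v hv h =>
    (hC _ _ (hHG (hpar v h).1)).resolve_left hv
  -- depths
  have hδ : ∀ c ∈ C, ∃ d ∈ C, (Finset.univ.filter fun u => u ∈ C ∧ u < d).card =
      (C.filter fun u => dep u < dep c).card := fun c hc =>
    C.exists_mem_card_filter_lt (Finset.card_lt_card
      ⟨Finset.filter_subset _ _, fun h => by simpa using h hc⟩)
  choose! δ hδC hδ using hδ
  -- The rank of `δ c` is the number of members of `C` less deep than `c`, so strict inequalities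
  -- between depths are kept.
  have hδlt : ∀ c ∈ C, ∀ c' ∈ C, dep c < dep c' → δ c < δ c' := by
    intro c hc c' hc' h
    by_contra hle
    push Not at hle
    have h1 : (C.filter fun u => dep u < dep c).card < (C.filter fun u => dep u < dep c').card := by
      refine Finset.card_lt_card ⟨fun u hu => ?_, fun h' => ?_⟩
      · simp only [Finset.mem_filter] at hu ⊢
        exact ⟨hu.1, hu.2.trans h⟩
      · have := h' (Finset.mem_filter.2 ⟨hc, h⟩)
        simp at this
    rw [← hδ c hc, ← hδ c' hc'] at h1
    refine absurd (Finset.card_le_card fun u hu => ?_) (not_le.2 h1)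
    simp only [Finset.mem_filter, Finset.mem_univ, true_and] at hu ⊢
    exact ⟨hu.1, hu.2.trans_le hle⟩
  -- names of hubs
  have hrep : ∀ v, ∃ i, (∃ j ∈ C, lab j ≠ j ∧ par j = v) → i ∈ C ∧ lab i ≠ i ∧ par i = v := by
    intro v
    by_cases h : ∃ j ∈ C, lab j ≠ j ∧ par j = v
    · obtain ⟨j, hj⟩ := h
      exact ⟨j, fun _ => hj⟩
    · exact ⟨v, fun h' => absurd h' h⟩
  choose rep hrep using hrep
  have hrep' : ∀ i ∈ C, lab i ≠ i → rep (par i) ∈ C ∧ lab (rep (par i)) ≠ rep (par i) ∧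
      par (rep (par i)) = par i := fun i hi h => hrep _ ⟨i, hi, h, rfl⟩
  obtain ⟨L, hLn, hL⟩ := exists_isMapOn lab hlabC
  obtain ⟨D, hDn, hD⟩ := exists_isMapOn δ hδC
  obtain ⟨A, hAn, hA⟩ := exists_isMapOn (C := C) (fun i => if par i ∈ C then i else oth i)
    (fun i hi => by split_ifs; exacts [hi, hothC i hi])
  obtain ⟨K, hKn, hK⟩ := exists_isMapOn (C := C)
    (fun i => if lab i = i then i else if par i ∈ C then par i else rep (par i))
    (fun i hi => by split_ifs with h1 h2; exacts [hi, h2, (hrep' i hi h1).1])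
  -- If `i` names a hub, its grandparent is in `C`; the value `i` in the other case is a mere
  -- default.
  obtain ⟨Q, hQn, hQ⟩ := exists_isMapOn (C := C)
    (fun i => if par (par i) ∈ C then par (par i) else i)
    (fun i hi => by split_ifs with h1; exacts [h1, hi])
  obtain ⟨T, hTn, hT⟩ := exists_isMapOn (C := C)
    (fun i => if IsTerminal cls (par i) then i else oth i)
    (fun i hi => by split_ifs; exacts [hi, hothC i hi])
  have hchild : ∀ (J : Fin n → ℕ) i h, HubChild C ⟨L, D, A, K, Q, T, J⟩ i h ↔
      i ∈ C ∧ lab i ≠ i ∧ par i ∉ C ∧ rep (par i) = h := by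
    intro J i h
    simp only [HubChild]
    refine and_congr_right fun hi => ?_
    rw [hL i hi, hA i hi, hK i hi]
    simp only [ne_eq, Fin.val_inj]
    refine and_congr_right fun hi' => ?_
    by_cases hp : par i ∈ C
    · simp [hp]
    · simp [hp, hi', hoth i hi]
  have hused : ∀ (J : Fin n → ℕ) h, Used C ⟨L, D, A, K, Q, T, J⟩ h →
      h ∈ C ∧ lab h ≠ h ∧ par h ∉ C ∧ rep (par h) = h := by
    rintro J h ⟨i, hi⟩
    obtain ⟨hiC, h1, h2, rfl⟩ := (hchild J i h).1 hi
    obtain ⟨h3, h4, h5⟩ := hrep' i hiC h1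
    exact ⟨h3, h4, h5.symm ▸ h2, by rw [h5]⟩
  have hhub : ∀ h ∈ C, lab h ≠ h → par h ∉ C → lab (par h) ≠ par h ∧ par (par h) ∈ C ∧
      G.Adj (par h) (par (par h)) ∧ lab (par h) = lab h ∧ lab (par (par h)) = lab h ∧
      dep (par (par h)) < dep h ∧ Q h = par (par h) := by
    intro h hh h1 h2
    obtain ⟨h3, h4, h5, h6⟩ := hpar h h1
    have h7 : lab (par h) ≠ par h := fun h8 => h2 (by rw [← h8, h4]; exact h6)
    obtain ⟨g3, g4, g5, g6⟩ := hpar _ h7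
    have g7 := hout _ h2 h7
    exact ⟨h7, g7, hHG g3, h4, g4.trans h4, g5.trans h5, by simp [hQ h hh, g7]⟩
  have hfits : ∀ (J : Fin n → ℕ) v, lab v ∈ C →
      ClassFits G C cls ⟨L, D, A, K, Q, T, J⟩ (cls v) (lab v) := by
    intro J v hv u hu
    have hlu := hclab u v hu
    by_cases huC : u ∈ C
    · exact .inl ⟨huC, by simp only [hL u huC, hlu]⟩
    · have hne : lab u ≠ u := fun h => huC (by rw [← h, hlu]; exact hv)
      have hp := hout u huC hne
      obtain ⟨h3, h4, -⟩ := hpar u hne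
      exact .inr ⟨huC, _, hp, hHG h3, by simp only [hL _ hp, h4, hlu]⟩
  have hcand : ∀ (J : Fin n → ℕ) h, Used C ⟨L, D, A, K, Q, T, J⟩ h →
      Candidate G C cls ⟨L, D, A, K, Q, T, J⟩ h (cls (par h)) := by
    intro J h hu
    obtain ⟨h1, h2, h3, h4⟩ := hused J h hu
    obtain ⟨g1, g2, g3, g4, g5, g6, g7⟩ := hhub h h1 h2 h3
    refine ⟨_, g2, g7, ?_, par h, h3, rfl, ?_, g3, fun i hi => ?_⟩
    · simp only [hL _ g2, g5, ← g4]
      exact hfits J _ (by rw [g4]; exact hlabC h h1)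
    · simp only [hT h h1]
      split_ifs with ht
      · simp [ht]
      · simp [ht, Fin.val_inj, hoth h h1]
    · obtain ⟨k1, k2, k3, k4⟩ := (hchild J i h).1 hi
      have : par h = par i := by rw [← k4, (hrep' i k1 k2).2.2]
      rw [this]
      exact hHG (hpar i k2).1.symm
  -- Neither the used hubs nor their candidates depend on `idx`, so a constant stands in for it
  -- until the classes have been chosen.
  set U : Finset (Fin n) := Finset.univ.filter fun h => Used C ⟨L, D, A, K, Q, T, fun _ => 0⟩ h
    with hU
  have hUmem : ∀ J h, Used C ⟨L, D, A, K, Q, T, J⟩ h → h ∈ U := fun J h hu =>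
    Finset.mem_filter.2 ⟨Finset.mem_univ _, hu⟩
  obtain ⟨r, hr, hrL, hrank⟩ := exists_candidate_of_small_rank U
    (fun h r => Candidate G C cls ⟨L, D, A, K, Q, T, fun _ => 0⟩ h r) (fun h => lab (par (par h)))
    (fun h => ⟨cls (par h), hlt _⟩)
    (fun h hh => hcand _ h (by simpa [hU] using hh)) (by
      intro h hh h' hh' he
      obtain ⟨h1, h2, h3, h4⟩ := hused _ h (by simpa [hU] using hh)
      obtain ⟨h1', h2', h3', h4'⟩ := hused _ h' (by simpa [hU] using hh')
      obtain ⟨-, -, -, g4, g5, -⟩ := hhub h h1 h2 h3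
      obtain ⟨-, -, -, g4', g5', -⟩ := hhub h' h1' h2' h3'
      rw [g5, g5', ← g4, ← g4', hclab _ _ (Fin.mk.inj_iff.1 he)])
  have hUC : U.card ≤ C.card := Finset.card_le_card fun h hh =>
    (hused _ h (by simpa [hU] using hh)).1
  -- The rank of the new class among the candidates is below `#U ≤ #C`, so it is the rank of a
  -- member of `C`.
  have hJ : ∀ h ∈ C, ∃ c ∈ C, h ∈ U → (Finset.univ.filter fun u => u ∈ C ∧ u < c).card =
      (Finset.univ.filter fun s => s < r h ∧
        Candidate G C cls ⟨L, D, A, K, Q, T, fun _ => 0⟩ h s).card := by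
    intro h hh
    by_cases hhU : h ∈ U
    · obtain ⟨c, hc, he⟩ := C.exists_mem_card_filter_lt ((hrank h hhU).trans_le hUC)
      exact ⟨c, hc, fun _ => he⟩
    · exact ⟨h, hh, fun h' => absurd h' hhU⟩
  choose! j hjC hj using hJ
  obtain ⟨J, hJn, hJ⟩ := exists_isMapOn j hjC
  have hchosen : ∀ h s, Used C ⟨L, D, A, K, Q, T, J⟩ h →
      (Chosen G C cls ⟨L, D, A, K, Q, T, J⟩ h s ↔ s = r h) := by
    intro h s hu
    have hhU : h ∈ U := hUmem J h hu
    have hhC := (hused _ h hu).1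
    have e := hj h hhC hhU
    have hCd := hr h hhU
    simp only [Chosen, hJ h hhC, Fin.val_fin_lt]
    rw [e]
    constructor
    · rintro ⟨h1, h2⟩
      by_contra hne
      rcases lt_or_gt_of_ne hne with hlt | hlt
      · refine absurd h2 (ne_of_lt (Finset.card_lt_card ⟨fun x hx => ?_, fun hh => ?_⟩))
        · simp only [Finset.mem_filter, Finset.mem_univ, true_and] at hx ⊢
          exact ⟨hx.1.trans hlt, hx.2⟩
        · have := hh (Finset.mem_filter.2 ⟨Finset.mem_univ _, hlt, h1⟩)
          simp at this
      · refine absurd h2 (ne_of_gt (Finset.card_lt_card ⟨fun x hx => ?_, fun hh => ?_⟩))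
        · simp only [Finset.mem_filter, Finset.mem_univ, true_and] at hx ⊢
          exact ⟨hx.1.trans hlt, hx.2⟩
        · have := hh (Finset.mem_filter.2 ⟨Finset.mem_univ _, hlt, hCd⟩)
          simp at this
    · rintro rfl
      exact ⟨hCd, rfl⟩
  -- If `v` is itself a root, another member of its class is a non-root with the same root, and
  -- roots of non-roots are in `C`.
  have hterm : ∀ v, IsTerminal cls v → lab v ∈ C := by
    rintro v ⟨u, hne, hu⟩
    have hl := hclab u v hu
    by_cases h : lab v = v
    · rw [← hl]
      exact (hpar u (by rw [hl, h]; exact hne.symm)).2.2.2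
    · exact (hpar v h).2.2.2
  refine ⟨⟨L, D, A, K, Q, T, J⟩, ⟨hLn, hDn, hAn, hKn, hQn, hTn, hJn⟩, ⟨?_, ?_, ?_, ?_⟩, ?_⟩
  · intro i hi
    by_cases h1 : lab i = i
    · exact .inl (by simp only [hL i hi, h1])
    obtain ⟨h3, h4, h5, h6⟩ := hpar i h1
    by_cases h2 : par i ∈ C
    · refine .inr (.inl ⟨by simp [hA i hi, h2], par i, h2, by simp [hK i hi, h1, h2], hHG h3,
        by simp only [hL i hi, hL _ h2, h4], ?_⟩)
      simp only [hD i hi, hD _ h2]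
      exact hδlt _ h2 _ hi h5
    · obtain ⟨h7, h8, h9⟩ := hrep' i hi h1
      obtain ⟨g1, g2, g3, g4, g5, g6, g7⟩ := hhub _ h7 h8 (by rw [h9]; exact h2)
      rw [h9] at g1 g2 g3 g4 g5 g6 g7
      refine .inr (.inr ⟨by simp [hA i hi, h2, Fin.val_inj, hoth i hi], rep (par i), h7,
        by simp [hK i hi, h1, h2], _, g2, g7, ?_, ?_⟩)
      · simp only [hL _ g2, hL i hi, g5, ← g4, h4]
      · simp only [hD _ g2, hD i hi]
        obtain ⟨-, -, -, -, -, k6, -⟩ := hhub i hi h1 h2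
        exact hδlt _ g2 _ hi k6
  · intro h hu
    exact ⟨r h, (hchosen h _ hu).2 rfl⟩
  · intro h h' hu hu' s hs hs' c c' hc hc'
    have e1 := (hchosen h s hu).1 hs
    have e2 := (hchosen h' s hu').1 hs'
    have e := hrL h (hUmem J h hu) h' (hUmem J h' hu') (e1.symm.trans e2)
    obtain ⟨h1, h2, h3, h4⟩ := hused _ h hu
    obtain ⟨h1', h2', h3', h4'⟩ := hused _ h' hu'
    obtain ⟨-, g2, -, -, -, -, g7⟩ := hhub h h1 h2 h3
    obtain ⟨-, g2', -, -, -, -, g7'⟩ := hhub h' h1' h2' h3'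
    have k1 : c = par (par h) := Fin.ext (hc.symm.trans g7)
    have k2 : c' = par (par h') := Fin.ext (hc'.symm.trans g7')
    subst k1 k2
    simp only [hL _ g2, hL _ g2']
    exact congrArg Fin.val (Fin.ext e)
  · intro v hv
    exact ⟨lab v, hfits J v (hterm v hv)⟩
  · refine le_trans ?_ hcard
    have hinj : ((Finset.univ.filter fun h => Used C ⟨L, D, A, K, Q, T, J⟩ h ∧ T h ≠ h).image
        par).card = (Finset.univ.filter fun h => Used C ⟨L, D, A, K, Q, T, J⟩ h ∧ T h ≠ h).card := by
      refine Finset.card_image_of_injOn fun x hx y hy hxy => ?_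
      simp only [Finset.coe_filter, Finset.mem_univ, true_and, Set.mem_ofPred_eq] at hx hy
      rw [← (hused _ x hx.1).2.2.2, ← (hused _ y hy.1).2.2.2, hxy]
    rw [cost]
    dsimp only
    -- The three summands count disjoint sets of non-roots of the forest; names of hubs are turned
    -- into vertices by `par`, which is injective on them.
    rw [← hinj, ← Finset.card_union_of_disjoint, ← Finset.card_union_of_disjoint,
      ← Set.ncard_coe_finset]
    · refine Set.ncard_le_ncard (fun x hx => ?_) (Set.toFinite _)
      simp only [Finset.coe_union, Finset.coe_filter, Finset.mem_univ, true_and, Finset.coe_image,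
        Set.mem_union, Set.mem_ofPred_eq, Set.mem_image] at hx ⊢
      rcases hx with (⟨h1, h2⟩ | ⟨h1, h2⟩) | ⟨h, ⟨h1, -⟩, rfl⟩
      · rw [hL x h1] at h2
        exact fun h => h2 (by rw [h])
      · exact fun h => h1 (by rw [← h]; exact hterm x h2)
      · obtain ⟨k1, k2, k3, k4⟩ := hused _ h h1
        exact (hhub h k1 k2 k3).1
    · rw [Finset.disjoint_left]
      intro x hx hx'
      simp only [Finset.mem_union, Finset.mem_filter, Finset.mem_univ, true_and,
        Finset.mem_image] at hx hx'
      obtain ⟨h, ⟨h1, h2⟩, rfl⟩ := hx'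
      obtain ⟨k1, k2, k3, k4⟩ := hused _ h h1
      rcases hx with h' | h'
      · exact k3 h'.1
      · exact h2 (by simp [hT h k1, h'.2])
    · rw [Finset.disjoint_left]
      intro x hx hx'
      simp only [Finset.mem_filter, Finset.mem_univ, true_and] at hx hx'
      exact hx'.1 hx.1

end Sketch

namespace RAM.Exp

/-! ### Bounded first-order formulas as expressions

A formula is true if its value is not zero.  Register `1` holds the bound of all quantifiers. -/

def Holds (A : ℕ → ℕ → ℕ) (ρ : ℕ → ℕ) (e : Exp) : Prop := e.val A ρ ≠ 0

def lt (e f : Exp) : Exp := .sub f e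
def ne (e f : Exp) : Exp := .add (.sub e f) (.sub f e)
def not (e : Exp) : Exp := .cond e (.lit 0) (.lit 1)
def eq (e f : Exp) : Exp := (ne e f).not
def and (e f : Exp) : Exp := .cond e f (.lit 0)
def or (e f : Exp) : Exp := .add e f
def imp (e f : Exp) : Exp := .cond e f (.lit 1)
def iff (e f : Exp) : Exp := .cond e f f.not
def ex (x : ℕ) (e : Exp) : Exp := .sum x 1 e
def all (x : ℕ) (e : Exp) : Exp := (ex x e.not).not
def count (x : ℕ) (e : Exp) : Exp := .sum x 1 (.cond e (.lit 1) (.lit 0))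

variable {A : ℕ → ℕ → ℕ} {ρ : ℕ → ℕ} {e f : Exp} {x n : ℕ}

theorem holds_lt : Holds A ρ (lt e f) ↔ e.val A ρ < f.val A ρ := by
  simp only [Holds, lt, val]; omega

theorem holds_ne : Holds A ρ (ne e f) ↔ e.val A ρ ≠ f.val A ρ := by
  simp only [Holds, ne, val]; omega

theorem holds_not : Holds A ρ e.not ↔ ¬ Holds A ρ e := by
  simp [Holds, not, val]

theorem holds_eq : Holds A ρ (eq e f) ↔ e.val A ρ = f.val A ρ := by
  rw [eq, holds_not, holds_ne, not_not]

theorem holds_and : Holds A ρ (and e f) ↔ Holds A ρ e ∧ Holds A ρ f := by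
  simp [Holds, and, val]

theorem holds_or : Holds A ρ (or e f) ↔ Holds A ρ e ∨ Holds A ρ f := by
  simp only [Holds, or, val]; omega

theorem holds_imp : Holds A ρ (imp e f) ↔ (Holds A ρ e → Holds A ρ f) := by
  by_cases h : e.val A ρ = 0 <;> simp [Holds, imp, val, h]

theorem holds_iff : Holds A ρ (iff e f) ↔ (Holds A ρ e ↔ Holds A ρ f) := by
  by_cases h : e.val A ρ = 0 <;> simp [Holds, iff, not, val, h]

theorem val_sum (hn : ρ 1 = n) :
    (sum x 1 e).val A ρ = ∑ i : Fin n, e.val A (Function.update ρ x i) := by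
  simp only [val, hn, Finset.sum_range]

theorem holds_ex (hn : ρ 1 = n) :
    Holds A ρ (ex x e) ↔ ∃ i : Fin n, Holds A (Function.update ρ x i) e := by
  simp [Holds, ex, val_sum hn]

theorem holds_all (hn : ρ 1 = n) :
    Holds A ρ (all x e) ↔ ∀ i : Fin n, Holds A (Function.update ρ x i) e := by
  simp [all, holds_not, holds_ex hn]

open Classical in
theorem val_count (hn : ρ 1 = n) :
    (count x e).val A ρ =
      (Finset.univ.filter fun i : Fin n => Holds A (Function.update ρ x i) e).card := by
  rw [count, val_sum hn, Finset.card_filter]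
  exact Finset.sum_congr rfl fun i _ => by by_cases h : e.val A (Function.update ρ x i) = 0 <;>
    simp [val, Holds, h]

/-! ### Recognizing valid sketches -/

/-- Membership in the vertex cover. -/
def mark (x : ℕ) : Exp := .get 6 (.var x)
/-- Array `a` at the content of register `x`. -/
def at' (a x : ℕ) : Exp := .get a (.var x)
/-- Adjacency; the adjacency matrix begins at cell `o` of array `0`. -/
def adj (o x y : ℕ) : Exp := .get 0 (.add (.add (.lit o) (at' 5 x)) (.var y))

def hubChild (x y : ℕ) : Exp :=
  and (mark x) <| and (ne (at' 10 x) (.var x)) <| and (ne (at' 12 x) (.var x)) <|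
    eq (at' 13 x) (.var y)

def used (y : ℕ) : Exp := ex 20 (hubChild 20 y)

def terminal (x : ℕ) : Exp := ex 30 (and (ne (.var 30) (.var x)) (eq (at' 7 30) (at' 7 x)))

def classFits (o : ℕ) (r b : Exp) : Exp :=
  all 25 <| imp (eq (at' 7 25) r) <| or (and (mark 25) (eq (at' 10 25) b)) <|
    and (mark 25).not <| ex 29 <| and (mark 29) <| and (adj o 25 29) (eq (at' 10 29) b)

def candidate (o x y : ℕ) : Exp :=
  ex 26 <| and (mark 26) <| and (eq (at' 14 x) (.var 26)) <|
    and (classFits o (.var y) (at' 10 26)) <| ex 24 <| and (mark 24).not <|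
    and (eq (at' 7 24) (.var y)) <| and (iff (terminal 24) (eq (at' 15 x) (.var x))) <|
    and (adj o 24 26) <| all 20 <| imp (hubChild 20 x) (adj o 24 20)

def chosen (o x y : ℕ) : Exp :=
  and (candidate o x y) <| eq (count 28 (and (lt (.var 28) (.var y)) (candidate o x 28)))
    (count 31 (and (mark 31) (lt (.var 31) (at' 16 x))))

def parentsValid (o : ℕ) : Exp :=
  all 20 <| imp (mark 20) <| or (eq (at' 10 20) (.var 20)) <|
    or (and (eq (at' 12 20) (.var 20)) <| ex 26 <| and (mark 26) <|
      and (eq (at' 13 20) (.var 26)) <| and (adj o 20 26) <|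
      and (eq (at' 10 26) (at' 10 20)) (lt (at' 11 26) (at' 11 20))) <|
    and (ne (at' 12 20) (.var 20)) <| ex 21 <| and (mark 21) <|
      and (eq (at' 13 20) (.var 21)) <| ex 26 <| and (mark 26) <|
      and (eq (at' 14 21) (.var 26)) <|
      and (eq (at' 10 26) (at' 10 20)) (lt (at' 11 26) (at' 11 20))

def hubsConsistent (o : ℕ) : Exp :=
  all 21 <| all 22 <| imp (used 21) <| imp (used 22) <| all 23 <| imp (chosen o 21 23) <|
    imp (chosen o 22 23) <| all 32 <| all 33 <| imp (eq (at' 14 21) (.var 32)) <|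
    imp (eq (at' 14 22) (.var 33)) <| eq (at' 10 32) (at' 10 33)

def valid (o : ℕ) : Exp :=
  and (parentsValid o) <| and (all 21 (imp (used 21) (ex 23 (chosen o 21 23)))) <|
    and (hubsConsistent o) <|
    all 22 (imp (terminal 22) (ex 27 (classFits o (at' 7 22) (.var 27))))

def cost : Exp :=
  .add (.add (count 20 (and (mark 20) (ne (at' 10 20) (.var 20))))
    (count 24 (and (mark 24).not (terminal 24))))
    (count 21 (and (used 21) (ne (at' 15 21) (.var 21))))

/-- The arrays describe a graph, a vertex cover, the demand classes, and a sketch. -/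
structure Describes (o : ℕ) {n : ℕ} (G : SimpleGraph (Fin n)) (C : Finset (Fin n))
    (cls : Fin n → ℕ) (g : Sketch n) (A : ℕ → ℕ → ℕ) : Prop where
  adj : ∀ u v : Fin n, A 0 (o + A 5 u + v) ≠ 0 ↔ G.Adj u v
  mark : ∀ u : Fin n, A 6 u ≠ 0 ↔ u ∈ C
  cls : ∀ u : Fin n, A 7 u = cls u
  lab : ∀ u : Fin n, A 10 u = g.lab u
  dep : ∀ u : Fin n, A 11 u = g.dep u
  kind : ∀ u : Fin n, A 12 u = g.kind u
  par : ∀ u : Fin n, A 13 u = g.par u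
  hub : ∀ u : Fin n, A 14 u = g.hub u
  typ : ∀ u : Fin n, A 15 u = g.typ u
  idx : ∀ u : Fin n, A 16 u = g.idx u

section

variable {o n : ℕ} {G : SimpleGraph (Fin n)} {C : Finset (Fin n)} {cls : Fin n → ℕ} {g : Sketch n}
  {A : ℕ → ℕ → ℕ} {ρ : ℕ → ℕ} {x y : ℕ} {u v h r : Fin n}

theorem val_at' {a : ℕ} : (at' a x).val A ρ = A a (ρ x) := rfl

theorem holds_mark (hA : Describes o G C cls g A) (hu : ρ x = u) :
    Holds A ρ (mark x) ↔ u ∈ C := by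
  rw [← hA.mark, ← hu]; rfl

theorem holds_adj (hA : Describes o G C cls g A) (hu : ρ x = u) (hv : ρ y = v) :
    Holds A ρ (Exp.adj o x y) ↔ G.Adj u v := by
  rw [← hA.adj, ← hu, ← hv]; rfl

theorem holds_hubChild (hA : Describes o G C cls g A) (hu : ρ x = u) (hv : ρ y = v) :
    Holds A ρ (hubChild x y) ↔ g.HubChild C u v := by
  simp only [hubChild, holds_and, holds_mark hA hu, holds_ne, holds_eq, val_at', val, hu, hv,
    hA.lab, hA.kind, hA.par, Sketch.HubChild]

theorem holds_used (hA : Describes o G C cls g A) (hn : ρ 1 = n) (hy : y ≠ 20) (hv : ρ y = v) :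
    Holds A ρ (used y) ↔ g.Used C v := by
  rw [used, holds_ex hn]
  exact exists_congr fun i => holds_hubChild hA (by simp) (by simp [hy, hv])

theorem holds_terminal (hA : Describes o G C cls g A) (hn : ρ 1 = n) (hx : x ≠ 30)
    (hu : ρ x = u) : Holds A ρ (terminal x) ↔ IsTerminal cls u := by
  rw [terminal, holds_ex hn]
  refine exists_congr fun i => ?_
  simp [holds_and, holds_ne, holds_eq, val_at', val, hx, hu, hA.cls, Fin.val_inj]

/-- The expressions `r` and `b` are evaluated inside the quantifiers over registers `25` and `29`;
the hypotheses exclude capture. -/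
theorem holds_classFits (hA : Describes o G C cls g A) (hn : ρ 1 = n) {r b : Exp} {r' b' : ℕ}
    (hr : ∀ i, r.val A (Function.update ρ 25 i) = r')
    (hb : ∀ i, b.val A (Function.update ρ 25 i) = b')
    (hb' : ∀ i j, b.val A (Function.update (Function.update ρ 25 i) 29 j) = b') :
    Holds A ρ (classFits o r b) ↔ g.ClassFits G C cls r' b' := by
  rw [classFits, holds_all hn]
  refine forall_congr' fun u => ?_
  have hn' : Function.update ρ 25 (u : ℕ) 1 = n := by simp [hn]
  rw [holds_imp, holds_eq, hr, holds_or, holds_and, holds_and, holds_not, holds_ex hn',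
    holds_mark (u := u) hA (by simp), holds_eq, hb]
  simp only [val_at', Function.update_self, hA.cls, hA.lab]
  refine imp_congr_right fun _ => or_congr_right (and_congr_right fun _ => exists_congr fun c => ?_)
  rw [holds_and, holds_and, holds_mark (u := c) hA (by simp),
    holds_adj (u := u) (v := c) hA (by simp) (by simp), holds_eq, hb']
  simp only [val_at', Function.update_self, hA.lab]

/-- The registers allowed for `x` and `y` are those in which the formula is used, and none of them
is bound inside it. -/
theorem holds_candidate (hA : Describes o G C cls g A) (hn : ρ 1 = n)
    (hx : x = 21 ∨ x = 22) (hy : y = 23 ∨ y = 28) (hh : ρ x = h) (hr : ρ y = r) :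
    Holds A ρ (candidate o x y) ↔ g.Candidate G C cls h r := by
  have x1 : x ≠ 26 := by omega
  have x2 : x ≠ 24 := by omega
  have x3 : x ≠ 20 := by omega
  have y1 : y ≠ 26 := by omega
  have y2 : y ≠ 24 := by omega
  have y3 : y ≠ 25 := by omega
  rw [candidate, holds_ex hn]
  refine exists_congr fun c => ?_
  have hn₁ : Function.update ρ 26 (c : ℕ) 1 = n := by simp [hn]
  rw [holds_and, holds_mark (u := c) hA (by simp), holds_and, holds_eq, holds_and,
    holds_classFits (r' := r) (b' := g.lab c) hA hn₁ (fun i => by simp [val, y1, y3, hr])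
      (fun i => by simp [val_at', hA.lab]) (fun i j => by simp [val_at', hA.lab]), holds_ex hn₁]
  simp only [val_at', val, Function.update_self, Function.update_of_ne x1, hh, hA.hub]
  refine and_congr_right fun _ => and_congr_right fun _ => and_congr_right fun _ =>
    exists_congr fun v => ?_
  have hn₂ : Function.update (Function.update ρ 26 (c : ℕ)) 24 (v : ℕ) 1 = n := by simp [hn]
  rw [holds_and, holds_not, holds_mark (u := v) hA (by simp), holds_and, holds_eq, holds_and,
    holds_iff, holds_terminal (u := v) hA hn₂ (by simp) (by simp), holds_eq, holds_and,
    holds_adj (u := v) (v := c) hA (by simp) (by simp), holds_all hn₂]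
  simp only [val_at', val, Function.update_self, Function.update_of_ne x1,
    Function.update_of_ne x2, Function.update_of_ne y1, Function.update_of_ne y2, hh, hr, hA.cls,
    hA.typ]
  refine and_congr_right fun _ => and_congr_right fun _ => and_congr_right fun _ =>
    and_congr_right fun _ => forall_congr' fun i => ?_
  rw [holds_imp, holds_hubChild (u := i) (v := h) hA (by simp) (by simp [x1, x2, x3, hh]),
    holds_adj (u := v) (v := i) hA (by simp) (by simp)]

theorem holds_chosen (hA : Describes o G C cls g A) (hn : ρ 1 = n)
    (hx : x = 21 ∨ x = 22) (hy : y = 23) (hh : ρ x = h) (hr : ρ y = r) :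
    Holds A ρ (chosen o x y) ↔ g.Chosen G C cls h r := by
  classical
  have x1 : x ≠ 28 := by omega
  have x2 : x ≠ 31 := by omega
  have y1 : y ≠ 28 := by omega
  rw [chosen, holds_and, holds_candidate hA hn hx (.inl hy) hh hr, holds_eq, val_count hn,
    val_count hn, Sketch.Chosen]
  refine and_congr_right fun _ => ?_
  have e1 : ∀ s : Fin n, Holds A (Function.update ρ 28 (s : ℕ))
      (and (lt (.var 28) (.var y)) (candidate o x 28)) ↔ s < r ∧ g.Candidate G C cls h s := by
    intro s
    rw [holds_and, holds_lt, holds_candidate (h := h) (r := s) hA (by simp [hn]) hx (.inr rfl)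
      (by simp [x1, hh]) (by simp)]
    simp [val, y1, hr]
  have e2 : ∀ s : Fin n, Holds A (Function.update ρ 31 (s : ℕ))
      (and (mark 31) (lt (.var 31) (at' 16 x))) ↔ s ∈ C ∧ (s : ℕ) < g.idx h := by
    intro s
    rw [holds_and, holds_mark (u := s) hA (by simp), holds_lt]
    simp [val, val_at', x2, hh, hA.idx]
  simp only [e1, e2]

theorem holds_parentsValid (hA : Describes o G C cls g A) (hn : ρ 1 = n) :
    Holds A ρ (parentsValid o) ↔ g.ParentsValid G C := by
  rw [parentsValid, holds_all hn]
  refine forall_congr' fun i => ?_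
  have hn₁ : Function.update ρ 20 (i : ℕ) 1 = n := by simp [hn]
  rw [holds_imp, holds_mark (u := i) hA (by simp), holds_or, holds_eq, holds_or, holds_and,
    holds_eq, holds_ex hn₁, holds_and, holds_ne, holds_ex hn₁]
  simp only [val_at', val, Function.update_self, hA.lab, hA.kind]
  refine imp_congr_right fun _ => or_congr_right (or_congr (and_congr_right fun _ =>
    exists_congr fun c => ?_) (and_congr_right fun _ => exists_congr fun h => ?_))
  · rw [holds_and, holds_mark (u := c) hA (by simp), holds_and, holds_eq, holds_and,
      holds_adj (u := i) (v := c) hA (by simp) (by simp), holds_and, holds_eq, holds_lt]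
    simp [val_at', val, hA.lab, hA.par, hA.dep]
  · have hn₂ : Function.update (Function.update ρ 20 (i : ℕ)) 21 (h : ℕ) 1 = n := by simp [hn]
    rw [holds_and, holds_mark (u := h) hA (by simp), holds_and, holds_eq, holds_ex hn₂]
    simp only [val_at', val, Function.update_self, ne_eq, Nat.reduceEqDiff, not_false_eq_true, Function.update_of_ne, hA.par]
    refine and_congr_right fun _ => and_congr_right fun _ => exists_congr fun c => ?_
    rw [holds_and, holds_mark (u := c) hA (by simp), holds_and, holds_eq, holds_and, holds_eq,
      holds_lt]
    simp [val_at', val, hA.lab, hA.hub, hA.dep]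

theorem holds_hubsConsistent (hA : Describes o G C cls g A) (hn : ρ 1 = n) :
    Holds A ρ (hubsConsistent o) ↔ g.HubsConsistent G C cls := by
  rw [hubsConsistent, holds_all hn]
  refine forall_congr' fun h => ?_
  rw [holds_all (n := n) (by simp [hn])]
  refine forall_congr' fun h' => ?_
  rw [holds_imp, holds_used (v := h) hA (by simp [hn]) (by simp) (by simp), holds_imp,
    holds_used (v := h') hA (by simp [hn]) (by simp) (by simp),
    holds_all (n := n) (by simp [hn])]
  refine imp_congr_right fun _ => imp_congr_right fun _ => forall_congr' fun r => ?_
  rw [holds_imp, holds_chosen (h := h) (r := r) hA (by simp [hn]) (by simp) rfl (by simp) (by simp),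
    holds_imp,
    holds_chosen (h := h') (r := r) hA (by simp [hn]) (by simp) rfl (by simp) (by simp),
    holds_all (n := n) (by simp [hn])]
  refine imp_congr_right fun _ => imp_congr_right fun _ => forall_congr' fun c => ?_
  rw [holds_all (n := n) (by simp [hn])]
  refine forall_congr' fun c' => ?_
  rw [holds_imp, holds_imp, holds_eq, holds_eq, holds_eq]
  simp [val_at', val, hA.hub, hA.lab]

theorem holds_valid (hA : Describes o G C cls g A) (hn : ρ 1 = n) :
    Holds A ρ (valid o) ↔ g.Valid G C cls := by
  have e1 : Holds A ρ (all 21 (imp (used 21) (ex 23 (chosen o 21 23)))) ↔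
      ∀ h, g.Used C h → ∃ r, g.Chosen G C cls h r := by
    rw [holds_all hn]
    refine forall_congr' fun h => ?_
    rw [holds_imp, holds_used (v := h) hA (by simp [hn]) (by simp) (by simp),
      holds_ex (n := n) (by simp [hn])]
    exact imp_congr_right fun _ => exists_congr fun r =>
      holds_chosen hA (by simp [hn]) (by simp) rfl (by simp) (by simp)
  have e2 : Holds A ρ (all 22 (imp (terminal 22) (ex 27 (classFits o (at' 7 22) (.var 27))))) ↔
      ∀ v, IsTerminal cls v → ∃ b : Fin n, g.ClassFits G C cls (cls v) b := by
    rw [holds_all hn]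
    refine forall_congr' fun v => ?_
    rw [holds_imp, holds_terminal (u := v) hA (by simp [hn]) (by simp) (by simp),
      holds_ex (n := n) (by simp [hn])]
    exact imp_congr_right fun _ => exists_congr fun b =>
      holds_classFits hA (by simp [hn]) (fun i => by simp [val_at', hA.cls])
        (fun i => by simp [val]) (fun i j => by simp [val])
  rw [valid, holds_and, holds_and, holds_and, holds_parentsValid hA hn, holds_hubsConsistent hA hn,
    e1, e2]
  exact ⟨fun h => ⟨h.1, h.2.1, h.2.2.1, h.2.2.2⟩, fun h => ⟨h.1, h.2, h.3, h.4⟩⟩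

theorem val_cost (hA : Describes o G C cls g A) (hn : ρ 1 = n) :
    cost.val A ρ = g.cost C cls := by
  classical
  rw [cost, val, val, val_count hn, val_count hn, val_count hn, Sketch.cost]
  have e1 : ∀ i : Fin n, Holds A (Function.update ρ 20 (i : ℕ))
      (and (mark 20) (ne (at' 10 20) (.var 20))) ↔ i ∈ C ∧ g.lab i ≠ i := fun i => by
    rw [holds_and, holds_mark (u := i) hA (by simp), holds_ne]
    simp [val_at', val, hA.lab]
  have e2 : ∀ i : Fin n, Holds A (Function.update ρ 24 (i : ℕ))
      (and (mark 24).not (terminal 24)) ↔ i ∉ C ∧ IsTerminal cls i := fun i => by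
    rw [holds_and, holds_not, holds_mark (u := i) hA (by simp),
      holds_terminal (u := i) hA (by simp [hn]) (by simp) (by simp)]
  have e3 : ∀ i : Fin n, Holds A (Function.update ρ 21 (i : ℕ))
      (and (used 21) (ne (at' 15 21) (.var 21))) ↔ g.Used C i ∧ g.typ i ≠ i := fun i => by
    rw [holds_and, holds_used (v := i) hA (by simp [hn]) (by simp) (by simp), holds_ne]
    simp [val_at', val, hA.typ]
  simp only [e1, e2, e3]

end

end RAM.Exp

/-! ### Ranks and digits -/

/-- The rank of a vertex in `C`. -/
def Finset.rank {n : ℕ} (C : Finset (Fin n)) (c : Fin n) : ℕ :=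
  (Finset.univ.filter fun u => u ∈ C ∧ u < c).card

theorem Finset.rank_strictMonoOn {n : ℕ} (C : Finset (Fin n)) {c d : Fin n} (hc : c ∈ C)
    (h : c < d) : C.rank c < C.rank d := by
  refine Finset.card_lt_card ⟨fun u hu => ?_, fun hh => ?_⟩
  · simp only [Finset.mem_filter, Finset.mem_univ, true_and] at hu ⊢
    exact ⟨hu.1, hu.2.trans h⟩
  · have := hh (Finset.mem_filter.2 ⟨Finset.mem_univ _, hc, h⟩)
    simp at this

theorem Finset.rank_inj {n : ℕ} {C : Finset (Fin n)} {c d : Fin n} (hc : c ∈ C) (hd : d ∈ C)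
    (h : C.rank c = C.rank d) : c = d := by
  rcases lt_trichotomy c d with hlt | rfl | hlt
  · exact absurd h (C.rank_strictMonoOn hc hlt).ne
  · rfl
  · exact absurd h (C.rank_strictMonoOn hd hlt).ne'

theorem Finset.rank_lt_card {n : ℕ} {C : Finset (Fin n)} {c : Fin n} (hc : c ∈ C) :
    C.rank c < C.card := by
  refine Finset.card_lt_card ⟨fun u hu => ?_, fun hh => ?_⟩
  · exact (Finset.mem_filter.1 hu).2.1
  · have := hh hc
    simp at this

/-- The step of loops over all vertices in which only the members of `C` contribute a digit or a
factor. -/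
theorem Finset.rank_succ {n : ℕ} (C : Finset (Fin n)) (i : Fin n) :
    (Finset.univ.filter fun u : Fin n => u ∈ C ∧ (u : ℕ) < i + 1).card =
      C.rank i + if i ∈ C then 1 else 0 := by
  classical
  have : (Finset.univ.filter fun u : Fin n => u ∈ C ∧ (u : ℕ) < i + 1) =
      (Finset.univ.filter fun u : Fin n => u ∈ C ∧ u < i) ∪ if i ∈ C then {i} else ∅ := by
    ext u
    have : (u : ℕ) < i + 1 ↔ u < i ∨ u = i := by
      rw [Fin.lt_def, Fin.ext_iff]; omega
    split_ifs with h <;> simp only [Finset.mem_filter, Finset.mem_univ, true_and, this,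
      Finset.mem_union, Finset.mem_singleton, Finset.notMem_empty, or_false]
    · constructor
      · rintro ⟨h1, h2 | h2⟩
        exacts [.inl ⟨h1, h2⟩, .inr h2]
      · rintro (⟨h1, h2⟩ | rfl)
        exacts [⟨h1, .inl h2⟩, ⟨h, .inr rfl⟩]
    · constructor
      · rintro ⟨h1, h2 | rfl⟩
        exacts [⟨h1, h2⟩, absurd h1 h]
      · exact fun h => ⟨h.1, .inl h.2⟩
  rw [this, Finset.card_union_of_disjoint, Finset.rank]
  · split_ifs <;> simp
  · rw [Finset.disjoint_left]
    intro u hu hu'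
    split_ifs at hu' with h
    · simp only [Finset.mem_singleton] at hu'
      simp [hu'] at hu
    · simp at hu'

/-- The member of `C` of rank `r`. -/
def Finset.ofRank {n : ℕ} (C : Finset (Fin n)) (r : ℕ) : ℕ :=
  ∑ v : Fin n, if v ∈ C ∧ C.rank v = r then (v : ℕ) else 0

theorem Finset.ofRank_rank {n : ℕ} {C : Finset (Fin n)} {c : Fin n} (hc : c ∈ C) :
    C.ofRank (C.rank c) = c := by
  rw [Finset.ofRank, Finset.sum_eq_single c]
  · simp [hc]
  · intro b _ hb
    rw [if_neg]
    rintro ⟨h1, h2⟩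
    exact hb (Finset.rank_inj h1 hc h2)
  · simp

/-- The function from `C` to `C` given by the `#C` lowest digits of `N` to base `#C`. -/
def digitMap {n : ℕ} (C : Finset (Fin n)) (N : ℕ) (i : Fin n) : ℕ :=
  if i ∈ C then C.ofRank (N / C.card ^ C.rank i % C.card) else 0

/-- The higher part `R` is arbitrary since the digits of further functions follow there. -/
theorem exists_number_of_digits (m : ℕ) (w : ℕ → ℕ) (L : ℕ) (hw : ∀ p < L, w p < m) :
    ∃ W < m ^ L, ∀ R, ∀ p < L, (W + m ^ L * R) / m ^ p % m = w p := by
  induction L with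
  | zero => exact ⟨0, by simp, fun _ p hp => absurd hp (by omega)⟩
  | succ L ih =>
    obtain ⟨W, hW, h⟩ := ih fun p hp => hw p (by omega)
    have hL := hw L (by omega)
    have hpos : 0 < m ^ L := by omega
    refine ⟨W + m ^ L * w L, ?_, fun R p hp => ?_⟩
    · calc W + m ^ L * w L < m ^ L + m ^ L * w L := by omega
        _ = m ^ L * (w L + 1) := by ring
        _ ≤ m ^ L * m := Nat.mul_le_mul_left _ hL
        _ = _ := (pow_succ _ _).symm
    · have e : W + m ^ L * w L + m ^ (L + 1) * R = W + m ^ L * (w L + m * R) := by ring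
      rw [e]
      rcases Nat.lt_succ_iff_lt_or_eq.1 hp with hp | rfl
      · exact h _ p hp
      · rw [Nat.add_mul_div_left _ _ hpos, Nat.div_eq_of_lt hW, zero_add, Nat.add_mul_mod_self_left,
          Nat.mod_eq_of_lt hL]

theorem Sketch.IsMapOn.exists_digitMap {n : ℕ} {C : Finset (Fin n)} {f : Fin n → ℕ}
    (hf : IsMapOn C f) :
    ∃ W < C.card ^ C.card, ∀ R, digitMap C (W + C.card ^ C.card * R) = f := by
  classical
  have h1 : ∀ p, ∃ w, (p < C.card → w < C.card) ∧
      ∀ i ∈ C, C.rank i = p → C.ofRank w = f i := by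
    intro p
    by_cases h : ∃ i ∈ C, C.rank i = p
    · obtain ⟨i, hi, hp⟩ := h
      obtain ⟨c, hc, hfc⟩ := hf.1 i hi
      refine ⟨C.rank c, fun _ => Finset.rank_lt_card hc, fun j hj hjp => ?_⟩
      rw [Finset.ofRank_rank hc, Finset.rank_inj hj hi (hjp.trans hp.symm), hfc]
    · exact ⟨0, fun h => by omega, fun i hi hp => absurd ⟨i, hi, hp⟩ h⟩
  choose w hw hwf using h1
  obtain ⟨W, hW, h⟩ := exists_number_of_digits C.card w C.card hw
  refine ⟨W, hW, fun R => funext fun i => ?_⟩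
  by_cases hi : i ∈ C
  · rw [digitMap, if_pos hi, h R _ (Finset.rank_lt_card hi), hwf _ i hi rfl]
  · rw [digitMap, if_neg hi, hf.2 i hi]

/-- The sketch given by a number. -/
def Sketch.ofNumber {n : ℕ} (C : Finset (Fin n)) (N : ℕ) : Sketch n :=
  let K := C.card ^ C.card
  ⟨digitMap C N, digitMap C (N / K), digitMap C (N / K / K), digitMap C (N / K / K / K),
    digitMap C (N / K / K / K / K), digitMap C (N / K / K / K / K / K),
    digitMap C (N / K / K / K / K / K / K)⟩

theorem Sketch.Normal.exists_ofNumber {n : ℕ} {C : Finset (Fin n)} {g : Sketch n}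
    (hg : g.Normal C) : ∃ N < (C.card ^ C.card) ^ 7, Sketch.ofNumber C N = g := by
  obtain ⟨W₁, h₁, e₁⟩ := hg.lab.exists_digitMap
  obtain ⟨W₂, h₂, e₂⟩ := hg.dep.exists_digitMap
  obtain ⟨W₃, h₃, e₃⟩ := hg.kind.exists_digitMap
  obtain ⟨W₄, h₄, e₄⟩ := hg.par.exists_digitMap
  obtain ⟨W₅, h₅, e₅⟩ := hg.hub.exists_digitMap
  obtain ⟨W₆, h₆, e₆⟩ := hg.typ.exists_digitMap
  obtain ⟨W₇, h₇, e₇⟩ := hg.idx.exists_digitMap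
  set K := C.card ^ C.card with hK
  have hdiv : ∀ W R, W < K → (W + K * R) / K = R := fun W R h => by
    rw [Nat.add_mul_div_left _ _ (by omega), Nat.div_eq_of_lt h, zero_add]
  have hlt : ∀ W R j, W < K → R < K ^ j → W + K * R < K ^ (j + 1) := fun W R j h h' => by
    calc W + K * R < K + K * R := by omega
      _ = K * (R + 1) := by ring
      _ ≤ K * K ^ j := Nat.mul_le_mul_left _ h'
      _ = _ := (pow_succ' _ _).symm
  refine ⟨W₁ + K * (W₂ + K * (W₃ + K * (W₄ + K * (W₅ + K * (W₆ + K * (W₇ + K * 0)))))),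
    hlt _ _ _ h₁ <| hlt _ _ _ h₂ <| hlt _ _ _ h₃ <| hlt _ _ _ h₄ <| hlt _ _ _ h₅ <|
    hlt _ _ _ h₆ <| hlt _ _ _ h₇ <| by simp, ?_⟩
  simp only [Sketch.ofNumber, ← hK]
  rw [hdiv _ _ h₁, hdiv _ _ h₂, hdiv _ _ h₃, hdiv _ _ h₄, hdiv _ _ h₅, hdiv _ _ h₆, e₁, e₂, e₃,
    e₄, e₅, e₆, e₇]

/-! ### Minima -/

/-- `b - 1` is the least number with property `P`, and `b = 0` if there is none. -/
def IsMinCode (P : ℕ → Prop) (b : ℕ) : Prop :=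
  (b = 0 ∧ ∀ c, ¬ P c) ∨ ∃ c, b = c + 1 ∧ P c ∧ ∀ c', P c' → c ≤ c'

/-- Two sets of numbers have the same minimum if each member of one is bounded below by a member of
the other, and conversely. The sets need not be equal: the cost of a sketch is only an upper bound
on the edges of its forest. -/
theorem IsMinCode.congr {P Q : ℕ → Prop} {b : ℕ} (h : IsMinCode P b)
    (hPQ : ∀ c, P c → ∃ c' ≤ c, Q c') (hQP : ∀ c, Q c → ∃ c' ≤ c, P c') : IsMinCode Q b := by
  rcases h with ⟨rfl, h⟩ | ⟨c, rfl, hc, hmin⟩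
  · refine .inl ⟨rfl, fun c hc => ?_⟩
    obtain ⟨c', -, hc'⟩ := hQP c hc
    exact h c' hc'
  · obtain ⟨c', hle, hc'⟩ := hPQ c hc
    have hmin' : ∀ c'', Q c'' → c ≤ c'' := fun c'' h'' => by
      obtain ⟨d, hd, hPd⟩ := hQP c'' h''
      exact (hmin d hPd).trans hd
    have : c' = c := le_antisymm hle (hmin' c' hc')
    exact .inr ⟨c, rfl, this ▸ hc', hmin'⟩

theorem IsMinCode.unique {P : ℕ → Prop} {a b : ℕ} (h : IsMinCode P a) (h' : IsMinCode P b) :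
    a = b := by
  rcases h with ⟨rfl, h⟩ | ⟨c, rfl, hc, hmin⟩ <;> rcases h' with ⟨rfl, h'⟩ | ⟨c', rfl, hc', hmin'⟩
  · rfl
  · exact absurd hc' (h c')
  · exact absurd hc (h' c)
  · exact congrArg (· + 1) (le_antisymm (hmin _ hc') (hmin' _ hc))

theorem IsMinCode.insert {P Q : ℕ → Prop} {b c : ℕ} (h : IsMinCode P b)
    (hQ : ∀ d, Q d ↔ P d ∨ d = c) :
    IsMinCode Q (if b = 0 ∨ c + 1 < b then c + 1 else b) := by
  rcases h with ⟨rfl, h⟩ | ⟨d, rfl, hd, hmin⟩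
  · refine .inr ⟨c, by simp, (hQ c).2 (.inr rfl), fun c' hc' => ?_⟩
    rcases (hQ c').1 hc' with h' | h'
    · exact absurd h' (h c')
    · exact h'.ge
  · refine .inr ?_
    by_cases hcd : c + 1 < d + 1
    · refine ⟨c, by simp [hcd], (hQ c).2 (.inr rfl), fun c' hc' => ?_⟩
      rcases (hQ c').1 hc' with h' | h'
      · have := hmin c' h'; omega
      · exact h'.ge
    · refine ⟨d, by simp [hcd], (hQ d).2 (.inl hd), fun c' hc' => ?_⟩
      rcases (hQ c').1 hc' with h' | h'
      · exact hmin c' h'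
      · omega

/-- `b - 1` is the least number of edges of a Steiner forest, and `b = 0` if there is none. -/
def IsOptCode {V : Type} (G : SimpleGraph V) (S : Set (V × V)) (b : ℕ) : Prop :=
  IsMinCode (fun c => ∃ H ≤ G, ConnectsPairs S H ∧ H.edgeSet.ncard = c) b

theorem reachable_of_eqvGen {V : Type} {H : SimpleGraph V} {S : Set (V × V)}
    (hH : ConnectsPairs S H) {u v : V} (h : Relation.EqvGen (fun a b => (a, b) ∈ S) u v) :
    H.Reachable u v := by
  induction h with
  | rel a b h => exact hH _ h
  | refl => exact .refl _
  | symm _ _ _ ih => exact ih.symm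
  | trans _ _ _ _ _ ih ih' => exact ih.trans ih'

theorem isOptCode_of_sketches {n : ℕ} {G : SimpleGraph (Fin n)} {S : Set (Fin n × Fin n)}
    {C : Finset (Fin n)} {cls : Fin n → ℕ} {b : ℕ} (hC : ∀ u v, G.Adj u v → u ∈ C ∨ v ∈ C)
    (hpair : ∀ c ∈ C, ∃ c' ∈ C, c' ≠ c) (hlt : ∀ v, cls v < n)
    (hcls : ∀ u v, cls u = cls v ↔ Relation.EqvGen (fun a b => (a, b) ∈ S) u v)
    (h : IsMinCode (fun c => ∃ N < (C.card ^ C.card) ^ 7, (Sketch.ofNumber C N).Valid G C cls ∧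
      (Sketch.ofNumber C N).cost C cls = c) b) : IsOptCode G S b := by
  refine h.congr ?_ ?_
  · rintro c ⟨N, -, hv, rfl⟩
    obtain ⟨H, hH, hS, hle⟩ := hv.exists_connectsPairs
      (fun p hp => (hcls _ _).2 (.rel _ _ hp)) hlt
    exact ⟨_, hle, H, hH, hS, rfl⟩
  · rintro c ⟨H, hH, hS, rfl⟩
    obtain ⟨g, hg, hv, hle⟩ := Sketch.exists_valid hH hC hpair hlt
      (fun u v h => reachable_of_eqvGen hS ((hcls u v).1 h))
    obtain ⟨N, hN, rfl⟩ := hg.exists_ofNumber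
    exact ⟨_, hle, N, hN, hv, rfl⟩

namespace RAM

open Exp

/-! ### Computing the optimum by trying all sketches -/

namespace Cmd

/-- Register `18` is a dummy that no expression of the algorithm reads. -/
def nop : Cmd := .set 18 (.lit 0)

theorem run_cond_pos {e : Exp} {c c' : Cmd} {s : State} (h : Holds s.arr s.reg e) :
    (Cmd.cond e c c').run s = c.run s := if_pos h

theorem run_cond_neg {e : Exp} {c c' : Cmd} {s : State} (h : ¬ Holds s.arr s.reg e) :
    (Cmd.cond e c c').run s = c'.run s := if_neg h

/-- The product of `e` and the number of marked vertices. -/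
def mulCard (e : Exp) : Exp := .sum 21 1 (.cond (mark 21) e (.lit 0))

/-- Store the function given by the lowest digits of register `12` in array `a`, and delete these
digits. -/
def decode (a : ℕ) : Cmd :=
  .iter 13 1 <| .cond (mark 13)
    (.seq (.set 8 (.sum 20 2 (Exp.lt (.var 12) (mulCard (.add (.var 20) (.lit 1)))).not)) <|
      .seq (.set 9 (.sub (.var 12) (mulCard (.var 8)))) <|
      .seq (.put a (.var 13) (.sum 20 1 (.cond
        (and (mark 20) (eq (count 22 (and (mark 22) (Exp.lt (.var 22) (.var 20)))) (.var 9)))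
        (.var 20) (.lit 0)))) <|
      .set 12 (.var 8))
    (.put a (.var 13) (.lit 0))

/-- Improve the value in register `14` by means of the sketch with the number in register `11`. -/
def tryNumber (o : ℕ) : Cmd :=
  .seq (.set 12 (.var 11)) <| .seq (decode 10) <| .seq (decode 11) <| .seq (decode 12) <|
    .seq (decode 13) <| .seq (decode 14) <| .seq (decode 15) <| .seq (decode 16) <|
    .cond (valid o)
      (.seq (.set 16 Exp.cost) <|
        .cond (or (eq (.var 14) (.lit 0)) (Exp.lt (.add (.var 16) (.lit 1)) (.var 14)))
          (.set 14 (.add (.var 16) (.lit 1))) nop)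
      nop

/-- Store the least cost of a valid sketch plus one in register `14`. -/
def opt (o : ℕ) : Cmd :=
  .seq (.set 14 (.lit 0)) (.iter 11 2 (tryNumber o))

end Cmd

/-- Array `6` marks the members of `C`. -/
def Marks {n : ℕ} (C : Finset (Fin n)) (A : ℕ → ℕ → ℕ) : Prop :=
  ∀ u : Fin n, A 6 u ≠ 0 ↔ u ∈ C

theorem Marks.holds {n : ℕ} {C : Finset (Fin n)} {A : ℕ → ℕ → ℕ} (hA : Marks C A) {ρ : ℕ → ℕ}
    {x : ℕ} {u : Fin n} (hu : ρ x = u) : Holds A ρ (mark x) ↔ u ∈ C := by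
  rw [← hA, ← hu]; rfl

theorem Marks.val_mulCard {n : ℕ} {C : Finset (Fin n)} {A : ℕ → ℕ → ℕ} (hA : Marks C A)
    {ρ : ℕ → ℕ} (hn : ρ 1 = n) {e : Exp} {k : ℕ}
    (he : ∀ i : Fin n, e.val A (Function.update ρ 21 i) = k) :
    (Cmd.mulCard e).val A ρ = C.card * k := by
  rw [Cmd.mulCard, val_sum hn]
  have : ∀ i : Fin n, (Exp.cond (mark 21) e (.lit 0)).val A (Function.update ρ 21 i) =
      if i ∈ C then k else 0 := by
    intro i
    simp only [val, he]
    exact if_congr (hA.holds (by simp)) rfl rfl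
  simp only [this, Finset.sum_ite_mem, Finset.univ_inter, Finset.sum_const, smul_eq_mul]

/-- Division by counting: the quotient is the number of positive multiples of `m` up to `G`. -/
theorem card_filter_mul_le {M G m : ℕ} (hG : G ≤ M) (hm : 0 < m) :
    (∑ x ∈ Finset.range M, if G < m * (x + 1) then 0 else 1) = G / m := by
  have : ∀ x, (if G < m * (x + 1) then 0 else 1) = if x < G / m then 1 else 0 := by
    intro x
    have : m * (x + 1) ≤ G ↔ x < G / m := by
      rw [Nat.lt_iff_add_one_le, Nat.le_div_iff_mul_le hm, mul_comm]
    by_cases h : x < G / m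
    · rw [if_pos h, if_neg (not_lt.2 (this.2 h))]
    · rw [if_neg h, if_pos (not_le.1 fun h' => h (this.1 h'))]
  simp only [this, ← Finset.card_filter]
  have : (Finset.range M).filter (fun x => x < G / m) = Finset.range (G / m) := by
    ext x
    simp only [Finset.mem_filter, Finset.mem_range]
    have := Nat.div_le_self G m
    omega
  rw [this, Finset.card_range]

/-- Each member of `C` strips one digit from register `12`. The members are visited in increasing
order, so the digit met at `i` is the one at position `C.rank i`. -/
theorem Cmd.run_decode {n : ℕ} {C : Finset (Fin n)} {a M N : ℕ} {s : State} (ha : a ≠ 6)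
    (hs : Marks C s.arr) (hn : s.reg 1 = n) (hM : s.reg 2 = M) (hN : s.reg 12 = N) (hNM : N ≤ M) :
    ((decode a).run s).reg 12 = N / C.card ^ C.card ∧
      ∀ i : Fin n, ((decode a).run s).arr a i = digitMap C N i := by
  have key := iter_inv (x := 13) (r := 1) (s := s) (c := .cond (mark 13)
    (.seq (.set 8 (.sum 20 2 (Exp.lt (.var 12) (mulCard (.add (.var 20) (.lit 1)))).not)) <|
      .seq (.set 9 (.sub (.var 12) (mulCard (.var 8)))) <|
      .seq (.put a (.var 13) (.sum 20 1 (.cond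
        (and (mark 20) (eq (count 22 (and (mark 22) (Exp.lt (.var 22) (.var 20)))) (.var 9)))
        (.var 20) (.lit 0)))) <|
      .set 12 (.var 8))
    (.put a (.var 13) (.lit 0)))
    (fun k st => st.reg 1 = n ∧ st.reg 2 = M ∧ st.arr 6 = s.arr 6 ∧
      st.reg 12 = N / C.card ^ (Finset.univ.filter fun u : Fin n => u ∈ C ∧ (u : ℕ) < k).card ∧
      ∀ i : Fin n, (i : ℕ) < k → st.arr a i = digitMap C N i)
    ⟨hn, hM, rfl, by simp [hN], fun i hi => absurd hi (by omega)⟩ (by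
      rintro i hi st ⟨h1, h2, h3, h4, h5⟩
      obtain ⟨i, rfl⟩ : ∃ j : Fin n, (j : ℕ) = i := ⟨⟨i, hn ▸ hi⟩, rfl⟩
      have hmk : Marks C (st.setReg 13 i).arr := fun u => by
        rw [State.setReg_arr, h3]; exact hs u
      have hr : C.rank i = (Finset.univ.filter fun u : Fin n => u ∈ C ∧ (u : ℕ) < i).card := rfl
      rw [← hr] at h4
      rw [Finset.rank_succ]
      by_cases hi : i ∈ C
      · rw [run_cond_pos ((hmk.holds (u := i) (by simp)).2 hi)]
        have hm : 0 < C.card := Finset.card_pos.2 ⟨i, hi⟩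
        set Q := N / C.card ^ C.rank i with hQ
        have hQM : Q ≤ M := (Nat.div_le_self _ _).trans hNM
        -- The count of multiples runs up to register `2`, the number of sketches, which is large
        -- enough because `N ≤ M`.
        have e1 : (Exp.sum 20 2 (Exp.lt (.var 12) (mulCard (.add (.var 20) (.lit 1)))).not).val
            (st.setReg 13 i).arr (st.setReg 13 i).reg = Q / C.card := by
          rw [← card_filter_mul_le hQM hm]
          simp only [val]
          rw [show (st.setReg 13 (i : ℕ)).reg 2 = M by simpa using h2]
          refine Finset.sum_congr rfl fun x _ => ?_
          have e2 : (mulCard (.add (.var 20) (.lit 1))).val (st.setReg 13 i).arr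
              (Function.update (st.setReg 13 (i : ℕ)).reg 20 x) = C.card * (x + 1) :=
            hmk.val_mulCard (by simp [h1]) fun j => by simp [val]
          have e3 : Holds (st.setReg 13 i).arr (Function.update (st.setReg 13 (i : ℕ)).reg 20 x)
              (Exp.lt (.var 12) (mulCard (.add (.var 20) (.lit 1)))) ↔ Q < C.card * (x + 1) := by
            rw [holds_lt, e2]; simp [val, h4]
          rw [Exp.not, val]
          exact if_congr e3 rfl rfl
        set st₁ := (st.setReg 13 i).setReg 8 (Q / C.card) with hst₁
        have e2 : (Exp.sub (.var 12) (mulCard (.var 8))).val st₁.arr st₁.reg = Q % C.card := by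
          have : (mulCard (.var 8)).val st₁.arr st₁.reg = C.card * (Q / C.card) :=
            hmk.val_mulCard (by simp [hst₁, h1]) fun j => by simp [val, hst₁]
          rw [val, this, Nat.mod_def]
          simp [val, hst₁, h4]
        set st₂ := st₁.setReg 9 (Q % C.card) with hst₂
        have hmk₂ : Marks C st₂.arr := hmk
        have e3 : (Exp.sum 20 1 (.cond
            (and (mark 20) (eq (count 22 (and (mark 22) (Exp.lt (.var 22) (.var 20)))) (.var 9)))
            (.var 20) (.lit 0))).val st₂.arr st₂.reg = digitMap C N i := by
          classical
          rw [digitMap, if_pos hi, Finset.ofRank, val_sum (n := n) (by simp [hst₂, hst₁, h1])]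
          refine Finset.sum_congr rfl fun v _ => ?_
          have e4 : Holds st₂.arr (Function.update st₂.reg 20 (v : ℕ))
            (and (mark 20) (eq (count 22 (and (mark 22) (Exp.lt (.var 22) (.var 20)))) (.var 9))) ↔
              v ∈ C ∧ C.rank v = Q % C.card := by
            rw [holds_and, hmk₂.holds (u := v) (by simp), holds_eq,
              val_count (n := n) (by simp [hst₂, hst₁, h1])]
            refine and_congr_right fun _ => ?_
            have e5 : ∀ w : Fin n, Holds st₂.arr (Function.update (Function.update st₂.reg 20
                (v : ℕ)) 22 (w : ℕ)) (and (mark 22) (Exp.lt (.var 22) (.var 20))) ↔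
                w ∈ C ∧ w < v := by
              intro w
              rw [holds_and, hmk₂.holds (u := w) (by simp), holds_lt]
              simp [val]
            simp only [e5]
            simp [val, hst₂, Finset.rank]
          rw [val]
          exact if_congr e4 (by simp [val]) rfl
        simp only [run, e1, ← hst₁, e2, ← hst₂, e3]
        refine ⟨by simp [hst₂, hst₁, h1], by simp [hst₂, hst₁, h2], ?_, ?_, fun j hj => ?_⟩
        · simp [State.setArr_arr, hst₂, hst₁, ha.symm, h3]
        · simp [val, hst₂, hst₁, hi, pow_succ, ← Nat.div_div_eq_div_mul, hQ]
        · simp only [State.setReg_arr, State.setArr_arr, Function.update_self]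
          by_cases hji : j = i
          · subst hji; simp [val, hst₂, hst₁]
          · have : (j : ℕ) ≠ i := fun h => hji (Fin.ext h)
            have : (Exp.var 13).val st₂.arr st₂.reg ≠ j := by
              simpa [val, hst₂, hst₁] using this.symm
            rw [Function.update_of_ne this.symm]
            exact h5 j (by omega)
      · rw [run_cond_neg (fun h => hi ((hmk.holds (u := i) (by simp)).1 h))]
        refine ⟨by simp [run, h1], by simp [run, h2], by simp [run, State.setArr_arr, ha.symm, h3],
          by simp [run, hi, h4], fun j hj => ?_⟩
        simp only [run, State.setReg_arr, State.setArr_arr, Function.update_self]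
        by_cases hji : j = i
        · subst hji; simp [val, digitMap, hi]
        · have : (j : ℕ) ≠ i := fun h => hji (Fin.ext h)
          rw [Function.update_of_ne (by simpa [val] using this)]
          exact h5 j (by omega))
  rw [hn] at key
  obtain ⟨-, -, -, h4, h5⟩ := key
  refine ⟨?_, fun i => h5 i i.2⟩
  rw [decode, h4]
  congr 2
  congr 1
  ext u
  simp

end RAM

namespace RAM

open Exp

theorem Cmd.run_decode_frame {n : ℕ} {C : Finset (Fin n)} {M N : ℕ} {s : State} (a : ℕ)
    (ha : a ≠ 6) (hs : Marks C s.arr ∧ s.reg 1 = n ∧ s.reg 2 = M ∧ s.reg 12 = N ∧ N ≤ M) :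
    (Marks C ((decode a).run s).arr ∧ ((decode a).run s).reg 1 = n ∧ ((decode a).run s).reg 2 = M ∧
      ((decode a).run s).reg 12 = N / C.card ^ C.card ∧ N / C.card ^ C.card ≤ M) ∧
      (∀ i : Fin n, ((decode a).run s).arr a i = digitMap C N i) ∧
      ∀ b, b ≠ a → ((decode a).run s).arr b = s.arr b := by
  obtain ⟨h1, h2, h3, h4, h5⟩ := hs
  have hb : ∀ b, b ≠ a → ((decode a).run s).arr b = s.arr b := fun b hb =>
    run_arr _ (by simp [decode, puts, hb]) s
  obtain ⟨e1, e2⟩ := run_decode ha h1 h2 h3 h4 h5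
  refine ⟨⟨fun u => ?_, ?_, ?_, e1, (Nat.div_le_self _ _).trans h5⟩, e2, hb⟩
  · rw [hb 6 ha.symm]; exact h1 u
  · rw [run_reg _ (by simp [decode, writes]), h2]
  · rw [run_reg _ (by simp [decode, writes]), h3]

/-- Every `decode` divides the number by `#C ^ #C`, so the seven calls fill the arrays `10` to `16`
with the components of `Sketch.ofNumber`. After that the formulas for validity and cost apply. -/
theorem Cmd.run_tryNumber {o n M N b : ℕ} {G : SimpleGraph (Fin n)} {C : Finset (Fin n)}
    {cls : Fin n → ℕ} {s : State} {P : ℕ → Prop} (hn : s.reg 1 = n) (hM : s.reg 2 = M)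
    (hN : s.reg 11 = N) (hNM : N ≤ M) (hs : Marks C s.arr)
    (hadj : ∀ u v : Fin n, s.arr 0 (o + s.arr 5 u + v) ≠ 0 ↔ G.Adj u v)
    (hcls : ∀ u : Fin n, s.arr 7 u = cls u) (hb : s.reg 14 = b) (hP : IsMinCode P b) :
    IsMinCode (fun c => P c ∨ ((Sketch.ofNumber C N).Valid G C cls ∧
      (Sketch.ofNumber C N).cost C cls = c)) (((tryNumber o).run s).reg 14) := by
  set s₀ := (Cmd.set 12 (.var 11)).run s with hs₀
  obtain ⟨d₁, v₁, f₁⟩ := run_decode_frame (s := s₀) (M := M) (N := N) (C := C) 10 (by simp)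
    ⟨hs, by simp [hs₀, run, hn], by simp [hs₀, run, hM], by simp [hs₀, run, val, hN], hNM⟩
  set s₁ := (decode 10).run s₀
  obtain ⟨d₂, v₂, f₂⟩ := run_decode_frame 11 (by simp) d₁
  set s₂ := (decode 11).run s₁
  obtain ⟨d₃, v₃, f₃⟩ := run_decode_frame 12 (by simp) d₂
  set s₃ := (decode 12).run s₂
  obtain ⟨d₄, v₄, f₄⟩ := run_decode_frame 13 (by simp) d₃
  set s₄ := (decode 13).run s₃
  obtain ⟨d₅, v₅, f₅⟩ := run_decode_frame 14 (by simp) d₄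
  set s₅ := (decode 14).run s₄
  obtain ⟨d₆, v₆, f₆⟩ := run_decode_frame 15 (by simp) d₅
  set s₆ := (decode 15).run s₅
  obtain ⟨d₇, v₇, f₇⟩ := run_decode_frame 16 (by simp) d₆
  set s₇ := (decode 16).run s₆
  have hfr : ∀ a < 10, s₇.arr a = s.arr a := by
    intro a ha
    rw [f₇ a (by omega), f₆ a (by omega), f₅ a (by omega), f₄ a (by omega), f₃ a (by omega),
      f₂ a (by omega), f₁ a (by omega)]
    rfl
  have hD : Describes o G C cls (Sketch.ofNumber C N) s₇.arr := by
    refine ⟨fun u v => ?_, d₇.1, fun u => ?_, fun u => ?_, fun u => ?_, fun u => ?_, fun u => ?_,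
      fun u => ?_, fun u => ?_, fun u => v₇ u⟩
    · rw [hfr 0 (by simp), hfr 5 (by simp)]; exact hadj u v
    · rw [hfr 7 (by simp)]; exact hcls u
    · rw [f₇ _ (by simp), f₆ _ (by simp), f₅ _ (by simp), f₄ _ (by simp), f₃ _ (by simp),
        f₂ _ (by simp)]; exact v₁ u
    · rw [f₇ _ (by simp), f₆ _ (by simp), f₅ _ (by simp), f₄ _ (by simp), f₃ _ (by simp)]
      exact v₂ u
    · rw [f₇ _ (by simp), f₆ _ (by simp), f₅ _ (by simp), f₄ _ (by simp)]; exact v₃ u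
    · rw [f₇ _ (by simp), f₆ _ (by simp), f₅ _ (by simp)]; exact v₄ u
    · rw [f₇ _ (by simp), f₆ _ (by simp)]; exact v₅ u
    · rw [f₇ _ (by simp)]; exact v₆ u
  have hn₇ : s₇.reg 1 = n := d₇.2.1
  have hb₇ : s₇.reg 14 = b := by
    have : ∀ a (t : State), ((decode a).run t).reg 14 = t.reg 14 := fun a t =>
      run_reg _ (by simp [decode, writes]) t
    rw [this, this, this, this, this, this, this]
    simpa [hs₀, run] using hb
  have hrun : (tryNumber o).run s = (Cmd.cond (valid o)
      (.seq (.set 16 Exp.cost) <|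
        .cond (or (eq (.var 14) (.lit 0)) (Exp.lt (.add (.var 16) (.lit 1)) (.var 14)))
          (.set 14 (.add (.var 16) (.lit 1))) nop) nop).run s₇ := rfl
  rw [hrun]
  by_cases hv : (Sketch.ofNumber C N).Valid G C cls
  · rw [run_cond_pos ((holds_valid hD hn₇).2 hv)]
    have hc := val_cost hD hn₇
    have hQ := hP.insert (Q := fun c => P c ∨ ((Sketch.ofNumber C N).Valid G C cls ∧
      (Sketch.ofNumber C N).cost C cls = c)) (c := (Sketch.ofNumber C N).cost C cls)
      (fun d => by simp [hv, eq_comm])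
    convert hQ using 1
    have e : Holds ((Cmd.set 16 Exp.cost).run s₇).arr ((Cmd.set 16 Exp.cost).run s₇).reg
        (or (eq (.var 14) (.lit 0)) (Exp.lt (.add (.var 16) (.lit 1)) (.var 14))) ↔
        b = 0 ∨ (Sketch.ofNumber C N).cost C cls + 1 < b := by
      rw [holds_or, holds_eq, holds_lt]
      simp [val, run, hb₇, hc]
    rw [run]
    split_ifs with h
    · rw [run_cond_pos (e.2 h)]; simp [run, val, hc]
    · rw [run_cond_neg fun h' => h (e.1 h')]; simp [run, nop, hb₇]
  · rw [run_cond_neg fun h => hv ((holds_valid hD hn₇).1 h)]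
    simpa [run, nop, hb₇, hv] using hP

/-- The state contains the instance `(G, S)`: its number of vertices in register `1` and cell `p` of
array `0`, followed there by the two matrices, whose rows are located by array `5` and
register `4`. -/
structure Loaded (p : ℕ) {n : ℕ} (G : SimpleGraph (Fin n)) (S : Set (Fin n × Fin n)) (s : State) :
    Prop where
  card : s.reg 1 = n
  sq : s.reg 4 = n * n
  row : ∀ u : Fin n, s.arr 5 u = u * n
  adj_iff : ∀ u v : Fin n, s.arr 0 (p + 1 + u * n + v) = 1 ↔ G.Adj u v
  adj_le : ∀ u v : Fin n, s.arr 0 (p + 1 + u * n + v) ≤ 1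
  dem_iff : ∀ u v : Fin n, s.arr 0 (p + 1 + n * n + u * n + v) ≠ 0 ↔ (u, v) ∈ S

/-- A vertex cover has been marked, the demand classes have been computed, and register `2` contains
the number of sketches. -/
structure Prepared {n : ℕ} (S : Set (Fin n × Fin n)) (C : Finset (Fin n)) (s : State) : Prop where
  marks : Marks C s.arr
  pair : ∀ c ∈ C, ∃ c' ∈ C, c' ≠ c
  sketches : s.reg 2 = (C.card ^ C.card) ^ 7
  cls_lt : ∀ u : Fin n, s.arr 7 u < n
  cls_iff : ∀ u v : Fin n, s.arr 7 u = s.arr 7 v ↔ Relation.EqvGen (fun a b => (a, b) ∈ S) u v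

section

variable {p n : ℕ} {G : SimpleGraph (Fin n)} {S : Set (Fin n × Fin n)} {C : Finset (Fin n)}
  {s st : State}

theorem Loaded.congr (h : Loaded p G S s) (h1 : st.reg 1 = s.reg 1) (h4 : st.reg 4 = s.reg 4)
    (h0 : st.arr 0 = s.arr 0) (h5 : st.arr 5 = s.arr 5) : Loaded p G S st := by
  obtain ⟨a1, a2, a3, a4, a5, a6⟩ := h
  rw [← h1] at a1
  rw [← h4] at a2
  rw [← h5] at a3
  rw [← h0] at a4 a5 a6
  exact ⟨a1, a2, a3, a4, a5, a6⟩

theorem Prepared.congr (h : Prepared S C s) (h2 : st.reg 2 = s.reg 2) (h6 : st.arr 6 = s.arr 6)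
    (h7 : st.arr 7 = s.arr 7) : Prepared S C st := by
  obtain ⟨a1, a2, a3, a4, a5⟩ := h
  rw [← h2] at a3
  rw [← h7] at a4 a5
  refine ⟨fun u => ?_, a2, a3, a4, a5⟩
  rw [h6]; exact a1 u

theorem Loaded.adj_ne (h : Loaded p G S s) (u v : Fin n) :
    s.arr 0 (p + 1 + s.arr 5 u + v) ≠ 0 ↔ G.Adj u v := by
  rw [h.row, ← h.adj_iff]
  have := h.adj_le u v
  omega

theorem Cmd.run_opt (hs : Loaded p G S s) (hC : Prepared S C s)
    (hcov : ∀ u v, G.Adj u v → u ∈ C ∨ v ∈ C) :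
    IsOptCode G S (((opt (p + 1)).run s).reg 14) := by
  refine isOptCode_of_sketches hcov hC.pair hC.cls_lt hC.cls_iff ?_
  have key := iter_inv (x := 11) (r := 2) (c := tryNumber (p + 1)) (s := s.setReg 14 0)
    (fun k st => k ≤ (C.card ^ C.card) ^ 7 → Loaded p G S st ∧ Prepared S C st ∧
      st.arr 7 = s.arr 7 ∧
      IsMinCode (fun c => ∃ N < k, (Sketch.ofNumber C N).Valid G C (fun u => s.arr 7 u) ∧
        (Sketch.ofNumber C N).cost C (fun u => s.arr 7 u) = c) (st.reg 14))
    (fun _ => ⟨hs.congr (by simp) (by simp) rfl rfl, hC.congr (by simp) rfl rfl, rfl,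
      .inl ⟨by simp, by simp⟩⟩) (by
      intro k _ st hst hk
      obtain ⟨h1, h2, h3, h4⟩ := hst (by omega)
      refine ⟨h1.congr ?_ ?_ ?_ ?_, h2.congr ?_ ?_ ?_, ?_, ?_⟩
      · rw [run_reg _ rfl]; simp
      · rw [run_reg _ rfl]; simp
      · rw [run_arr _ rfl]; simp
      · rw [run_arr _ rfl]; simp
      · rw [run_reg _ rfl]; simp
      · rw [run_arr _ rfl]; simp
      · rw [run_arr _ rfl]; simp
      · rw [run_arr _ rfl]; simpa using h3
      · have := run_tryNumber (o := p + 1) (N := k) (G := G) (C := C) (s := st.setReg 11 k)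
          (cls := fun u => s.arr 7 u) (by simpa using h1.card) (by simpa using h2.sketches)
          (by simp) (by omega) h2.marks h1.adj_ne (fun u => by simp [h3]) (by simp) h4
        refine this.congr ?_ ?_
        · rintro c (⟨N, hN, h⟩ | h)
          exacts [⟨c, le_rfl, N, by omega, h⟩, ⟨c, le_rfl, k, by omega, h⟩]
        · rintro c ⟨N, hN, h⟩
          rcases Nat.lt_succ_iff_lt_or_eq.1 hN with hN | rfl
          exacts [⟨c, le_rfl, .inl ⟨N, hN, h⟩⟩, ⟨c, le_rfl, .inr h⟩])
  have e : (s.setReg 14 0).reg 2 = (C.card ^ C.card) ^ 7 := by simpa using hC.sketches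
  rw [e] at key
  exact (key le_rfl).2.2.2

end

end RAM

/-! ### Preparation -/

/-- The union step of computing classes: adding the pair `(i, j)` merges exactly the two classes of
`i` and `j`. -/
theorem eqvGen_relabel {V : Type} {R R' : V → V → Prop} {f : V → ℕ} {i j : V}
    (hf : ∀ u v, f u = f v ↔ Relation.EqvGen R u v) (hR : ∀ a b, R' a b ↔ R a b ∨ (a = i ∧ b = j))
    (u v : V) : ((if f u = f i then f j else f u) = if f v = f i then f j else f v) ↔
      Relation.EqvGen R' u v := by
  have hmono : ∀ a b, Relation.EqvGen R a b → Relation.EqvGen R' a b := fun a b h =>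
    h.mono fun _ _ h' => (hR _ _).2 (.inl h')
  have hij : Relation.EqvGen R' i j := .rel _ _ ((hR i j).2 (.inr ⟨rfl, rfl⟩))
  constructor
  · intro h
    split_ifs at h with h1 h2 h2
    · exact hmono _ _ ((hf _ _).1 (h1.trans h2.symm))
    · exact ((hmono _ _ ((hf _ _).1 h1)).trans _ _ _ hij).trans _ _ _ (hmono _ _ ((hf _ _).1 h))
    · exact ((hmono _ _ ((hf _ _).1 h)).trans _ _ _ (hij.symm _ _)).trans _ _ _
        (hmono _ _ ((hf _ _).1 h2.symm))
    · exact hmono _ _ ((hf _ _).1 h)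
  · intro h
    induction h with
    | rel a b h =>
      rcases (hR a b).1 h with h | ⟨rfl, rfl⟩
      · rw [(hf a b).2 (.rel _ _ h)]
      · simp
    | refl => rfl
    | symm _ _ _ ih => exact ih.symm
    | trans _ _ _ _ _ ih ih' => exact ih.trans ih'

namespace RAM

open Exp

namespace Cmd

/-- `I i j` describes the moment before the pair `(i, j)` is treated, and `hrow` passes from the end
of a row to the next row. -/
theorem for_iter_inv {x y r n : ℕ} {c : Cmd} {s : State} (I : ℕ → ℕ → State → Prop)
    (hxy : x ≠ y) (hc : c.writes x = false) (hr : ∀ i j st, I i j st → st.reg r = n)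
    (hset : ∀ i st, I i 0 st → I i 0 (st.setReg x i)) (h0 : I 0 0 s)
    (hstep : ∀ i < n, ∀ j < n, ∀ st, I i j st → st.reg x = i →
      I i (j + 1) (c.run (st.setReg y j)))
    (hrow : ∀ i st, I i n st → I (i + 1) 0 st) :
    I n 0 ((Cmd.iter x r (.iter y r c)).run s) := by
  have := iter_inv (x := x) (r := r) (c := .iter y r c) (s := s) (fun i => I i 0) h0 (by
    intro i hi st hst
    rw [hr 0 0 s h0] at hi
    have e := hr _ _ _ (hset i st hst)
    have := iter_inv (x := y) (r := r) (c := c) (s := st.setReg x i)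
      (fun j st' => I i j st' ∧ st'.reg x = i) ⟨hset i st hst, by simp⟩ (by
        intro j hj st' hst'
        rw [e] at hj
        refine ⟨hstep i hi j hj st' hst'.1 hst'.2, ?_⟩
        rw [run_reg c hc]
        simpa [hxy] using hst'.2)
    rw [e] at this
    exact hrow i _ this.1)
  rwa [hr 0 0 s h0] at this

/-- The demand matrix begins `n * n` cells after cell `o` of array `0`. -/
def dem (o x y : ℕ) : Exp := .get 0 (.add (.add (.add (.lit o) (.var 4)) (at' 5 x)) (.var y))

/-- The machine cannot multiply, so the multiples of `n` are accumulated once and for all; the final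
value is `n * n`. -/
def rows : Cmd :=
  .seq (.set 5 (.lit 0)) <|
    .seq (.iter 6 1 (.seq (.put 5 (.var 6) (.var 5)) (.set 5 (.add (.var 5) (.var 1))))) <|
    .set 4 (.var 5)

/-- Mark the vertices of a maximal matching. -/
def cover (o : ℕ) : Cmd :=
  .iter 6 1 <| .iter 7 1 <| .cond (and (adj o 6 7) (and (mark 6).not (mark 7).not))
    (.seq (.put 6 (.var 6) (.lit 1)) (.put 6 (.var 7) (.lit 1))) nop

/-- Give all members of the class of register `6` the label of register `7`. -/
def relabel : Cmd :=
  .seq (.set 8 (at' 7 6)) <| .seq (.set 9 (at' 7 7)) <|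
    .iter 10 1 (.cond (eq (at' 7 10) (.var 8)) (.put 7 (.var 10) (.var 9)) nop)

def classes (o : ℕ) : Cmd :=
  .seq (.iter 6 1 (.put 7 (.var 6) (.var 6))) <|
    .iter 6 1 <| .iter 7 1 <| .cond (dem o 6 7) relabel nop

def mulStep : Cmd := .set 2 (mulCard (.var 2))

/-- Every marked vertex contributes seven factors `#C`. -/
def sketches : Cmd :=
  .seq (.set 2 (.lit 1)) <| .iter 6 1 <| .cond (mark 6)
    (.seq mulStep <| .seq mulStep <| .seq mulStep <| .seq mulStep <| .seq mulStep <|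
      .seq mulStep mulStep) nop

def prepare (o : ℕ) : Cmd :=
  .seq rows <| .seq (cover o) <| .seq (classes o) sketches

end Cmd

/-- `(u, v)` comes before `(i, j)` in lexicographic order. -/
def Before (i j u v : ℕ) : Prop := u < i ∨ (u = i ∧ v < j)

theorem before_succ {i j u v : ℕ} : Before i (j + 1) u v ↔ Before i j u v ∨ (u = i ∧ v = j) := by
  simp only [Before]; omega

theorem before_row {i n u v : ℕ} (hv : v < n) : Before (i + 1) 0 u v ↔ Before i n u v := by
  simp only [Before]; omega

section

variable {p n : ℕ} {G : SimpleGraph (Fin n)} {S : Set (Fin n × Fin n)} {C : Finset (Fin n)}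
  {s st : State}

theorem Cmd.run_rows (hn : s.reg 1 = n)
    (hadj : ∀ u v : Fin n, s.arr 0 (p + 1 + u * n + v) = 1 ↔ G.Adj u v)
    (hle : ∀ u v : Fin n, s.arr 0 (p + 1 + u * n + v) ≤ 1)
    (hdem : ∀ u v : Fin n, s.arr 0 (p + 1 + n * n + u * n + v) ≠ 0 ↔ (u, v) ∈ S) :
    Loaded p G S (rows.run s) := by
  have key := iter_inv (x := 6) (r := 1)
    (c := .seq (.put 5 (.var 6) (.var 5)) (.set 5 (.add (.var 5) (.var 1))))
    (s := s.setReg 5 0)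
    (fun k st => st.reg 1 = n ∧ st.arr 0 = s.arr 0 ∧ st.reg 5 = k * n ∧ ∀ u < k, st.arr 5 u = u * n)
    ⟨by simp [hn], rfl, by simp, fun u hu => absurd hu (by omega)⟩ (by
      rintro k - st ⟨h1, h2, h3, h4⟩
      refine ⟨by simp [run, h1], by simp [run, State.setArr_arr, h2],
        by simp [run, val, h3, h1]; ring, fun u hu => ?_⟩
      simp only [run, State.setReg_arr, State.setArr_arr, Function.update_self, val,
        State.setReg_reg]
      by_cases huk : u = k
      · subst huk; simp [h3]
      · rw [Function.update_of_ne huk]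
        exact h4 u (by omega))
  have e : (s.setReg 5 0).reg 1 = n := by simp [hn]
  rw [e] at key
  obtain ⟨h1, h2, h3, h4⟩ := key
  have hrun : rows.run s = (Cmd.set 4 (.var 5)).run ((Cmd.iter 6 1 (.seq (.put 5 (.var 6) (.var 5))
    (.set 5 (.add (.var 5) (.var 1))))).run (s.setReg 5 0)) := rfl
  rw [hrun]
  rw [← h2] at hadj hle hdem
  exact ⟨by simpa [run] using h1, by simpa [run, val] using h3, fun u => h4 u u.2, hadj, hle, hdem⟩

/-- Greedy matching: an edge with both ends unmarked gets both marked, so each marked vertex comes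
with another one. A vertex cover contains an end of every matching edge, which gives the factor two.
-/
theorem Cmd.run_cover (hs : Loaded p G S s) (h6 : ∀ i, s.arr 6 i = 0) :
    Loaded p G S ((cover (p + 1)).run s) ∧ ∃ C : Finset (Fin n),
      Marks C ((cover (p + 1)).run s).arr ∧ (∀ c ∈ C, ∃ c' ∈ C, c' ≠ c) ∧
      (∀ u v, G.Adj u v → u ∈ C ∨ v ∈ C) ∧
      ∀ W : Finset (Fin n), (∀ u v, G.Adj u v → u ∈ W ∨ v ∈ W) → C.card ≤ 2 * W.card := by
  have key := for_iter_inv (x := 6) (y := 7) (r := 1) (n := n) (s := s)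
    (c := .cond (and (adj (p + 1) 6 7) (and (mark 6).not (mark 7).not))
      (.seq (.put 6 (.var 6) (.lit 1)) (.put 6 (.var 7) (.lit 1))) nop)
    (fun i j st => Loaded p G S st ∧ ∃ C : Finset (Fin n),
      Marks C st.arr ∧ (∀ c ∈ C, ∃ c' ∈ C, c' ≠ c) ∧
      (∀ u v : Fin n, Before i j u v → G.Adj u v → u ∈ C ∨ v ∈ C) ∧
      ∀ W : Finset (Fin n), (∀ u v, G.Adj u v → u ∈ W ∨ v ∈ W) → C.card ≤ 2 * (C ∩ W).card)
    (by simp) rfl (fun i j st h => h.1.card)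
    (fun i st h => ⟨h.1.congr (by simp) (by simp) rfl rfl, h.2⟩)
    ⟨hs, ∅, fun u => by simp [h6], by simp, fun u v h => absurd h (by simp [Before]), by simp⟩ (by
      rintro i hi j hj st ⟨hL, C, h1, h2, h3, h4⟩ hx
      obtain ⟨i, rfl⟩ : ∃ i' : Fin n, (i' : ℕ) = i := ⟨⟨i, hi⟩, rfl⟩
      obtain ⟨j, rfl⟩ : ∃ j' : Fin n, (j' : ℕ) = j := ⟨⟨j, hj⟩, rfl⟩
      have hL' : Loaded p G S (st.setReg 7 j) := hL.congr (by simp) (by simp) rfl rfl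
      have hM : Marks C (st.setReg 7 j).arr := h1
      have hh : Holds (st.setReg 7 j).arr (st.setReg 7 (j : ℕ)).reg
          (and (adj (p + 1) 6 7) (and (mark 6).not (mark 7).not)) ↔
          G.Adj i j ∧ i ∉ C ∧ j ∉ C := by
        rw [holds_and, holds_and, holds_not, holds_not, hM.holds (u := i) (by simp [hx]),
          hM.holds (u := j) (by simp), ← hL'.adj_ne]
        simp [adj, Holds, val, at', hx]
      by_cases hcond : G.Adj i j ∧ i ∉ C ∧ j ∉ C
      · rw [run_cond_pos (hh.2 hcond)]
        obtain ⟨hadj, hiC, hjC⟩ := hcond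
        have hne := hadj.ne
        refine ⟨hL'.congr rfl rfl ?_ ?_, insert i (insert j C), fun u => ?_, fun c hc => ?_,
          fun u v hb huv => ?_, fun W hW => ?_⟩
        · rw [run_arr _ rfl]
        · rw [run_arr _ rfl]
        · simp only [run, State.setArr_arr, Function.update_self, val, State.setReg_reg,
            State.setArr_reg, Finset.mem_insert]
          rw [← h1 u]
          rcases eq_or_ne u j with rfl | huj
          · simp
          rcases eq_or_ne u i with rfl | hui
          · simp [Fin.val_inj, huj, hx]
          · simp [Fin.val_inj, huj, hui, hx]
        · simp only [Finset.mem_insert] at hc ⊢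
          rcases hc with rfl | rfl | hc
          · exact ⟨j, by simp, hne.symm⟩
          · exact ⟨i, by simp, hne⟩
          · obtain ⟨c', h, h'⟩ := h2 c hc
            exact ⟨c', by simp [h], h'⟩
        · simp only [Finset.mem_insert]
          rcases before_succ.1 hb with hb | ⟨h, h'⟩
          · rcases h3 u v hb huv with h | h <;> simp [h]
          · left; left; exact Fin.ext h
        · have hiC' : i ∉ insert j C := by simp [hne, hiC]
          rw [Finset.card_insert_of_notMem hiC', Finset.card_insert_of_notMem hjC]
          have h5 := h4 W hW
          -- The new edge adds two vertices to `C` and at least one to `C ∩ W`.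
          have h6 : (C ∩ W).card + 1 ≤ (insert i (insert j C) ∩ W).card := by
            rcases hW i j hadj with h | h
            · rw [← Finset.card_insert_of_notMem (a := i) (s := C ∩ W) (by simp [hiC])]
              refine Finset.card_le_card fun x hx => ?_
              simp only [Finset.mem_insert, Finset.mem_inter] at hx ⊢
              rcases hx with rfl | hx
              exacts [⟨.inl rfl, h⟩, ⟨.inr (.inr hx.1), hx.2⟩]
            · rw [← Finset.card_insert_of_notMem (a := j) (s := C ∩ W) (by simp [hjC])]
              refine Finset.card_le_card fun x hx => ?_
              simp only [Finset.mem_insert, Finset.mem_inter] at hx ⊢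
              rcases hx with rfl | hx
              exacts [⟨.inr (.inl rfl), h⟩, ⟨.inr (.inr hx.1), hx.2⟩]
          omega
      · rw [run_cond_neg fun h => hcond (hh.1 h)]
        refine ⟨hL'.congr (by simp [run, nop]) (by simp [run, nop]) rfl rfl, C, h1, h2,
          fun u v hb huv => ?_, h4⟩
        rcases before_succ.1 hb with hb | ⟨h, h'⟩
        · exact h3 u v hb huv
        · obtain rfl := Fin.ext h
          obtain rfl := Fin.ext h'
          by_contra hcon
          exact hcond ⟨huv, fun h => hcon (.inl h), fun h => hcon (.inr h)⟩)
    (by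
      rintro i st ⟨hL, C, h1, h2, h3, h4⟩
      exact ⟨hL, C, h1, h2, fun u v hb => h3 u v ((before_row v.2).1 hb), h4⟩)
  obtain ⟨hL, C, h1, h2, h3, h4⟩ := key
  refine ⟨hL, C, h1, h2, fun u v => h3 u v (.inl u.2), fun W hW => (h4 W hW).trans ?_⟩
  exact Nat.mul_le_mul_left _ (Finset.card_le_card Finset.inter_subset_right)

/-- Both labels are copied to registers beforehand, since the loop overwrites the label of `i`
itself. -/
theorem Cmd.run_relabel {i j : Fin n} (hn : s.reg 1 = n) (hi : s.reg 6 = i) (hj : s.reg 7 = j)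
    (u : Fin n) : (relabel.run s).arr 7 u =
      if s.arr 7 u = s.arr 7 i then s.arr 7 j else s.arr 7 u := by
  set s₂ := (Cmd.set 9 (at' 7 7)).run ((Cmd.set 8 (at' 7 6)).run s) with hs₂
  have key := iter_inv (x := 10) (r := 1) (s := s₂)
    (c := .cond (eq (at' 7 10) (.var 8)) (.put 7 (.var 10) (.var 9)) nop)
    (fun k st => st.reg 8 = s.arr 7 i ∧ st.reg 9 = s.arr 7 j ∧ ∀ u : Fin n, st.arr 7 u =
      if (u : ℕ) < k ∧ s.arr 7 u = s.arr 7 i then s.arr 7 j else s.arr 7 u)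
    ⟨by simp [hs₂, run, at', val, hi], by simp [hs₂, run, at', val, hj],
      fun u => by simp [hs₂, run]⟩ (by
      rintro k hk st ⟨h1, h2, h3⟩
      have e : Holds (st.setReg 10 k).arr (st.setReg 10 k).reg (eq (at' 7 10) (.var 8)) ↔
          st.arr 7 k = s.arr 7 i := by
        rw [holds_eq]; simp [val_at', val, h1]
      have hk' : k < n := by simpa [hs₂, run, hn] using hk
      have h3k := h3 ⟨k, hk'⟩
      simp only [lt_self_iff_false, false_and, if_false] at h3k
      by_cases hc : st.arr 7 k = s.arr 7 i
      · rw [run_cond_pos (e.2 hc)]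
        refine ⟨by simp [run, h1], by simp [run, h2], fun u => ?_⟩
        simp only [run, State.setArr_arr, State.setReg_arr, Function.update_self]
        by_cases huk : (u : ℕ) = k
        · have : s.arr 7 u = s.arr 7 i := by rw [huk, ← h3k, hc]
          have e1 : ∀ A, (Exp.var 10).val A (st.setReg 10 k).reg = u := fun A => by
            simp [val, huk]
          rw [e1, Function.update_self, if_pos ⟨by omega, this⟩]
          simp [val, h2]
        · rw [Function.update_of_ne (by simpa [val] using huk), h3 u]
          refine if_congr (and_congr_left fun _ => ?_) rfl rfl
          omega
      · rw [run_cond_neg fun h => hc (e.1 h)]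
        refine ⟨by simp [run, nop, h1], by simp [run, nop, h2], fun u => ?_⟩
        simp only [run, nop, State.setReg_arr]
        rw [h3 u]
        refine if_congr (and_congr_left fun hu => ?_) rfl rfl
        have : (u : ℕ) ≠ k := by
          rintro huk
          rw [h3k, ← huk] at hc
          exact hc hu
        omega)
  have e : s₂.reg 1 = n := by simp [hs₂, run, hn]
  rw [e] at key
  have := key.2.2 u
  simp only [u.2, true_and] at this
  exact this

/-- The labels describe the equivalence relation generated by the demands treated so far, starting
from equality. Labels are only copied, so they stay below `n`. -/
theorem Cmd.run_classes (hs : Loaded p G S s) :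
    (∀ u : Fin n, ((classes (p + 1)).run s).arr 7 u < n) ∧
    ∀ u v : Fin n, ((classes (p + 1)).run s).arr 7 u = ((classes (p + 1)).run s).arr 7 v ↔
      Relation.EqvGen (fun a b => (a, b) ∈ S) u v := by
  set s₁ := (Cmd.iter 6 1 (.put 7 (.var 6) (.var 6))).run s with hs₁
  have h₁ : ∀ u < n, s₁.arr 7 u = u := by
    have := iter_inv (x := 6) (r := 1) (c := .put 7 (.var 6) (.var 6)) (s := s)
      (fun k st => ∀ u < k, st.arr 7 u = u) (fun u hu => absurd hu (by omega)) (by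
        intro k _ st h u hu
        simp only [run, State.setArr_arr, State.setReg_arr, Function.update_self, val,
          State.setReg_reg]
        by_cases huk : u = k
        · subst huk; simp
        · rw [Function.update_of_ne huk]; exact h u (by omega))
    rwa [hs.card] at this
  have hL₁ : Loaded p G S s₁ := by
    refine hs.congr ?_ ?_ ?_ ?_
    · rw [hs₁, run_reg _ rfl]
    · rw [hs₁, run_reg _ rfl]
    · rw [hs₁, run_arr _ rfl]
    · rw [hs₁, run_arr _ rfl]
  have key := for_iter_inv (x := 6) (y := 7) (r := 1) (n := n) (s := s₁)
    (c := .cond (dem (p + 1) 6 7) relabel nop)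
    (fun i j st => Loaded p G S st ∧ (∀ u : Fin n, st.arr 7 u < n) ∧
      ∀ u v : Fin n, st.arr 7 u = st.arr 7 v ↔
        Relation.EqvGen (fun a b : Fin n => (a, b) ∈ S ∧ Before i j a b) u v)
    (by simp) rfl (fun i j st h => h.1.card)
    (fun i st h => ⟨h.1.congr (by simp) (by simp) rfl rfl, h.2⟩)
    ⟨hL₁, fun u => by rw [h₁ u u.2]; exact u.2, fun u v => by
      rw [h₁ u u.2, h₁ v v.2, Fin.val_inj]
      constructor
      · rintro rfl; exact .refl _
      · intro h
        induction h with
        | rel a b h => exact absurd h.2 (by simp [Before])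
        | refl => rfl
        | symm _ _ _ ih => exact ih.symm
        | trans _ _ _ _ _ ih ih' => exact ih.trans ih'⟩ (by
      rintro i hi j hj st ⟨hL, h1, h2⟩ hx
      obtain ⟨i, rfl⟩ : ∃ i' : Fin n, (i' : ℕ) = i := ⟨⟨i, hi⟩, rfl⟩
      obtain ⟨j, rfl⟩ : ∃ j' : Fin n, (j' : ℕ) = j := ⟨⟨j, hj⟩, rfl⟩
      have hL' : Loaded p G S (st.setReg 7 j) := hL.congr (by simp) (by simp) rfl rfl
      have hh : Holds (st.setReg 7 j).arr (st.setReg 7 (j : ℕ)).reg (dem (p + 1) 6 7) ↔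
          (i, j) ∈ S := by
        rw [← hL'.dem_iff]
        simp [dem, Holds, val, at', hx, hL.sq, hL.row]
      by_cases hcond : (i, j) ∈ S
      · rw [run_cond_pos (hh.2 hcond)]
        have hrel : ∀ u : Fin n, (relabel.run (st.setReg 7 (j : ℕ))).arr 7 u =
            if st.arr 7 u = st.arr 7 i then st.arr 7 j else st.arr 7 u :=
          run_relabel hL'.card (by simp [hx]) (by simp)
        refine ⟨hL'.congr ?_ ?_ ?_ ?_, fun u => ?_, fun u v => ?_⟩
        · rw [run_reg _ rfl]
        · rw [run_reg _ rfl]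
        · rw [run_arr _ rfl]
        · rw [run_arr _ rfl]
        · rw [hrel]; split_ifs; exacts [h1 j, h1 u]
        · rw [hrel, hrel]
          refine eqvGen_relabel (f := fun u : Fin n => st.arr 7 u) h2 (fun a b => ?_) u v
          simp only [before_succ, Fin.val_inj]
          constructor
          · rintro ⟨h, h' | h'⟩
            exacts [.inl ⟨h, h'⟩, .inr h']
          · rintro (⟨h, h'⟩ | ⟨rfl, rfl⟩)
            exacts [⟨h, .inl h'⟩, ⟨hcond, .inr ⟨rfl, rfl⟩⟩]
      · rw [run_cond_neg fun h => hcond (hh.1 h)]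
        refine ⟨hL'.congr (by simp [run, nop]) (by simp [run, nop]) rfl rfl, h1, fun u v => ?_⟩
        have : (fun a b : Fin n => (a, b) ∈ S ∧ Before i (j + 1) a b) =
            fun a b : Fin n => (a, b) ∈ S ∧ Before i j a b := by
          funext a b
          refine propext (and_congr_right fun h => ?_)
          rw [before_succ, or_iff_left]
          rintro ⟨h1, h2⟩
          rw [Fin.ext h1, Fin.ext h2] at h
          exact hcond h
        rw [this]; exact h2 u v)
    (by
      rintro i st ⟨hL, h1, h2⟩
      refine ⟨hL, h1, fun u v => ?_⟩
      have : (fun a b : Fin n => (a, b) ∈ S ∧ Before (i + 1) 0 a b) =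
          fun a b : Fin n => (a, b) ∈ S ∧ Before i n a b := by
        funext a b; rw [before_row b.2]
      rw [this]; exact h2 u v)
  obtain ⟨-, h1, h2⟩ := key
  refine ⟨h1, fun u v => (h2 u v).trans ?_⟩
  have : (fun a b : Fin n => (a, b) ∈ S ∧ Before n 0 a b) = fun a b : Fin n => (a, b) ∈ S := by
    funext a b
    exact propext (and_iff_left (.inl a.2))
  rw [this]

theorem Cmd.run_sketches (hn : s.reg 1 = n) (hC : Marks C s.arr) :
    (sketches.run s).reg 2 = (C.card ^ C.card) ^ 7 := by
  have hmul : ∀ st : State, st.reg 1 = n → Marks C st.arr →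
      (mulStep.run st).reg 2 = st.reg 2 * C.card ∧ (mulStep.run st).reg 1 = n ∧
      Marks C (mulStep.run st).arr := by
    intro st h1 h2
    refine ⟨?_, by simp [mulStep, run, h1], h2⟩
    simp only [mulStep, run, State.setReg_reg, Function.update_self]
    rw [h2.val_mulCard h1 (k := st.reg 2) (fun i => by simp [val]), mul_comm]
  have key := iter_inv (x := 6) (r := 1) (s := s.setReg 2 1) (c := .cond (mark 6)
    (.seq mulStep <| .seq mulStep <| .seq mulStep <| .seq mulStep <| .seq mulStep <|
      .seq mulStep mulStep) nop)
    (fun k st => st.reg 1 = n ∧ Marks C st.arr ∧ st.reg 2 =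
      (C.card ^ (Finset.univ.filter fun u : Fin n => u ∈ C ∧ (u : ℕ) < k).card) ^ 7)
    ⟨by simp [hn], hC, by simp⟩ (by
      rintro i hi st ⟨h1, h2, h3⟩
      obtain ⟨i, rfl⟩ : ∃ i' : Fin n, (i' : ℕ) = i := ⟨⟨i, by simpa [hn] using hi⟩, rfl⟩
      have h2' : Marks C (st.setReg 6 (i : ℕ)).arr := h2
      have hr : C.rank i = (Finset.univ.filter fun u : Fin n => u ∈ C ∧ (u : ℕ) < i).card := rfl
      rw [Finset.rank_succ]
      rw [← hr] at h3
      by_cases hi : i ∈ C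
      · rw [run_cond_pos ((h2'.holds (u := i) (by simp)).2 hi)]
        simp only [run]
        obtain ⟨e1, f1, g1⟩ := hmul (st.setReg 6 (i : ℕ)) (by simp [h1]) h2'
        obtain ⟨e2, f2, g2⟩ := hmul _ f1 g1
        obtain ⟨e3, f3, g3⟩ := hmul _ f2 g2
        obtain ⟨e4, f4, g4⟩ := hmul _ f3 g3
        obtain ⟨e5, f5, g5⟩ := hmul _ f4 g4
        obtain ⟨e6, f6, g6⟩ := hmul _ f5 g5
        obtain ⟨e7, f7, g7⟩ := hmul _ f6 g6
        refine ⟨f7, g7, ?_⟩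
        rw [e7, e6, e5, e4, e3, e2, e1, if_pos hi]
        simp only [State.setReg_reg, ne_eq, Nat.reduceEqDiff, not_false_eq_true,
          Function.update_of_ne, h3]
        ring
      · rw [run_cond_neg fun h => hi ((h2'.holds (u := i) (by simp)).1 h), if_neg hi]
        exact ⟨by simp [run, nop, h1], h2', by simp [run, nop, h3]⟩)
  have e : (s.setReg 2 1).reg 1 = n := by simp [hn]
  rw [e] at key
  have := key.2.2
  simp only [Fin.is_lt, and_true, Finset.filter_mem_eq_inter, Finset.univ_inter] at this
  exact this

theorem Cmd.run_prepare (hn : s.reg 1 = n)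
    (hadj : ∀ u v : Fin n, s.arr 0 (p + 1 + u * n + v) = 1 ↔ G.Adj u v)
    (hle : ∀ u v : Fin n, s.arr 0 (p + 1 + u * n + v) ≤ 1)
    (hdem : ∀ u v : Fin n, s.arr 0 (p + 1 + n * n + u * n + v) ≠ 0 ↔ (u, v) ∈ S)
    (h6 : ∀ i, s.arr 6 i = 0) :
    Loaded p G S ((prepare (p + 1)).run s) ∧ ∃ C : Finset (Fin n),
      Prepared S C ((prepare (p + 1)).run s) ∧ (∀ u v, G.Adj u v → u ∈ C ∨ v ∈ C) ∧
      ∀ W : Finset (Fin n), (∀ u v, G.Adj u v → u ∈ W ∨ v ∈ W) → C.card ≤ 2 * W.card := by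
  have hL₁ := run_rows hn hadj hle hdem
  obtain ⟨hL₂, C, h1, h2, h3, h4⟩ := run_cover hL₁ (fun i => by rw [run_arr _ rfl]; exact h6 i)
  obtain ⟨h5, h7⟩ := run_classes hL₂
  have hrun : (prepare (p + 1)).run s =
    sketches.run ((classes (p + 1)).run ((cover (p + 1)).run (rows.run s))) := rfl
  rw [hrun]
  set s₂ := (cover (p + 1)).run (rows.run s)
  have e1 : ∀ x, (classes (p + 1)).writes x = false → sketches.writes x = false →
      (sketches.run ((classes (p + 1)).run s₂)).reg x = s₂.reg x := fun x h h' => by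
    rw [run_reg _ h', run_reg _ h]
  have e2 : ∀ x, (classes (p + 1)).puts x = false → sketches.puts x = false →
      (sketches.run ((classes (p + 1)).run s₂)).arr x = s₂.arr x := fun x h h' => by
    rw [run_arr _ h', run_arr _ h]
  refine ⟨hL₂.congr (e1 _ rfl rfl) (e1 _ rfl rfl) (e2 _ rfl rfl) (e2 _ rfl rfl), C,
    ⟨fun u => ?_, h2, ?_, fun u => ?_, fun u v => ?_⟩, h3, h4⟩
  · rw [e2 6 rfl rfl]; exact h1 u
  · refine run_sketches ?_ fun u => ?_
    · rw [run_reg _ rfl, hL₂.card]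
    · rw [run_arr _ rfl]; exact h1 u
  · rw [run_arr sketches rfl]; exact h5 u
  · rw [run_arr sketches rfl]; exact h7 u v

end

end RAM

/-- The optimum can only get worse when edges are deleted, so a graph between two graphs with equal
optimum shares it. -/
theorem IsOptCode.of_le_of_le {V : Type} {S : Set (V × V)} {b : ℕ} {G₁ G₂ G₃ : SimpleGraph V}
    (h₁ : IsOptCode G₁ S b) (h₃ : IsOptCode G₃ S b) (h₁₂ : G₁ ≤ G₂) (h₂₃ : G₂ ≤ G₃) :
    IsOptCode G₂ S b := by
  rcases h₃ with ⟨rfl, h₃⟩ | ⟨c, rfl, -, hmin⟩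
  · exact .inl ⟨rfl, fun c ⟨H, hH, h⟩ => h₃ c ⟨H, hH.trans h₂₃, h⟩⟩
  · rcases h₁ with ⟨h, -⟩ | ⟨c', hc', ⟨H, hH, h⟩, -⟩
    · simp at h
    · obtain rfl : c = c' := by omega
      exact .inr ⟨c, rfl, ⟨H, hH.trans h₁₂, h⟩, fun c' ⟨H', hH', h'⟩ =>
        hmin c' ⟨H', hH'.trans h₂₃, h'⟩⟩

/-! ### Finding an optimal forest by deleting edges -/

namespace RAM

open Exp

namespace Cmd

/-- Set the adjacency of the vertices in registers `6` and `7`. -/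
def setAdj (o k : ℕ) : Cmd :=
  .seq (.put 0 (.add (.add (.lit o) (at' 5 6)) (.var 7)) (.lit k))
    (.put 0 (.add (.add (.lit o) (at' 5 7)) (.var 6)) (.lit k))

/-- Delete the edge between the vertices in registers `6` and `7`, unless this changes the
optimum. -/
def tryDelete (o : ℕ) : Cmd :=
  .cond (adj o 6 7)
    (.seq (setAdj o 0) <| .seq (opt o) <| .cond (ne (.var 14) (.var 15)) (setAdj o 1) nop) nop

def minimize (o : ℕ) : Cmd :=
  .seq (.set 15 (.var 14)) <| .iter 6 1 <| .iter 7 1 <| tryDelete o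

end Cmd

section

variable {p n : ℕ} {G H H' : SimpleGraph (Fin n)} {S : Set (Fin n × Fin n)} {C : Finset (Fin n)}
  {s st : State}

theorem cell_inj {u v i j : Fin n} (h : (u : ℕ) * n + v = i * n + j) : u = i ∧ v = j := by
  have hn : 0 < n := u.pos
  have h1 := congrArg (· / n) h
  have h2 := congrArg (· % n) h
  simp only [Nat.mul_add_mod_self_right, Nat.mod_eq_of_lt v.2, Nat.mod_eq_of_lt j.2] at h2
  simp only [mul_comm _ n, Nat.mul_add_div hn, Nat.div_eq_of_lt v.2, Nat.div_eq_of_lt j.2,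
    add_zero] at h1
  exact ⟨Fin.ext h1, Fin.ext h2⟩

theorem cell_lt (i j : Fin n) : (i : ℕ) * n + j < n * n := by
  calc (i : ℕ) * n + j < i * n + n := by omega
    _ = (i + 1) * n := by ring
    _ ≤ n * n := Nat.mul_le_mul_right _ i.2

theorem Cmd.run_setAdj {k : ℕ} (hs : Loaded p H S s) {i j : Fin n} (hi : s.reg 6 = i)
    (hj : s.reg 7 = j) (hk : k ≤ 1)
    (hH' : ∀ u v, H'.Adj u v ↔ if (u = i ∧ v = j) ∨ (u = j ∧ v = i) then k = 1 else H.Adj u v) :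
    Loaded p H' S ((setAdj (p + 1) k).run s) := by
  have e : ∀ x, ((setAdj (p + 1) k).run s).arr 0 x =
      if x = p + 1 + j * n + i ∨ x = p + 1 + i * n + j then k else s.arr 0 x := by
    intro x
    simp only [setAdj, run, State.setArr_arr, val, at', State.setArr_reg, hi, hj, hs.row,
      Function.update_apply, if_true, if_neg (show (5 : ℕ) ≠ 0 by decide)]
    by_cases h1 : x = p + 1 + j * n + i <;> by_cases h2 : x = p + 1 + i * n + j <;> simp [h1, h2]
  have e' : ∀ u v : Fin n, ((setAdj (p + 1) k).run s).arr 0 (p + 1 + u * n + v) =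
      if (u = i ∧ v = j) ∨ (u = j ∧ v = i) then k else s.arr 0 (p + 1 + u * n + v) := by
    intro u v
    rw [e]
    refine if_congr ?_ rfl rfl
    constructor
    · rintro (h | h)
      · exact .inr (cell_inj (by omega))
      · exact .inl (cell_inj (by omega))
    · rintro (⟨rfl, rfl⟩ | ⟨rfl, rfl⟩)
      exacts [.inr rfl, .inl rfl]
  refine ⟨?_, ?_, fun u => ?_, fun u v => ?_, fun u v => ?_, fun u v => ?_⟩
  · rw [run_reg _ rfl, hs.card]
  · rw [run_reg _ rfl, hs.sq]
  · rw [run_arr _ rfl, hs.row]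
  · rw [e', hH']
    split_ifs
    · rfl
    · exact hs.adj_iff u v
  · rw [e']
    split_ifs
    · exact hk
    · exact hs.adj_le u v
  · rw [e, if_neg]
    · exact hs.dem_iff u v
    · have := cell_lt i j
      have := cell_lt j i
      rintro (h | h) <;> omega

theorem deleteEdge_adj {i j u v : Fin n} : (H.deleteEdges {s(i, j)}).Adj u v ↔
    if (u = i ∧ v = j) ∨ (u = j ∧ v = i) then False else H.Adj u v := by
  rw [SimpleGraph.deleteEdges_adj, Set.mem_singleton_iff, Sym2.eq_iff]
  split_ifs with h <;> simp [h]

/-- The current graph `H` keeps the optimum of `G`, and no edge already examined can be deleted from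
it without changing the optimum. The set `C` covers all subgraphs of `G`, so the preparation stays
valid. -/
theorem Cmd.run_minimize {b : ℕ} (hs : Loaded p G S s) (hC : Prepared S C s)
    (hcov : ∀ u v, G.Adj u v → u ∈ C ∨ v ∈ C) (hb : s.reg 14 = b) (hopt : IsOptCode G S b)
    (hpos : b ≠ 0) :
    ∃ H ≤ G, Loaded p H S ((minimize (p + 1)).run s) ∧ ConnectsPairs S H ∧
      H.edgeSet.ncard + 1 = b := by
  have key := for_iter_inv (x := 6) (y := 7) (r := 1) (n := n) (c := tryDelete (p + 1))
    (s := (Cmd.set 15 (.var 14)).run s)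
    (fun i j st => st.reg 15 = b ∧ Prepared S C st ∧ ∃ H ≤ G, Loaded p H S st ∧ IsOptCode H S b ∧
      ∀ u v : Fin n, Before i j u v → H.Adj u v → ¬ IsOptCode (H.deleteEdges {s(u, v)}) S b)
    (by simp) rfl (fun i j st ⟨_, _, _, _, h, _⟩ => h.card)
    (fun i st ⟨h1, h2, H, h3, h4, h5⟩ => ⟨by simpa using h1, h2.congr (by simp) rfl rfl, H, h3,
      h4.congr (by simp) (by simp) rfl rfl, h5⟩)
    ⟨by simp [run, val, hb], hC.congr (by simp [run]) rfl rfl, G, le_rfl,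
      hs.congr (by simp [run]) (by simp [run]) rfl rfl, hopt,
      fun u v h => absurd h (by simp [Before])⟩ (by
      rintro i hi j hj st ⟨h1, h2, H, hHG, h3, h4, h5⟩ hx
      obtain ⟨i, rfl⟩ : ∃ i' : Fin n, (i' : ℕ) = i := ⟨⟨i, hi⟩, rfl⟩
      obtain ⟨j, rfl⟩ : ∃ j' : Fin n, (j' : ℕ) = j := ⟨⟨j, hj⟩, rfl⟩
      have h3' : Loaded p H S (st.setReg 7 (j : ℕ)) := h3.congr (by simp) (by simp) rfl rfl
      have h2' : Prepared S C (st.setReg 7 (j : ℕ)) := h2.congr (by simp) rfl rfl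
      have h1' : (st.setReg 7 (j : ℕ)).reg 15 = b := by simpa using h1
      have hx' : (st.setReg 7 (j : ℕ)).reg 6 = i := by simpa using hx
      have hy' : (st.setReg 7 (j : ℕ)).reg 7 = j := by simp
      generalize st.setReg 7 (j : ℕ) = t at h1' h2' h3' hx' hy'
      have hh : Holds t.arr t.reg (adj (p + 1) 6 7) ↔ H.Adj i j := by
        rw [← h3'.adj_ne]
        simp [adj, Holds, val, at', hx', hy']
      rw [tryDelete]
      by_cases hadj : H.Adj i j
      · rw [run_cond_pos (hh.2 hadj), run, run]
        set t₁ := (setAdj (p + 1) 0).run t with ht₁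
        have hL₁ : Loaded p (H.deleteEdges {s(i, j)}) S t₁ :=
          run_setAdj h3' hx' hy' (by simp) fun u v => by
            rw [deleteEdge_adj]; split_ifs <;> simp
        have hP₁ : Prepared S C t₁ := by
          refine h2'.congr ?_ ?_ ?_
          · rw [ht₁, run_reg _ rfl]
          · rw [ht₁, run_arr _ rfl]
          · rw [ht₁, run_arr _ rfl]
        have hle : H.deleteEdges {s(i, j)} ≤ H := SimpleGraph.deleteEdges_le _
        have hO := run_opt hL₁ hP₁ fun u v huv => hcov u v (hHG (hle huv))
        have hreg : ∀ x, (setAdj (p + 1) 0).writes x = false → (opt (p + 1)).writes x = false →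
            ((opt (p + 1)).run t₁).reg x = t.reg x := fun x hx hx' => by
          rw [run_reg _ hx', ht₁, run_reg _ hx]
        have hL₂ : Loaded p (H.deleteEdges {s(i, j)}) S ((opt (p + 1)).run t₁) := by
          refine hL₁.congr ?_ ?_ ?_ ?_
          · rw [run_reg _ rfl]
          · rw [run_reg _ rfl]
          · rw [run_arr _ rfl]
          · rw [run_arr _ rfl]
        have hP₂ : Prepared S C ((opt (p + 1)).run t₁) := by
          refine hP₁.congr ?_ ?_ ?_
          · rw [run_reg _ rfl]
          · rw [run_arr _ rfl]
          · rw [run_arr _ rfl]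
        have h6 := hreg 6 rfl rfl
        have h7 := hreg 7 rfl rfl
        have h15 := hreg 15 rfl rfl
        rw [hx'] at h6
        rw [hy'] at h7
        rw [h1'] at h15
        generalize (opt (p + 1)).run t₁ = t₂ at hO hL₂ hP₂ h6 h7 h15
        have hc : Holds t₂.arr t₂.reg (ne (.var 14) (.var 15)) ↔ t₂.reg 14 ≠ b := by
          rw [holds_ne]; simp [val, h15]
        by_cases hne : t₂.reg 14 = b
        · rw [run_cond_neg fun h => hc.1 h hne]
          rw [hne] at hO
          refine ⟨by simp [run, nop, h15], hP₂.congr (by simp [run, nop]) rfl rfl, _,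
            hle.trans hHG, hL₂.congr (by simp [run, nop]) (by simp [run, nop]) rfl rfl, hO,
            fun u v hb' huv hcon => ?_⟩
          rcases before_succ.1 hb' with hb' | ⟨hu, hv⟩
          -- An edge found essential stays so: if it could be deleted from the smaller graph, it
          -- could be deleted from `H`, which lies in between.
          · refine h5 u v hb' (hle huv) (hcon.of_le_of_le h4 ?_ (SimpleGraph.deleteEdges_le _))
            exact SimpleGraph.deleteEdges_mono hle
          · obtain rfl := Fin.ext hu
            obtain rfl := Fin.ext hv
            simp [SimpleGraph.deleteEdges_adj] at huv
        · rw [run_cond_pos (hc.2 hne)]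
          refine ⟨?_, hP₂.congr ?_ ?_ ?_, H, hHG, ?_, h4, fun u v hb' huv hcon => ?_⟩
          · rw [run_reg _ rfl, h15]
          · rw [run_reg _ rfl]
          · rw [run_arr _ rfl]
          · rw [run_arr _ rfl]
          · refine run_setAdj hL₂ h6 h7 le_rfl fun u v => ?_
            rw [deleteEdge_adj]
            split_ifs with h
            · rcases h with ⟨rfl, rfl⟩ | ⟨rfl, rfl⟩
              · simpa using hadj
              · simpa using hadj.symm
            · rfl
          · rcases before_succ.1 hb' with hb' | ⟨hu, hv⟩
            · exact h5 u v hb' huv hcon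
            · obtain rfl := Fin.ext hu
              obtain rfl := Fin.ext hv
              exact hne (hO.unique hcon)
      · rw [run_cond_neg fun h => hadj (hh.1 h)]
        refine ⟨by simp [run, nop, h1'], h2'.congr (by simp [run, nop]) rfl rfl, H, hHG,
          h3'.congr (by simp [run, nop]) (by simp [run, nop]) rfl rfl, h4, fun u v hb' huv => ?_⟩
        rcases before_succ.1 hb' with hb' | ⟨hu, hv⟩
        · exact h5 u v hb' huv
        · obtain rfl := Fin.ext hu
          obtain rfl := Fin.ext hv
          exact absurd huv hadj)
    (fun i st ⟨h1, h2, H, hHG, h3, h4, h5⟩ => ⟨h1, h2, H, hHG, h3, h4,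
      fun u v hb' => h5 u v ((before_row v.2).1 hb')⟩)
  obtain ⟨-, -, H, hHG, hL, hO, hess⟩ := key
  have hO' := hO
  rcases hO with ⟨h, -⟩ | ⟨c, rfl, ⟨H₀, hH₀, hS, hcard⟩, hmin⟩
  · exact absurd h hpos
  -- An edge of `H` outside the optimal solution `H₀` could be deleted without loss, although every
  -- edge of `H` is essential.
  have : H = H₀ := by
    refine le_antisymm (fun u v huv => ?_) hH₀
    by_contra hnot
    refine hess u v (.inl u.2) huv (.inr ⟨c, rfl, ⟨H₀, fun x y hxy => ?_, hS, hcard⟩,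
      fun c' ⟨H', hH', h'⟩ => hmin c' ⟨H', hH'.trans (SimpleGraph.deleteEdges_le _), h'⟩⟩)
    refine SimpleGraph.deleteEdges_adj.2 ⟨hH₀ hxy, fun hmem => hnot ?_⟩
    rw [Set.mem_singleton_iff] at hmem
    rw [← SimpleGraph.mem_edgeSet, ← hmem]
    exact hxy
  exact ⟨H, hHG, hL, this ▸ hS, by rw [this, hcard]⟩

end

/-! ### Input and output -/

namespace Cmd

def start (p : ℕ) : Cmd := .set 1 (.get 0 (.lit p))

/-- Compare the optimum with the number in cell `0` of array `0`. -/
def decide : Cmd :=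
  .seq (opt 2) <|
    -- The value is exactly `0` or `1`, as an `and` takes its nonzero value from the second
    -- argument, here a `not`.
    .seq (.put 1 (.lit 0) (and (.var 14) (Exp.lt (.add (.get 0 (.lit 0)) (.lit 1)) (.var 14)).not))
      (.set 0 (.lit 1))

def writeMatrix : Cmd :=
  .seq (.put 1 (.lit 0) (.lit 1)) <| .seq
    (.iter 6 1 <| .iter 7 1 <| .put 1 (.add (.add (.lit 1) (at' 5 6)) (.var 7)) (adj 1 6 7)) <|
    .set 0 (.add (.var 4) (.lit 1))

def solve : Cmd :=
  .seq (opt 1) <| .cond (.var 14) (.seq (minimize 1) writeMatrix)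
    (.seq (.put 1 (.lit 0) (.lit 0)) (.set 0 (.lit 1)))

end Cmd

open Classical in
theorem matrixBits_eq {n : ℕ} (r : Fin n → Fin n → Prop) :
    matrixBits r = List.ofFn fun k : Fin (n * n) => if r k.divNat k.modNat then 1 else 0 := by
  rw [matrixBits, List.ofFn_mul, List.flatMap_def, ← List.ofFn_id, List.map_ofFn]
  congr 2
  funext i
  simp only [Function.comp, id, List.map_ofFn]
  congr 1
  funext j
  have hn : 0 < n := i.pos
  have e1 : (⟨(i : ℕ) * n + j, cell_lt i j⟩ : Fin (n * n)).divNat = i := by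
    apply Fin.ext
    simp [Fin.divNat, mul_comm _ n, Nat.mul_add_div hn, Nat.div_eq_of_lt j.2]
  have e2 : (⟨(i : ℕ) * n + j, cell_lt i j⟩ : Fin (n * n)).modNat = j := by
    apply Fin.ext
    simp [Fin.modNat, Nat.mod_eq_of_lt j.2]
  rw [e1, e2]
  rfl

theorem length_matrixBits {n : ℕ} (r : Fin n → Fin n → Prop) : (matrixBits r).length = n * n := by
  rw [matrixBits_eq, List.length_ofFn]

open Classical in
theorem matrixBits_getElem? {n : ℕ} (r : Fin n → Fin n → Prop) (i j : Fin n) :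
    (matrixBits r)[(i : ℕ) * n + j]? = some (if r i j then 1 else 0) := by
  have hlen : (i : ℕ) * n + j < (matrixBits r).length := by
    rw [length_matrixBits]; exact cell_lt i j
  rw [List.getElem?_eq_getElem hlen]
  congr 1
  have hn : 0 < n := i.pos
  simp only [matrixBits_eq, List.getElem_ofFn]
  congr 2
  · apply Fin.ext
    simp [Fin.divNat, mul_comm _ n, Nat.mul_add_div hn, Nat.div_eq_of_lt j.2]
  · apply Fin.ext
    simp [Fin.modNat, Nat.mod_eq_of_lt j.2]

theorem init_cells (pre : List ℕ) (I : SteinerInstance) {p : ℕ} (hp : pre.length = p) :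
    (State.init (pre ++ I.encode)).arr 0 p = I.n ∧
    (∀ u v : Fin I.n, (State.init (pre ++ I.encode)).arr 0 (p + 1 + u * I.n + v) = 1 ↔
      I.G.Adj u v) ∧
    (∀ u v : Fin I.n, (State.init (pre ++ I.encode)).arr 0 (p + 1 + u * I.n + v) ≤ 1) ∧
    ∀ u v : Fin I.n, (State.init (pre ++ I.encode)).arr 0 (p + 1 + I.n * I.n + u * I.n + v) ≠ 0 ↔
      (u, v) ∈ I.S := by
  classical
  have h : ∀ k, (State.init (pre ++ I.encode)).arr 0 (p + k) = (I.encode[k]?).getD 0 := by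
    intro k
    simp only [State.init, if_true, List.getD_eq_getElem?_getD]
    rw [List.getElem?_append_right (by omega), hp, Nat.add_sub_cancel_left]
  have h1 : ∀ u v : Fin I.n, (State.init (pre ++ I.encode)).arr 0 (p + 1 + u * I.n + v) =
      if I.G.Adj u v then 1 else 0 := by
    intro u v
    have hlt := cell_lt u v
    rw [show p + 1 + u * I.n + v = p + ((u * I.n + v) + 1) by omega, h, SteinerInstance.encode,
      List.getElem?_cons_succ, List.getElem?_append_left (by rw [length_matrixBits]; exact hlt),
      matrixBits_getElem?]
    simp
  refine ⟨by simpa [SteinerInstance.encode] using h 0, fun u v => ?_, fun u v => ?_,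
    fun u v => ?_⟩
  · rw [h1]; split_ifs with h <;> simp [h]
  · rw [h1]; split_ifs <;> simp
  · rw [show p + 1 + I.n * I.n + u * I.n + v = p + ((I.n * I.n + (u * I.n + v)) + 1) by omega, h,
      SteinerInstance.encode, List.getElem?_cons_succ,
      List.getElem?_append_right (by rw [length_matrixBits]; omega), length_matrixBits,
      Nat.add_sub_cancel_left, matrixBits_getElem?]
    simp

section

variable {p n : ℕ} {G H : SimpleGraph (Fin n)} {S : Set (Fin n × Fin n)} {C : Finset (Fin n)}
  {s : State}

theorem Cmd.run_writeMatrix (hs : Loaded 0 H S s) :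
    (writeMatrix.run s).output = 1 :: matrixBits H.Adj := by
  classical
  have hs' : Loaded 0 H S ((Cmd.put 1 (.lit 0) (.lit 1)).run s) := hs.congr rfl rfl rfl rfl
  have key := for_iter_inv (x := 6) (y := 7) (r := 1) (n := n)
    (c := .put 1 (.add (.add (.lit 1) (at' 5 6)) (.var 7)) (adj 1 6 7))
    (s := (Cmd.put 1 (.lit 0) (.lit 1)).run s)
    (fun i j st => Loaded 0 H S st ∧ st.arr 1 0 = 1 ∧ ∀ u v : Fin n, Before i j u v →
      st.arr 1 (1 + (u * n + v)) = if H.Adj u v then 1 else 0)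
    (by simp) rfl (fun i j st h => h.1.card)
    (fun i st h => ⟨h.1.congr (by simp) (by simp) rfl rfl, h.2⟩)
    ⟨hs', by simp [run, State.setArr_arr, val], fun u v h => absurd h (by simp [Before])⟩ (by
      rintro i hi j hj st ⟨hL, h1, h2⟩ hx
      obtain ⟨i, rfl⟩ : ∃ i' : Fin n, (i' : ℕ) = i := ⟨⟨i, hi⟩, rfl⟩
      obtain ⟨j, rfl⟩ : ∃ j' : Fin n, (j' : ℕ) = j := ⟨⟨j, hj⟩, rfl⟩
      have e0 : (Exp.add (.add (.lit 1) (at' 5 6)) (.var 7)).val st.arr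
          (Function.update st.reg 7 (j : ℕ)) = 1 + (i * n + j) := by
        simp [val, at', hx, hL.row, add_assoc]
      have e1 : (adj 1 6 7).val st.arr (Function.update st.reg 7 (j : ℕ)) =
          if H.Adj i j then 1 else 0 := by
        have h := hL.adj_iff i j
        have hle := hL.adj_le i j
        have e : (adj 1 6 7).val st.arr (Function.update st.reg 7 (j : ℕ)) =
            st.arr 0 (0 + 1 + i * n + j) := by
          simp [adj, val, at', hx, hL.row]
        rw [e]
        split_ifs with ha
        · exact h.2 ha
        · have : st.arr 0 (0 + 1 + i * n + j) ≠ 1 := fun h' => ha (h.1 h')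
          omega
      refine ⟨hL.congr (by simp [run]) (by simp [run]) ?_ ?_, ?_, fun u v hb => ?_⟩
      · rw [run_arr _ rfl]; rfl
      · rw [run_arr _ rfl]; rfl
      · simp only [run, State.setArr_arr, State.setReg_arr, State.setReg_reg, e0,
          Function.update_self]
        rw [Function.update_of_ne (by omega)]
        exact h1
      · simp only [run, State.setArr_arr, State.setReg_arr, State.setReg_reg, e0, e1,
          Function.update_self]
        by_cases huv : u = i ∧ v = j
        · obtain ⟨rfl, rfl⟩ := huv
          rw [Function.update_self]
        · rw [Function.update_of_ne fun h => huv (cell_inj (by omega))]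
          refine h2 u v ((before_succ.1 hb).resolve_right fun h => huv ⟨Fin.ext h.1, Fin.ext h.2⟩))
    (fun i st ⟨hL, h1, h2⟩ => ⟨hL, h1, fun u v hb => h2 u v ((before_row v.2).1 hb)⟩)
  obtain ⟨hL, h1, h2⟩ := key
  have hrun : writeMatrix.run s = (Cmd.set 0 (.add (.var 4) (.lit 1))).run ((Cmd.iter 6 1 (.iter 7 1
    (.put 1 (.add (.add (.lit 1) (at' 5 6)) (.var 7)) (adj 1 6 7)))).run
      ((Cmd.put 1 (.lit 0) (.lit 1)).run s)) := rfl
  rw [hrun]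
  generalize (Cmd.iter 6 1 (.iter 7 1 (.put 1 (.add (.add (.lit 1) (at' 5 6)) (.var 7))
    (adj 1 6 7)))).run ((Cmd.put 1 (.lit 0) (.lit 1)).run s) = t at hL h1 h2
  have hsq : ((Cmd.set 0 (.add (.var 4) (.lit 1))).run t).reg 0 = n * n + 1 := by
    simp [run, val, hL.sq]
  rw [State.output, hsq, List.range_succ_eq_map, List.map_cons, List.map_map]
  congr 1
  refine List.ext_getElem (by simp [length_matrixBits]) fun k hk hk' => ?_
  have hk₂ : k < n * n := by simpa using hk
  have hn : 0 < n := Nat.pos_of_ne_zero fun h => by simp [h] at hk₂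
  have hu : k / n < n := Nat.div_lt_of_lt_mul hk₂
  have hv : k % n < n := Nat.mod_lt _ hn
  have hkuv : k / n * n + k % n = k := Nat.div_add_mod' k n
  have e := matrixBits_getElem? H.Adj ⟨k / n, hu⟩ ⟨k % n, hv⟩
  simp only [hkuv] at e
  rw [List.getElem?_eq_getElem hk', Option.some_inj] at e
  rw [e, ← h2 ⟨k / n, hu⟩ ⟨k % n, hv⟩ (.inl hu)]
  simp [hkuv, run, add_comm 1 k]

theorem Cmd.run_decide (hs : Loaded 1 G S s) (hC : Prepared S C s)
    (hcov : ∀ u v, G.Adj u v → u ∈ C ∨ v ∈ C) :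
    ∃ b, IsOptCode G S b ∧ (Cmd.decide.run s).output =
      [if b ≠ 0 ∧ b ≤ s.arr 0 0 + 1 then 1 else 0] := by
  refine ⟨_, run_opt hs hC hcov, ?_⟩
  have h0 : ((opt 2).run s).arr 0 = s.arr 0 := run_arr _ rfl s
  simp only [Cmd.decide, run, State.output]
  generalize (opt 2).run s = t at h0 ⊢
  simp only [State.setReg_reg, State.setReg_arr, State.setArr_arr, val, Function.update_self,
    List.range_one, List.map_cons, List.map_nil, Exp.and, Exp.not, Exp.lt, h0]
  congr 1
  by_cases h1 : t.reg 14 = 0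
  · simp [h1]
  · by_cases h2 : t.reg 14 ≤ s.arr 0 0 + 1
    · simp [h1, h2]
    · have : t.reg 14 - (s.arr 0 0 + 1) ≠ 0 := by omega
      simp [h1, h2, this]

theorem Cmd.run_solve (hs : Loaded 0 G S s) (hC : Prepared S C s)
    (hcov : ∀ u v, G.Adj u v → u ∈ C ∨ v ∈ C) :
    ∃ b, IsOptCode G S b ∧ (b = 0 → (solve.run s).output = [0]) ∧
      (b ≠ 0 → ∃ H ≤ G, ConnectsPairs S H ∧ H.edgeSet.ncard + 1 = b ∧
        (solve.run s).output = 1 :: matrixBits H.Adj) := by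
  have hO := run_opt hs hC hcov
  refine ⟨_, hO, fun hb => ?_, fun hb => ?_⟩
  · have : ¬ Holds ((opt 1).run s).arr ((opt 1).run s).reg (.var 14) := fun h => h hb
    rw [solve, run, run_cond_neg this]
    simp [run, State.output, State.setArr_arr, val]
  · have : Holds ((opt 1).run s).arr ((opt 1).run s).reg (.var 14) := hb
    rw [solve, run, run_cond_pos this]
    have hL : Loaded 0 G S ((opt 1).run s) := by
      refine hs.congr ?_ ?_ ?_ ?_
      · rw [run_reg _ rfl]
      · rw [run_reg _ rfl]
      · rw [run_arr _ rfl]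
      · rw [run_arr _ rfl]
    have hP : Prepared S C ((opt 1).run s) := by
      refine hC.congr ?_ ?_ ?_
      · rw [run_reg _ rfl]
      · rw [run_arr _ rfl]
      · rw [run_arr _ rfl]
    obtain ⟨H, hH, hL', hS, hcard⟩ := run_minimize hL hP hcov rfl hO hb
    exact ⟨H, hH, hS, hcard, run_writeMatrix hL'⟩

end

end RAM

/-! ### The running time and the three claims -/

theorem SteinerInstance.exists_cover_card (I : SteinerInstance) :
    ∃ W : Finset (Fin I.n), (∀ u v, I.G.Adj u v → u ∈ W ∨ v ∈ W) ∧ W.card = I.vc := by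
  classical
  obtain ⟨s, hs, hcov⟩ := SimpleGraph.vertexCoverNum_exists I.G
  refine ⟨s.toFinset, fun u v h => by simpa using hcov h, ?_⟩
  rw [SteinerInstance.vc, ← hs, Set.encard_eq_coe_toFinset_card, ENat.toNat_natCast]

/-- Only edges are counted, so a subgraph may be extended to all vertices. The code is the optimum
plus one, whence `l + 1`. -/
theorem IsOptCode.exists_isSteinerForest_iff {V : Type} {G : SimpleGraph V} {S : Set (V × V)}
    {b : ℕ} (h : IsOptCode G S b) (l : ℕ) :
    (∃ F : G.Subgraph, IsSteinerForest S F ∧ F.edgeSet.ncard ≤ l) ↔ b ≠ 0 ∧ b ≤ l + 1 := by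
  constructor
  · rintro ⟨F, hF, hl⟩
    have hP : ∃ H ≤ G, ConnectsPairs S H ∧ H.edgeSet.ncard = F.edgeSet.ncard :=
      ⟨F.spanningCoe, F.spanningCoe_le, hF.connectsPairs, rfl⟩
    rcases h with ⟨rfl, h⟩ | ⟨c, rfl, -, hmin⟩
    · exact absurd hP (h _)
    · have := hmin _ hP
      omega
  · rintro ⟨h0, hl⟩
    rcases h with ⟨rfl, h⟩ | ⟨c, rfl, ⟨H, hH, hS, hc⟩, -⟩
    · exact absurd rfl h0
    · refine ⟨SimpleGraph.toSubgraph H hH, hS.isSteinerForest hH, ?_⟩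
      have : (SimpleGraph.toSubgraph H hH).edgeSet = H.edgeSet := rfl
      rw [this]; omega

namespace RAM

/-- Compilation of three programs, where the first one is without loops, the loops of the second
are bounded by register `1` and those of the third by the registers `1` and `2`. -/
theorem exists_exec_of_fits (c₀ c₁ c₂ : Cmd) (h₀ : c₀.fits 64 [] = true)
    (h₁ : c₁.fits 64 [1] = true) (h₂ : c₂.fits 64 [1, 2] = true) :
    ∃ (P : Prog) (k : ℕ), ∀ (s : State) (n M : ℕ), (c₀.run s).reg 1 = n →
      (c₁.run (c₀.run s)).reg 2 = M → ∃ s' t, Exec P s s' t ∧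
        s'.output = (c₂.run (c₁.run (c₀.run s))).output ∧ t ≤ k * ((n + 1) * (M + 1)) ^ k := by
  obtain ⟨k₀, hk₀⟩ := c₀.polyBounded_time
  obtain ⟨k₁, hk₁⟩ := c₁.polyBounded_time
  obtain ⟨k₂, hk₂⟩ := c₂.polyBounded_time
  refine ⟨.seq (c₀.comp 64) (.seq (c₁.comp 64) (c₂.comp 64)), k₀ + k₁ + k₂, ?_⟩
  intro s n M hn hM
  obtain ⟨s₁, t₁, e₁, a₁, r₁, -, l₁⟩ := c₀.comp_spec h₀ 64 le_rfl s s 0 rfl (fun _ _ => rfl)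
    (by simp)
  obtain ⟨s₂, t₂, e₂, a₂, r₂, -, l₂⟩ := c₁.comp_spec h₁ 64 le_rfl s₁ (c₀.run s) n a₁ r₁
    (by simp [hn])
  have hn₁ : (c₁.run (c₀.run s)).reg 1 = n := by
    rw [c₁.run_reg (c₁.writes_of_fits (by simp) h₁), hn]
  obtain ⟨s₃, t₃, e₃, a₃, r₃, -, l₃⟩ := c₂.comp_spec h₂ 64 le_rfl s₂ (c₁.run (c₀.run s)) (n + M)
    a₂ r₂ (by simp [hn₁, hM])
  refine ⟨s₃, _, e₁.seq (e₂.seq e₃), by rw [State.output, State.output, a₃, r₃ 0 (by simp)], ?_⟩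
  have hB : 1 ≤ (n + 1) * (M + 1) := Nat.one_le_iff_ne_zero.2 (by positivity)
  have hpow : ∀ X k, X + 1 ≤ (n + 1) * (M + 1) → k ≤ k₀ + k₁ + k₂ →
      k * (X + 1) ^ k ≤ k * ((n + 1) * (M + 1)) ^ (k₀ + k₁ + k₂) := fun X k hX hk =>
    Nat.mul_le_mul_left _ ((Nat.pow_le_pow_left hX k).trans (Nat.pow_le_pow_right hB hk))
  have b₁ := (l₁.trans (hk₀ 0)).trans (hpow 0 k₀ hB (by omega))
  have b₂ := (l₂.trans (hk₁ n)).trans (hpow n k₁ (Nat.le_mul_of_pos_right _ (by omega)) (by omega))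
  -- All loops of the third program have length at most `n + M`, and `n + M + 1 ≤ (n + 1) * (M +
  -- 1)`.
  have b₃ := (l₃.trans (hk₂ (n + M))).trans (hpow (n + M) k₂ (by nlinarith) (by omega))
  calc t₁ + (t₂ + t₃) ≤ _ := add_le_add b₁ (add_le_add b₂ b₃)
    _ = _ := by ring

/-- For `κ ≥ 2` use `2 * κ ≤ κ * κ`; the factor `2 ^ 2` in `h2` pays for `κ = 1`, where `κ ^ κ` is
too small. -/
theorem sketches_le {m κ : ℕ} (h : m ≤ 2 * κ) : (m ^ m) ^ 7 ≤ 2 ^ 14 * (κ ^ κ) ^ 28 := by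
  have hpos : 0 < κ ^ κ := Nat.pow_self_pos
  have hmm : m ^ m ≤ (2 * κ) ^ (2 * κ) := by
    rcases Nat.eq_zero_or_pos m with rfl | hm
    · simpa using Nat.one_le_iff_ne_zero.2 (Nat.pow_self_pos (n := 2 * κ)).ne'
    · exact (Nat.pow_le_pow_left h m).trans (Nat.pow_le_pow_right (by omega) h)
  have h2 : (2 * κ) ^ (2 * κ) ≤ 2 ^ 2 * (κ ^ κ) ^ 4 := by
    rcases Nat.lt_or_ge κ 2 with hκ | hκ
    · interval_cases κ <;> simp
    · calc (2 * κ) ^ (2 * κ) ≤ (κ * κ) ^ (2 * κ) :=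
            Nat.pow_le_pow_left (Nat.mul_le_mul_right _ hκ) _
        _ = (κ ^ κ) ^ 4 := by rw [← pow_two, ← pow_mul, ← pow_mul]; congr 1; ring
        _ ≤ 2 ^ 2 * (κ ^ κ) ^ 4 := Nat.le_mul_of_pos_left _ (by norm_num)
  calc (m ^ m) ^ 7 ≤ (2 ^ 2 * (κ ^ κ) ^ 4) ^ 7 := Nat.pow_le_pow_left (hmm.trans h2) 7
    _ = _ := by rw [mul_pow, ← pow_mul, ← pow_mul]

/-- For `κ = 0` both sides are `1`, by the conventions for `logb` and `0 ^ 0`. -/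
theorem two_rpow_mul_logb (κ c : ℕ) :
    (2 : ℝ) ^ (c * (κ * Real.logb 2 κ)) = (((κ ^ κ) ^ c : ℕ) : ℝ) := by
  have h : (2 : ℝ) ^ (κ * Real.logb 2 κ) = ((κ ^ κ : ℕ) : ℝ) := by
    rcases Nat.eq_zero_or_pos κ with rfl | hκ
    · simp
    · rw [mul_comm, Real.rpow_mul (by norm_num), Real.rpow_logb (by norm_num) (by norm_num)
        (by exact_mod_cast hκ), Real.rpow_natCast]
      push_cast; rfl
  rw [mul_comm, Real.rpow_mul (by norm_num), h, Real.rpow_natCast]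
  push_cast; rfl

/-- The bound on the running time. -/
theorem time_le {k n m κ t : ℕ} (hm : m ≤ 2 * κ)
    (ht : t ≤ k * ((n + 1) * ((m ^ m) ^ 7 + 1)) ^ k) :
    (t : ℝ) ≤ (k * (2 ^ 15) ^ k + 28 * k : ℕ) *
      (2 : ℝ) ^ ((k * (2 ^ 15) ^ k + 28 * k : ℕ) * (κ * Real.logb 2 κ)) *
      ((n : ℝ) + 1) ^ (k * (2 ^ 15) ^ k + 28 * k) := by
  rw [two_rpow_mul_logb]
  have hpos : 0 < κ ^ κ := Nat.pow_self_pos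
  have h1 : (m ^ m) ^ 7 + 1 ≤ 2 ^ 15 * (κ ^ κ) ^ 28 := by
    have h := sketches_le hm
    have h2 : 1 ≤ (κ ^ κ) ^ 28 := Nat.one_le_pow _ _ hpos
    generalize (κ ^ κ) ^ 28 = y at h h2 ⊢
    omega
  -- A single constant must serve as coefficient and as both exponents: the first summand absorbs
  -- the coefficient, the second one the exponents `28 * k` and `k`.
  set c := k * (2 ^ 15) ^ k + 28 * k with hc
  have h3 : t ≤ c * (κ ^ κ) ^ c * (n + 1) ^ c := by
    calc t ≤ k * ((n + 1) * (2 ^ 15 * (κ ^ κ) ^ 28)) ^ k :=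
          ht.trans (Nat.mul_le_mul_left _ (Nat.pow_le_pow_left (Nat.mul_le_mul_left _ h1) _))
      _ = (k * (2 ^ 15) ^ k) * (κ ^ κ) ^ (28 * k) * (n + 1) ^ k := by
          rw [mul_pow, mul_pow, ← pow_mul (κ ^ κ)]; ring
      _ ≤ c * (κ ^ κ) ^ c * (n + 1) ^ c := by
          have e1 : k * (2 ^ 15) ^ k ≤ c := Nat.le_add_right _ _
          have e2 : 28 * k ≤ c := Nat.le_add_left _ _
          exact Nat.mul_le_mul (Nat.mul_le_mul e1 (Nat.pow_le_pow_right hpos e2))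
            (Nat.pow_le_pow_right (by omega) (by omega))
  exact_mod_cast h3

/-- After the preparation of the input of the instance `I`, preceded by `p` numbers. -/
theorem exists_prepared (pre : List ℕ) (I : SteinerInstance) {p : ℕ} (hp : pre.length = p) :
    ((Cmd.start p).run (State.init (pre ++ I.encode))).reg 1 = I.n ∧
    ∃ C : Finset (Fin I.n), C.card ≤ 2 * I.vc ∧ (∀ u v, I.G.Adj u v → u ∈ C ∨ v ∈ C) ∧
      Loaded p I.G I.S ((Cmd.prepare (p + 1)).run
        ((Cmd.start p).run (State.init (pre ++ I.encode)))) ∧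
      Prepared I.S C ((Cmd.prepare (p + 1)).run
        ((Cmd.start p).run (State.init (pre ++ I.encode)))) := by
  obtain ⟨h1, h2, h3, h4⟩ := init_cells pre I hp
  have hn : ((Cmd.start p).run (State.init (pre ++ I.encode))).reg 1 = I.n := by
    simpa [Cmd.start, Cmd.run, Exp.val] using h1
  obtain ⟨hL, C, hP, hcov, hmin⟩ := Cmd.run_prepare (p := p) (G := I.G) (S := I.S) hn h2 h3 h4
    (fun i => by simp [Cmd.start, Cmd.run, State.init])
  obtain ⟨W, hW, hcard⟩ := I.exists_cover_card
  exact ⟨hn, C, hcard ▸ hmin W hW, hcov, hL, hP⟩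

theorem exists_decidesWithin : ∃ (c : ℕ) (P : Prog), ∀ (I : SteinerInstance) (l : ℕ),
    P.DecidesWithin (I.encodeWith l) (I.HasSteinerForestOfSize l)
      (c * (2 : ℝ) ^ (c * (I.vc * Real.logb 2 I.vc)) * ((I.n : ℝ) + 1) ^ c) := by
  obtain ⟨P, k, hP⟩ := exists_exec_of_fits (Cmd.start 1) (Cmd.prepare 2) Cmd.decide rfl rfl rfl
  refine ⟨k * (2 ^ 15) ^ k + 28 * k, P, fun I l => ?_⟩
  obtain ⟨hn, C, hC, hcov, hL, hPr⟩ := exists_prepared (p := 1) [l] I rfl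
  obtain ⟨s', t, he, ho, ht⟩ := hP _ _ _ hn hPr.sketches
  obtain ⟨b, hb, hout⟩ := Cmd.run_decide hL hPr hcov
  refine ⟨s', t, he, ?_, time_le hC ht⟩
  rw [ho]
  refine hout.trans ?_
  have e0 : ((Cmd.prepare 2).run ((Cmd.start 1).run (State.init ([l] ++ I.encode)))).arr 0 0 =
      l := by
    rw [Cmd.run_arr _ rfl, Cmd.run_arr _ rfl]
    rfl
  rw [e0]
  have key := hb.exists_isSteinerForest_iff l
  by_cases h : I.HasSteinerForestOfSize l
  · rw [if_pos h, if_pos (key.1 h)]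
  · rw [if_neg h, if_neg fun h' => h (key.2 h')]

theorem exists_solver : ∃ (c : ℕ) (P : Prog), ∀ I : SteinerInstance,
    (I.Feasible → ∃ F : I.G.Subgraph, IsMinSteinerForest I.S F ∧
      P.OutputsWithin I.encode (1 :: matrixBits F.Adj)
        (c * (2 : ℝ) ^ (c * (I.vc * Real.logb 2 I.vc)) * ((I.n : ℝ) + 1) ^ c)) ∧
    (¬ I.Feasible →
      P.OutputsWithin I.encode [0]
        (c * (2 : ℝ) ^ (c * (I.vc * Real.logb 2 I.vc)) * ((I.n : ℝ) + 1) ^ c)) := by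
  obtain ⟨P, k, hP⟩ := exists_exec_of_fits (Cmd.start 0) (Cmd.prepare 1) Cmd.solve rfl rfl rfl
  refine ⟨k * (2 ^ 15) ^ k + 28 * k, P, fun I => ?_⟩
  obtain ⟨hn, C, hC, hcov, hL, hPr⟩ := exists_prepared (p := 0) [] I rfl
  obtain ⟨s', t, he, ho, ht⟩ := hP _ _ _ hn hPr.sketches
  obtain ⟨b, hb, hzero, hpos⟩ := Cmd.run_solve hL hPr hcov
  have ht' := time_le hC ht
  refine ⟨fun ⟨F, hF⟩ => ?_, fun hF => ?_⟩
  · have hb0 := ((hb.exists_isSteinerForest_iff F.edgeSet.ncard).1 ⟨F, hF, le_rfl⟩).1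
    obtain ⟨H, hH, hS, hcard, hout⟩ := hpos hb0
    refine ⟨SimpleGraph.toSubgraph H hH, ⟨hS.isSteinerForest hH, fun F' hF' => ?_⟩,
      s', t, he, ho.trans hout, ht'⟩
    have h1 := ((hb.exists_isSteinerForest_iff F'.edgeSet.ncard).1 ⟨F', hF', le_rfl⟩).2
    have h2 : (SimpleGraph.toSubgraph H hH).edgeSet = H.edgeSet := rfl
    rw [h2]; omega
  · have hb0 : b = 0 := by
      by_contra h
      obtain ⟨F, h1, -⟩ := (hb.exists_isSteinerForest_iff b).2 ⟨h, by omega⟩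
      exact hF ⟨F, h1⟩
    exact ⟨s', t, he, ho.trans (hzero hb0), ht'⟩

theorem primrec₂_pow : Primrec₂ fun a b : ℕ => a ^ b := by
  have h : Primrec₂ fun a b : ℕ => (Nat.rec 1 (fun _ r => r * a) b : ℕ) :=
    Primrec.nat_rec (Primrec.const 1)
      (Primrec.nat_mul.comp (Primrec.snd.comp Primrec.snd) Primrec.fst).to₂
  refine h.of_eq fun a b => ?_
  induction b with
  | zero => rfl
  | succ b ih => rw [pow_succ, ← ih]

theorem le_inputSize (I : SteinerInstance) (l : ℕ) : I.n + 1 ≤ inputSize (I.encodeWith l) := by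
  have h : ∀ x : List ℕ, x.length ≤ inputSize x := by
    intro x
    induction x with
    | nil => simp
    | cons a x ih =>
      simp only [inputSize, List.map_cons, List.sum_cons, List.length_cons] at ih ⊢
      omega
  refine le_trans ?_ (h _)
  simp only [SteinerInstance.encodeWith, SteinerInstance.encode, List.length_cons,
    List.length_append, length_matrixBits]
  nlinarith [Nat.zero_le I.n]

/-- The factor depending on the parameter is `c * (κ ^ κ) ^ c`, which is primitive recursive, and `n
+ 1` is at most the size of the input. -/
theorem fixedParameterTractable : FixedParameterTractable
    (fun a : SteinerInstance × ℕ => a.1.encodeWith a.2)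
    (fun a => a.1.HasSteinerForestOfSize a.2) (fun a => a.1.vc) := by
  obtain ⟨c, P, hP⟩ := exists_decidesWithin
  refine ⟨fun κ => c * (κ ^ κ) ^ c, c, P, ?_, fun ⟨I, l⟩ => ?_⟩
  · refine Primrec.to_comp (Primrec.nat_mul.comp (Primrec.const c)
      (primrec₂_pow.comp (primrec₂_pow.comp Primrec.id Primrec.id) (Primrec.const c)))
  · obtain ⟨s, t, he, ho, ht⟩ := hP I l
    refine ⟨s, t, he, ho, ht.trans ?_⟩
    rw [two_rpow_mul_logb, Nat.cast_mul]
    refine mul_le_mul_of_nonneg_left (pow_le_pow_left₀ (by positivity) ?_ c) (by positivity)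
    exact_mod_cast le_inputSize I l

end RAM

/-- (1) Steiner Forest is fixed-parameter tractable by the vertex cover number `k`; (2) it is decided
in time `2 ^ O(k log k) * n ^ O(1)`, where `n` is the number of vertices; (3) within the same time
one can compute (the adjacency matrix of) a Steiner forest with the minimum number of edges, or report
that there is none. -/
theorem theorem9 :
    RAM.FixedParameterTractable
      (fun a : SteinerInstance × ℕ => a.1.encodeWith a.2)
      (fun a => a.1.HasSteinerForestOfSize a.2)
      (fun a => a.1.vc) ∧
    (∃ (c : ℕ) (P : RAM.Prog), ∀ (I : SteinerInstance) (l : ℕ),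
      P.DecidesWithin (I.encodeWith l) (I.HasSteinerForestOfSize l)
        (c * (2 : ℝ) ^ (c * (I.vc * Real.logb 2 I.vc)) * ((I.n : ℝ) + 1) ^ c)) ∧
    (∃ (c : ℕ) (P : RAM.Prog), ∀ I : SteinerInstance,
      (I.Feasible → ∃ F : I.G.Subgraph, IsMinSteinerForest I.S F ∧
        P.OutputsWithin I.encode (1 :: matrixBits F.Adj)
          (c * (2 : ℝ) ^ (c * (I.vc * Real.logb 2 I.vc)) * ((I.n : ℝ) + 1) ^ c)) ∧
      (¬ I.Feasible →
        P.OutputsWithin I.encode [0]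
          (c * (2 : ℝ) ^ (c * (I.vc * Real.logb 2 I.vc)) * ((I.n : ℝ) + 1) ^ c))) := by
  exact ⟨RAM.fixedParameterTractable, RAM.exists_decidesWithin, RAM.exists_solver⟩
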